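/- Let $n\ge 0$ and $m\ge 1$ be integers. Let $\mathfrak h_n$ be the Siegel upper half-space of complex symmetric $n\times n$ matrices with positive definite imaginary part, on which $\left(\begin{smallmatrix}A&B\\C&D\end{smallmatrix}\right)\in \mathrm{Sp}(2n,\mathbb R)$ acts by $Z\mapsto (AZ+B)(CZ+D)^{-1}$, and let $\Gamma(4m)$ be the principal congruence subgroup of level $4m$ in $\mathrm{Sp}(2n,\mathbb Z)$. Let $\overline{\mathfrak h}_n$ be the Satake partial compactification of $\mathfrak h_n$, i.e. the union of $\mathfrak h_n$ and all its rational boundary components (the $\mathrm{Sp}(2n,\mathbb Q)$-translates of the standard components $F_q\cong\mathfrak h_q$, $0\le q<n$, where $z\in\mathfrak h_q$ is attached as the limit of $\left(\begin{smallmatrix} z&0\\0&iY\end{smallmatrix}\right)$ as all eigenvalues of $Y>0$ tend to $\infty$), with the Satake topology. The involution $\tau(Z)=-\overline Z$ of $\mathfrak h_n$ extends to $\overline{\mathfrak h}_n$. For $\gamma\in\Gamma(4m)$ put $\mathfrak h_n^{\gamma}=\{Z\in\mathfrak h_n : \gamma Z=\tau(Z)\}$ and $\mathfrak h_n^{\Gamma(4m)}=\bigcup_{\gamma\in\Gamma(4m)}\mathfrak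 h_n^{\gamma}$, and for a rational boundary component $F$ put $F^{\gamma}=\{x\in F : \tau(x)=\gamma x\}$. Let $V=\Gamma(4m)\backslash\overline{\mathfrak h}_n$ be the Baily--Borel compactification of $X=\Gamma(4m)\backslash\mathfrak h_n$, with the quotient topology, and let $\pi:\overline{\mathfrak h}_n\to V$ be the projection. Let $\tau$ also denote the induced involution (complex conjugation) of $V$, let $V_{\mathbb R}$ be its set of fixed points and $X_{\mathbb R}=X\cap V_{\mathbb R}$. Let $V^r$ be the union of the sets $\pi(F)$ over all rational boundary components $F$ of rank $n-r$ (for $r=0$, $F=\mathfrak h_n$), and let $V^r_{\mathbb R}=V^r\cap V_{\mathbb R}$. 1. Let $F$ be a rational boundary component of rank $n-1$, let $\gamma\in\Gamma(4m)$, and suppose that $F^{\gamma}\neq\emptyset$. Then $F^{\gamma}$ is contained in the closure of $\mathfrak h_n^{\Gamma(4m)}$ in $\overline{\mathfrak h}_n$. 2. Consequently, if $\overline{X}_{\mathbb R}$ denotes the closure of $X_{\mathbb R}$ in $V$, then $$V^0_{\mathbb R}\cup V^1_{\mathbb R}\subset \overline{X}_{\mathbb R}\subset V_{\mathbb R}.$$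 -/

import Mathlib

open Matrix

noncomputable section

namespace RealSatake

/-! ### The Siegel upper half-space and its real points -/

/-- The Siegel upper half-space `𝔥_n`: complex symmetric matrices with positive definite imaginary
part. -/
def siegel (n : ℕ) : Set (Matrix (Fin n) (Fin n) ℂ) :=
  {Z | Zᵀ = Z ∧ (Z.map Complex.im).PosDef}

/-- The group `Sp(2n, ℚ)`. -/
abbrev SpQ (n : ℕ) : Type := symplecticGroup (Fin n) ℚ

/-- The complex matrix underlying an element of `Sp(2n, ℚ)`. -/
def toC {n : ℕ} (g : SpQ n) : Matrix (Fin n ⊕ Fin n) (Fin n ⊕ Fin n) ℂ :=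
  (g : Matrix (Fin n ⊕ Fin n) (Fin n ⊕ Fin n) ℚ).map (algebraMap ℚ ℂ)

/-- The principal congruence subgroup `Γ(N) ⊆ Sp(2n, ℤ)` of integral symplectic matrices congruent
to the identity modulo `N`, as a subgroup of `Sp(2n, ℚ)`. In particular `Γ(1) = Sp(2n, ℤ)`. -/
def congruenceSubgroup (n N : ℕ) : Subgroup (SpQ n) where
  carrier := {g | ∃ M : Matrix (Fin n ⊕ Fin n) (Fin n ⊕ Fin n) ℤ,
    (g : Matrix (Fin n ⊕ Fin n) (Fin n ⊕ Fin n) ℚ) = 1 + (N : ℚ) • M.map (Int.castRingHom ℚ)}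
  mul_mem' := by
    rintro a b ⟨A, hA⟩ ⟨B, hB⟩
    refine ⟨A + B + (N : ℤ) • (A * B), ?_⟩
    have h : (A + B + (N : ℤ) • (A * B)).map (Int.castRingHom ℚ)
        = A.map (Int.castRingHom ℚ) + B.map (Int.castRingHom ℚ)
          + (N : ℚ) • (A.map (Int.castRingHom ℚ) * B.map (Int.castRingHom ℚ)) := by
      rw [← Matrix.map_mul]
      ext i j
      simp only [Matrix.map_apply, Matrix.add_apply, Matrix.smul_apply, smul_eq_mul, map_add,
        map_mul, eq_intCast, Int.cast_natCast]
    rw [Submonoid.coe_mul, hA, hB, h]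
    simp only [Matrix.add_mul, Matrix.mul_add, Matrix.one_mul, Matrix.mul_one, smul_add,
      Matrix.smul_mul, Matrix.mul_smul]
    abel
  one_mem' := ⟨0, by ext i j; simp⟩
  inv_mem' := by
    rintro a ⟨A, hA⟩
    refine ⟨(-J (Fin n) ℤ) * Aᵀ * J (Fin n) ℤ, ?_⟩
    have h : ((-J (Fin n) ℤ) * Aᵀ * J (Fin n) ℤ).map (Int.castRingHom ℚ)
        = (-J (Fin n) ℚ) * (A.map (Int.castRingHom ℚ))ᵀ * J (Fin n) ℚ := by
      rw [Matrix.map_mul, Matrix.map_mul, Matrix.map_neg _ (by simp), map_J, transpose_map]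
    rw [SymplecticGroup.coe_inv, hA, h]
    simp [Matrix.mul_add, Matrix.add_mul, J_squared, add_comm]

/-- The Möbius transformation `g Z = (A Z + B) (C Z + D)⁻¹`. -/
def moebius {n : ℕ} (g : SpQ n) (Z : Matrix (Fin n) (Fin n) ℂ) : Matrix (Fin n) (Fin n) ℂ :=
  ((toC g).toBlocks₁₁ * Z + (toC g).toBlocks₁₂) * ((toC g).toBlocks₂₁ * Z + (toC g).toBlocks₂₂)⁻¹

/-- The set `𝔥_n^γ` of `γ`-real points: `γ Z = τ(Z) = -Z̄`. -/
def realLocus {n : ℕ} (γ : SpQ n) : Set (siegel n) :=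
  {Z | moebius γ Z.1 = -Z.1.map (starRingEnd ℂ)}

/-- The set `𝔥_n^Γ` of `Γ`-real points: the union of the `𝔥_n^γ` over `γ ∈ Γ`. -/
def groupRealLocus {n : ℕ} (Γ : Subgroup (SpQ n)) : Set (siegel n) :=
  ⋃ γ ∈ Γ, realLocus γ

/-! ### The action on linear subspaces of `ℂ²ⁿ` -/

/-- Linear subspaces of `ℂ²ⁿ = ℂⁿ ⊕ ℂⁿ`. The compact dual of `𝔥_n` is the Grassmannian of
Lagrangian subspaces, in which `Z ∈ 𝔥_n` is the subspace `{(Z u, u)}`. -/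
abbrev LinSub (n : ℕ) : Type := Submodule ℂ (Fin n ⊕ Fin n → ℂ)

/-- `Sp(2n, ℚ)` acts on subspaces by `L ↦ g L`. -/
def actSub {n : ℕ} (g : SpQ n) (L : LinSub n) : LinSub n := L.map (toC g).mulVecLin

/-- The antilinear involution `(a, b) ↦ (-ā, b̄)` of `ℂ²ⁿ`; it maps `{(Z u, u)}` onto
`{(-Z̄ u, u)}`. -/
def conjVec (n : ℕ) : (Fin n ⊕ Fin n → ℂ) →ₛₗ[starRingEnd ℂ] (Fin n ⊕ Fin n → ℂ) where
  toFun v := Sum.elim (fun i => -starRingEnd ℂ (v (Sum.inl i)))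
    (fun i => starRingEnd ℂ (v (Sum.inr i)))
  map_add' v w := by
    ext i
    rcases i with i | i <;> simp [add_comm]
  map_smul' c v := by
    ext i
    rcases i with i | i <;> simp

/-- The involution `τ` on subspaces (image and preimage under `conjVec` are the same). -/
def tauSub {n : ℕ} (L : LinSub n) : LinSub n := L.comap (conjVec n)

/-- The matrix `I₋ = diag(-I, I)`. -/
def Iminus (n : ℕ) (R : Type*) [CommRing R] : Matrix (Fin n ⊕ Fin n) (Fin n ⊕ Fin n) R :=
  fromBlocks (-1) 0 0 1

theorem Iminus_sq (n : ℕ) (R : Type*) [CommRing R] : Iminus n R * Iminus n R = 1 := by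
  simp [Iminus, fromBlocks_multiply]

theorem Iminus_J (n : ℕ) (R : Type*) [CommRing R] :
    Iminus n R * J (Fin n) R * Iminus n R = -J (Fin n) R := by
  simp [Iminus, J, fromBlocks_multiply, fromBlocks_neg]

theorem Iminus_transpose (n : ℕ) (R : Type*) [CommRing R] : (Iminus n R)ᵀ = Iminus n R := by
  simp [Iminus, fromBlocks_transpose]

/-- The involution `τ(g) = I₋ g I₋` of `Sp(2n, ℚ)`. -/
def tauSp {n : ℕ} (g : SpQ n) : SpQ n :=
  ⟨Iminus n ℚ * g.1 * Iminus n ℚ, by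
    have hg := SymplecticGroup.mem_iff.1 g.2
    rw [SymplecticGroup.mem_iff]
    simp only [transpose_mul, Iminus_transpose]
    calc Iminus n ℚ * g.1 * Iminus n ℚ * J (Fin n) ℚ * (Iminus n ℚ * (g.1ᵀ * Iminus n ℚ))
        = Iminus n ℚ * (g.1 * (Iminus n ℚ * J (Fin n) ℚ * Iminus n ℚ) * g.1ᵀ) * Iminus n ℚ := by
          simp only [Matrix.mul_assoc]
      _ = J (Fin n) ℚ := by
          rw [Iminus_J, Matrix.mul_neg, Matrix.neg_mul, hg, Matrix.mul_neg, Matrix.neg_mul,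
            Iminus_J, neg_neg]⟩

theorem tauSp_mem {n N : ℕ} {g : SpQ n} (hg : g ∈ congruenceSubgroup n N) :
    tauSp g ∈ congruenceSubgroup n N := by
  obtain ⟨M, hM⟩ := hg
  refine ⟨Iminus n ℤ * M * Iminus n ℤ, ?_⟩
  have hI : (Iminus n ℤ).map (Int.castRingHom ℚ) = Iminus n ℚ := by
    simp [Iminus, fromBlocks_map, Matrix.map_neg]
  rw [Matrix.map_mul, Matrix.map_mul, hI]
  simp [tauSp, hM, Matrix.mul_add, Matrix.add_mul, Iminus_sq]

theorem actSub_one {n : ℕ} (L : LinSub n) : actSub 1 L = L := by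
  have h : toC (1 : SpQ n) = 1 := by simp [toC]
  simp [actSub, h]

theorem actSub_mul {n : ℕ} (g h : SpQ n) (L : LinSub n) :
    actSub (g * h) L = actSub g (actSub h L) := by
  have e : toC (g * h) = toC g * toC h := by simp [toC, Matrix.map_mul]
  simp [actSub, e, mulVecLin_mul, Submodule.map_comp]

theorem conjVec_conjVec {n : ℕ} (v : Fin n ⊕ Fin n → ℂ) : conjVec n (conjVec n v) = v := by
  ext i
  rcases i with i | i <;> simp [conjVec]

theorem tauSub_tauSub {n : ℕ} (L : LinSub n) : tauSub (tauSub L) = L := by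
  ext v
  simp [tauSub, conjVec_conjVec]

theorem conjVec_mulVec {n : ℕ} (g : SpQ n) (v : Fin n ⊕ Fin n → ℂ) :
    conjVec n (toC g *ᵥ v) = toC (tauSp g) *ᵥ conjVec n v := by
  have e : toC (tauSp g) = Iminus n ℂ * toC g * Iminus n ℂ := by
    simp [toC, tauSp, Matrix.map_mul, Iminus, fromBlocks_map, Matrix.map_neg]
  have c : ∀ w : Fin n ⊕ Fin n → ℂ,
      conjVec n w = Iminus n ℂ *ᵥ (fun i => starRingEnd ℂ (w i)) := by
    intro w
    ext i
    rcases i with i | i <;> simp [conjVec, Iminus, fromBlocks_mulVec, neg_mulVec]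
  have d : (fun i => starRingEnd ℂ ((toC g *ᵥ v) i))
      = toC g *ᵥ (fun i => starRingEnd ℂ (v i)) := by
    ext i
    simp only [mulVec, dotProduct, map_sum, map_mul, toC, Matrix.map_apply, eq_ratCast,
      map_ratCast]
  rw [e, c, c, d, mulVec_mulVec, mulVec_mulVec, Matrix.mul_assoc, Iminus_sq, Matrix.mul_one]

theorem tauSub_actSub {n : ℕ} (g : SpQ n) (L : LinSub n) :
    tauSub (actSub g L) = actSub (tauSp g) (tauSub L) := by
  ext v
  simp only [tauSub, actSub, Submodule.mem_comap, Submodule.mem_map, mulVecLin_apply]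
  constructor
  · rintro ⟨w, hw, h⟩
    exact ⟨conjVec n w, by rwa [conjVec_conjVec], by
      rw [← conjVec_mulVec, h, conjVec_conjVec]⟩
  · rintro ⟨w, hw, h⟩
    refine ⟨conjVec n w, hw, ?_⟩
    have := congrArg (conjVec n) h
    rw [← conjVec_conjVec (toC g *ᵥ conjVec n w), conjVec_mulVec, conjVec_conjVec, h]

/-! ### The Satake partial compactification -/

/-- The point `φ_q(z) = {((z u, w), (u, 0)) : u ∈ ℂ^q, w ∈ ℂ^(n-q)}` of the compact dual. For
`z ∈ 𝔥_q` it is the limit of the points `diag(z, i Y) ∈ 𝔥_n` as all eigenvalues of the positive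
definite matrix `Y` tend to infinity; for `q = n` it is the point `z` of `𝔥_n` itself. -/
def stdSub {n q : ℕ} (hq : q ≤ n) (z : Matrix (Fin q) (Fin q) ℂ) : LinSub n where
  carrier := {v | (∀ i : Fin q, v (Sum.inl (Fin.castLE hq i))
      = ∑ j, z i j * v (Sum.inr (Fin.castLE hq j))) ∧
    ∀ i : Fin n, q ≤ (i : ℕ) → v (Sum.inr i) = 0}
  add_mem' := by
    rintro v w ⟨hv, hv'⟩ ⟨hw, hw'⟩
    refine ⟨fun i => ?_, fun i hi => ?_⟩
    · simp [hv i, hw i, mul_add, Finset.sum_add_distrib]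
    · simp [hv' i hi, hw' i hi]
  zero_mem' := by simp
  smul_mem' := by
    rintro c v ⟨hv, hv'⟩
    refine ⟨fun i => ?_, fun i hi => ?_⟩
    · simp [hv i, Finset.mul_sum, mul_left_comm]
    · simp [hv' i hi]

/-- The underlying set `𝔥̄_n` of the Satake partial compactification: the union of all rational
boundary components (including `𝔥_n` itself), that is, of the `Sp(2n, ℚ)`-translates of the
standard ones `F_q = φ_q(𝔥_q)`, `0 ≤ q ≤ n`. -/
def Satake (n : ℕ) : Type :=
  {L : LinSub n // ∃ (q : ℕ) (hq : q ≤ n) (g : SpQ n), ∃ z ∈ siegel q, L = actSub g (stdSub hq z)}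

/-- The action of `Sp(2n, ℚ)` on `𝔥̄_n`. -/
instance (n : ℕ) : MulAction (SpQ n) (Satake n) where
  smul g x := ⟨actSub g x.1, by
    obtain ⟨q, hq, h, z, hz, e⟩ := x.2
    exact ⟨q, hq, g * h, z, hz, by rw [e, actSub_mul]⟩⟩
  one_smul x := Subtype.ext (actSub_one x.1)
  mul_smul g h x := Subtype.ext (actSub_mul g h x.1)

theorem smul_val {n : ℕ} (g : SpQ n) (x : Satake n) : (g • x).1 = actSub g x.1 := rfl

/-- The attaching map `φ_q : 𝔥_q → 𝔥̄_n` of the standard boundary component of rank `q`. -/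
def std {n q : ℕ} (hq : q ≤ n) (z : siegel q) : Satake n :=
  ⟨stdSub hq z.1, q, hq, 1, z.1, z.2, (actSub_one _).symm⟩

/-- The inclusion `𝔥_n → 𝔥̄_n`. -/
def incl (n : ℕ) : siegel n → Satake n := std le_rfl

/-- `F` is a rational boundary component of rank `q`: a translate by an element of `Sp(2n, ℚ)` of
the standard one `F_q`. The case `q = n` is the improper component `𝔥_n`. -/
def IsRationalBoundaryComponent {n : ℕ} (q : ℕ) (F : Set (Satake n)) : Prop :=
  ∃ (hq : q ≤ n) (g : SpQ n), F = Set.range (fun z : siegel q => g • std hq z)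

theorem neg_conj_mem_siegel {q : ℕ} {z : Matrix (Fin q) (Fin q) ℂ} (hz : z ∈ siegel q) :
    -z.map (starRingEnd ℂ) ∈ siegel q := by
  obtain ⟨h, h'⟩ := hz
  refine ⟨?_, ?_⟩
  · rw [transpose_neg, ← transpose_map, h]
  · have e : (-z.map (starRingEnd ℂ)).map Complex.im = z.map Complex.im := by
      ext i j
      simp
    rwa [e]

theorem tauSub_stdSub {n q : ℕ} (hq : q ≤ n) (z : Matrix (Fin q) (Fin q) ℂ) :
    tauSub (stdSub hq z) = stdSub hq (-z.map (starRingEnd ℂ)) := by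
  ext v
  have key : ∀ i : Fin q, (-starRingEnd ℂ (v (Sum.inl (Fin.castLE hq i)))
        = ∑ j, z i j * starRingEnd ℂ (v (Sum.inr (Fin.castLE hq j)))) ↔
      (v (Sum.inl (Fin.castLE hq i))
        = ∑ j, (-z.map (starRingEnd ℂ)) i j * v (Sum.inr (Fin.castLE hq j))) := by
    intro i
    rw [← (RingHom.injective (starRingEnd ℂ)).eq_iff]
    simp only [map_neg, map_sum, map_mul, Complex.conj_conj, Matrix.neg_apply, Matrix.map_apply,
      neg_mul, Finset.sum_neg_distrib]
    exact neg_eq_iff_eq_neg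
  have h1 : v ∈ tauSub (stdSub hq z) ↔
      (∀ i : Fin q, -starRingEnd ℂ (v (Sum.inl (Fin.castLE hq i)))
        = ∑ j, z i j * starRingEnd ℂ (v (Sum.inr (Fin.castLE hq j)))) ∧
      ∀ i : Fin n, q ≤ (i : ℕ) → starRingEnd ℂ (v (Sum.inr i)) = 0 := Iff.rfl
  have h2 : v ∈ stdSub hq (-z.map (starRingEnd ℂ)) ↔
      (∀ i : Fin q, v (Sum.inl (Fin.castLE hq i))
        = ∑ j, (-z.map (starRingEnd ℂ)) i j * v (Sum.inr (Fin.castLE hq j))) ∧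
      ∀ i : Fin n, q ≤ (i : ℕ) → v (Sum.inr i) = 0 := Iff.rfl
  rw [h1, h2, forall_congr' key]
  simp

/-- The involution `τ` of `𝔥̄_n`, the extension of `Z ↦ -Z̄`. -/
def tau {n : ℕ} (x : Satake n) : Satake n :=
  ⟨tauSub x.1, by
    obtain ⟨q, hq, g, z, hz, e⟩ := x.2
    exact ⟨q, hq, tauSp g, _, neg_conj_mem_siegel hz, by
      rw [e, tauSub_actSub, tauSub_stdSub]⟩⟩

theorem tau_smul {n : ℕ} (g : SpQ n) (x : Satake n) : tau (g • x) = tauSp g • tau x :=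
  Subtype.ext (tauSub_actSub g x.1)

/-- The set `F^γ` of `γ`-real points of `F`: the `x ∈ F` with `τ(x) = γ x`. -/
def componentReal {n : ℕ} (F : Set (Satake n)) (γ : SpQ n) : Set (Satake n) :=
  {x | x ∈ F ∧ tau x = γ • x}

/-! ### The Satake topology -/

/-- The subgroup of `Sp(2n, ℤ)` fixing the standard boundary component `F_q` pointwise. It contains
the integral points of the unipotent radical of the normalizer of `F_q`, and `GL(n-q, ℤ)`. -/
def fixer {n q : ℕ} (hq : q ≤ n) : Set (SpQ n) :=
  {δ | δ ∈ congruenceSubgroup n 1 ∧ ∀ w : siegel q, δ • std hq w = std hq w}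

/-- The basic Satake neighbourhoods of the points of `F_q`, given by an open set `V` and a large
real number `k`. On the standard component of rank `r`, with `q ≤ r ≤ n`, take the cylindrical set
of all `Z ∈ 𝔥_r` whose upper left `q × q` block lies in `V` and for which
`Im Z - diag(0_q, k I_(r-q))` is still positive definite. The neighbourhood is the saturation of
the union of these sets under the integral elements that fix `F_q` pointwise. -/
def basicNhd {n q : ℕ} (hq : q ≤ n) (V : Set (Matrix (Fin q) (Fin q) ℂ)) (k : ℝ) :
    Set (Satake n) :=
  {y | ∃ (r : ℕ) (hr : r ≤ n) (hqr : q ≤ r) (Z : siegel r),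
    Z.1.submatrix (Fin.castLE hqr) (Fin.castLE hqr) ∈ V ∧
    (Z.1.map Complex.im
      - k • Matrix.diagonal (fun i : Fin r => if q ≤ (i : ℕ) then (1 : ℝ) else 0)).PosDef ∧
    ∃ δ ∈ fixer hq, y = δ • std hr Z}

theorem basicNhd_mono {n q : ℕ} (hq : q ≤ n) {V V' : Set (Matrix (Fin q) (Fin q) ℂ)} {k k' : ℝ}
    (hV : V ⊆ V') (hk : k' ≤ k) : basicNhd hq V k ⊆ basicNhd hq V' k' := by
  rintro y ⟨r, hr, hqr, Z, hZ, hp, hδ⟩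
  refine ⟨r, hr, hqr, Z, hV hZ, ?_, hδ⟩
  have hs : ((k - k') • Matrix.diagonal
      (fun i : Fin r => if q ≤ (i : ℕ) then (1 : ℝ) else 0)).PosSemidef := by
    refine Matrix.PosSemidef.smul (Matrix.PosSemidef.diagonal ?_) (sub_nonneg.2 hk)
    intro i
    simp only [Pi.zero_apply]
    split_ifs <;> norm_num
  have := hp.add_posSemidef hs
  rw [sub_smul] at this
  simpa using this

/-- The Satake topology on `𝔥̄_n`: a set is open if with each of its points `x = g φ_q(z)`,
`g ∈ Sp(2n, ℚ)`, it contains the `g`-translate of a basic neighbourhood of `φ_q(z)`. (The group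
`Sp(2n, ℚ)` acts by homeomorphisms, and on `𝔥_n` this is the usual topology.) -/
instance (n : ℕ) : TopologicalSpace (Satake n) where
  IsOpen U := ∀ (q : ℕ) (hq : q ≤ n) (g : SpQ n) (z : siegel q), g • std hq z ∈ U →
    ∃ V : Set (Matrix (Fin q) (Fin q) ℂ), IsOpen V ∧ z.1 ∈ V ∧
      ∃ k : ℝ, 0 < k ∧ ∀ y ∈ basicNhd hq V k, g • y ∈ U
  isOpen_univ := fun q hq g z _ => ⟨Set.univ, isOpen_univ, trivial, 1, one_pos, fun _ _ => trivial⟩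
  isOpen_inter := by
    intro U U' hU hU' q hq g z hz
    obtain ⟨V, hV, hzV, k, hk, h⟩ := hU q hq g z hz.1
    obtain ⟨V', hV', hzV', k', hk', h'⟩ := hU' q hq g z hz.2
    refine ⟨V ∩ V', hV.inter hV', ⟨hzV, hzV'⟩, max k k', lt_max_of_lt_left hk, fun y hy => ⟨?_, ?_⟩⟩
    · exact h y (basicNhd_mono hq Set.inter_subset_left (le_max_left _ _) hy)
    · exact h' y (basicNhd_mono hq Set.inter_subset_right (le_max_right _ _) hy)
  isOpen_sUnion := by
    intro S hS q hq g z hz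
    obtain ⟨U, hUS, hzU⟩ := hz
    obtain ⟨V, hV, hzV, k, hk, h⟩ := hS U hUS q hq g z hzU
    exact ⟨V, hV, hzV, k, hk, fun y hy => ⟨U, hUS, h y hy⟩⟩

/-! ### The Baily-Borel compactification and its real points -/

/-- The Baily-Borel (Satake) compactification `V = Γ(N) \ 𝔥̄_n` of `X = Γ(N) \ 𝔥_n`, as a topological
space with the quotient topology. -/
abbrev BailyBorel (n N : ℕ) : Type :=
  Quotient (MulAction.orbitRel (congruenceSubgroup n N) (Satake n))

/-- The projection `π : 𝔥̄_n → V`. -/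
def proj (n N : ℕ) (x : Satake n) : BailyBorel n N :=
  Quotient.mk (MulAction.orbitRel (congruenceSubgroup n N) (Satake n)) x

/-- The involution (complex conjugation) `τ` of `V`. -/
def tauV (n N : ℕ) : BailyBorel n N → BailyBorel n N :=
  Quotient.map tau (by
    rintro x y ⟨⟨γ, hγ⟩, h⟩
    refine ⟨⟨tauSp γ, tauSp_mem hγ⟩, ?_⟩
    have h' : γ • y = x := h
    change tauSp γ • tau y = tau x
    rw [← tau_smul, h'])

/-- The real points `V_ℝ` of `V`. -/
def VReal (n N : ℕ) : Set (BailyBorel n N) := {v | tauV n N v = v}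

/-- The stratum `V^r`: the union of the images of the rational boundary components of rank
`n - r`. -/
def stratum (n N r : ℕ) : Set (BailyBorel n N) :=
  {v | ∃ (q : ℕ) (F : Set (Satake n)), q + r = n ∧ IsRationalBoundaryComponent q F ∧
    v ∈ proj n N '' F}

/-- The real points `V^r_ℝ = V^r ∩ V_ℝ` of the stratum `V^r`. -/
def stratumReal (n N r : ℕ) : Set (BailyBorel n N) := stratum n N r ∩ VReal n N

/-- The real points `X_ℝ` of `X = Γ(N) \ 𝔥_n`: the `τ`-fixed points in the image of `𝔥_n`. -/
def XReal (n N : ℕ) : Set (BailyBorel n N) :=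
  {v | v ∈ Set.range (fun Z : siegel n => proj n N (incl n Z)) ∧ tauV n N v = v}

end RealSatake

end

open Matrix

noncomputable section

namespace RealSatake

/-! ### The symplectic form, the antilinear maps `conjVec ∘ h`, and the Hermitian form -/

/-! A point `x` is a Lagrangian subspace `L` of `ℂ²ⁿ`, and `tau x = h • x` says that the antilinear
map `σ = sig h` maps `L` into itself (`tau_std_iff`). Since `h` is rational, `σ` commutes with
coordinatewise conjugation and sends `ω` to minus its conjugate. Hence it preserves the Hermitian
form `herm`, which on `L` is positive semidefinite with kernel the span of the real vectors of `L`.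
Everything rests on such isometries having bounded denominators: a real vector `2 Re ℓ` with `ℓ ∈ L`
and `herm ℓ` small has small coordinates in the relevant directions, so these vanish once they are
known to lie in `d⁻¹ℤ`.

Density at corank one. Let `b` be the primitive integral vector of the component, so `σ b = ± b`.
For `γ ∈ Γ(4m)` the square `σ²` is `1 + 8m S` with `S` integral (`tauSp_mul_self`). As `σ²` is a
`herm`-isometry close to `1`, `herm` shrinks along the powers of `S` on the Lagrangian; integrality
makes it vanish at a high power, and a descent by the parallelogram law brings this down to the
first power. So `σ² = 1` on `b^⊥ / b` (`mulVec_eq_zero`). The remaining defect of `σ²` on `b^⊥` is a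
pairing against `8m S f`; because `8m` is twice the level, half of it is a unipotent element of
`Γ(4m)`, and multiplying by it makes `σ` an involution on `b^⊥` (`exists_involutive`). Then `σ` acts
on the points of `𝔥_n` lying over `z`, and a fixed point amounts to an equivariant splitting of `L`
and one equation for the real part of the last diagonal entry `t`. The imaginary part of `t` stays
free, so fixed points go arbitrarily far up towards the boundary (`exists_real_point`). Projecting
to `V` gives the first inclusion.

Closedness of `V_ℝ`. An element that is real at a point near the boundary and has bounded
denominators preserves the flag of the boundary component, so it is real at the projection of that
point to the component (`stable_of_close`). On the component only finitely many actions with bounded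
denominators occur near `z`, and reality for each is a closed condition, so it passes to `z`
(`exists_nhd_stable`). The denominator bound depends only on the translate `g`, not on the elements
of `Γ`, which yields `isClosed_VReal`. -/

/-- The standard symplectic form on `ℂ²ⁿ`. -/
def om (n : ℕ) : (Fin n ⊕ Fin n → ℂ) →ₗ[ℂ] (Fin n ⊕ Fin n → ℂ) →ₗ[ℂ] ℂ :=
  Matrix.toLinearMap₂' ℂ (J (Fin n) ℂ)

theorem om_eq {n : ℕ} (v w : Fin n ⊕ Fin n → ℂ) :
    om n v w = v ⬝ᵥ (J (Fin n) ℂ *ᵥ w) := by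
  simp [om, Matrix.toLinearMap₂'_apply']

theorem om_apply {n : ℕ} (v w : Fin n ⊕ Fin n → ℂ) :
    om n v w = ∑ i, (v (Sum.inr i) * w (Sum.inl i) - v (Sum.inl i) * w (Sum.inr i)) := by
  rw [om_eq]
  simp [J, dotProduct, fromBlocks_mulVec, neg_mulVec, Finset.sum_sub_distrib]
  ring

theorem om_swap {n : ℕ} (v w : Fin n ⊕ Fin n → ℂ) : om n v w = -om n w v := by
  simp only [om_apply, ← Finset.sum_neg_distrib]
  exact Finset.sum_congr rfl fun i _ => by ring

theorem om_self {n : ℕ} (v : Fin n ⊕ Fin n → ℂ) : om n v v = 0 := by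
  simp only [om_apply]
  exact Finset.sum_eq_zero fun i _ => by ring

theorem toC_mul {n : ℕ} (g h : SpQ n) : toC (g * h) = toC g * toC h := by
  simp [toC, Matrix.map_mul]

theorem toC_one {n : ℕ} : toC (1 : SpQ n) = 1 := by simp [toC]

theorem toC_mul_mulVec {n : ℕ} (g h : SpQ n) (v : Fin n ⊕ Fin n → ℂ) :
    toC (g * h) *ᵥ v = toC g *ᵥ (toC h *ᵥ v) := by
  rw [toC_mul, mulVec_mulVec]

theorem toC_inv_mulVec {n : ℕ} (g : SpQ n) (v : Fin n ⊕ Fin n → ℂ) :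
    toC g⁻¹ *ᵥ (toC g *ᵥ v) = v := by
  rw [← toC_mul_mulVec, inv_mul_cancel, toC_one, one_mulVec]

theorem toC_mulVec_inv {n : ℕ} (g : SpQ n) (v : Fin n ⊕ Fin n → ℂ) :
    toC g *ᵥ (toC g⁻¹ *ᵥ v) = v := by
  rw [← toC_mul_mulVec, mul_inv_cancel, toC_one, one_mulVec]

theorem om_toC {n : ℕ} (g : SpQ n) (v w : Fin n ⊕ Fin n → ℂ) :
    om n (toC g *ᵥ v) (toC g *ᵥ w) = om n v w := by
  have h := SymplecticGroup.mem_iff'.1 g.2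
  have h' : (toC g)ᵀ * J (Fin n) ℂ * toC g = J (Fin n) ℂ := by
    have := congrArg (fun M => M.map (algebraMap ℚ ℂ)) h
    simp only [Matrix.map_mul, map_J] at this
    exact this
  rw [om_eq, om_eq, ← vecMul_transpose, mulVec_mulVec, ← dotProduct_mulVec, mulVec_mulVec,
    ← Matrix.mul_assoc, h']

theorem om_conjVec {n : ℕ} (v w : Fin n ⊕ Fin n → ℂ) :
    om n (conjVec n v) (conjVec n w) = -star (om n v w) := by
  simp only [om_apply, conjVec, star_sum, ← Finset.sum_neg_distrib]
  exact Finset.sum_congr rfl fun i _ => by simp; ring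

theorem conjVec_star {n : ℕ} (v : Fin n ⊕ Fin n → ℂ) :
    conjVec n (star v) = star (conjVec n v) := by
  ext i
  rcases i with i | i <;> simp [conjVec]

theorem toC_mulVec_star {n : ℕ} (g : SpQ n) (v : Fin n ⊕ Fin n → ℂ) :
    toC g *ᵥ star v = star (toC g *ᵥ v) := by
  ext i
  simp [mulVec, dotProduct, toC]

/-- The antilinear map `v ↦ conjVec (h v)`. -/
def sig {n : ℕ} (h : SpQ n) : (Fin n ⊕ Fin n → ℂ) →ₛₗ[starRingEnd ℂ] (Fin n ⊕ Fin n → ℂ) :=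
  (conjVec n).comp (toC h).mulVecLin

theorem sig_apply {n : ℕ} (h : SpQ n) (v : Fin n ⊕ Fin n → ℂ) :
    sig h v = conjVec n (toC h *ᵥ v) := rfl

theorem om_sig {n : ℕ} (h : SpQ n) (v w : Fin n ⊕ Fin n → ℂ) :
    om n (sig h v) (sig h w) = -star (om n v w) := by
  rw [sig_apply, sig_apply, om_conjVec, om_toC]

theorem sig_star {n : ℕ} (h : SpQ n) (v : Fin n ⊕ Fin n → ℂ) :
    sig h (star v) = star (sig h v) := by
  rw [sig_apply, sig_apply, toC_mulVec_star, conjVec_star]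

theorem sig_sig {n : ℕ} (h : SpQ n) (v : Fin n ⊕ Fin n → ℂ) :
    sig h (sig h v) = toC (tauSp h * h) *ᵥ v := by
  rw [sig_apply, sig_apply, conjVec_mulVec, conjVec_conjVec, toC_mul_mulVec]

theorem tauSp_mul {n : ℕ} (g h : SpQ n) : tauSp (g * h) = tauSp g * tauSp h := by
  apply Subtype.ext
  change Iminus n ℚ * (g.1 * h.1) * Iminus n ℚ
    = Iminus n ℚ * g.1 * Iminus n ℚ * (Iminus n ℚ * h.1 * Iminus n ℚ)
  calc _ = Iminus n ℚ * g.1 * (1 * h.1) * Iminus n ℚ := by simp only [Matrix.mul_assoc, Matrix.one_mul]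
    _ = _ := by rw [← Iminus_sq]; simp only [Matrix.mul_assoc]

theorem tauSp_tauSp {n : ℕ} (g : SpQ n) : tauSp (tauSp g) = g := by
  apply Subtype.ext
  change Iminus n ℚ * (Iminus n ℚ * g.1 * Iminus n ℚ) * Iminus n ℚ = g.1
  calc _ = (Iminus n ℚ * Iminus n ℚ) * g.1 * (Iminus n ℚ * Iminus n ℚ) := by
        simp only [Matrix.mul_assoc]
    _ = _ := by rw [Iminus_sq, Matrix.one_mul, Matrix.mul_one]

theorem tauSp_one {n : ℕ} : tauSp (1 : SpQ n) = 1 := by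
  have := tauSp_mul (1 : SpQ n) 1
  rwa [mul_one, left_eq_mul] at this

theorem tauSp_inv {n : ℕ} (g : SpQ n) : tauSp g⁻¹ = (tauSp g)⁻¹ := by
  rw [eq_inv_iff_mul_eq_one, ← tauSp_mul, inv_mul_cancel, tauSp_one]

/-- The Hermitian form `v ↦ Im ω(v̄, v) / 2`. -/
def herm {n : ℕ} (v : Fin n ⊕ Fin n → ℂ) : ℝ := (om n (star v) v).im / 2

/-- Because `sig h` commutes with `star`, `ω(v̄, v)` is replaced by minus its conjugate, which has
the same imaginary part. -/
theorem herm_sig {n : ℕ} (h : SpQ n) (v : Fin n ⊕ Fin n → ℂ) : herm (sig h v) = herm v := by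
  simp [herm, ← sig_star, om_sig]

theorem herm_toC {n : ℕ} (g : SpQ n) (v : Fin n ⊕ Fin n → ℂ) : herm (toC g *ᵥ v) = herm v := by
  rw [herm, ← toC_mulVec_star, om_toC, herm]

theorem herm_add_add_herm_sub {n : ℕ} (v w : Fin n ⊕ Fin n → ℂ) :
    herm (v + w) + herm (v - w) = 2 * herm v + 2 * herm w := by
  simp only [herm, star_add, star_sub, map_add, map_sub, LinearMap.add_apply, LinearMap.sub_apply,
    Complex.add_im, Complex.sub_im]
  ring

theorem herm_real_smul {n : ℕ} (c : ℝ) (v : Fin n ⊕ Fin n → ℂ) :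
    herm ((c : ℂ) • v) = c ^ 2 * herm v := by
  simp [herm, Complex.mul_im, Complex.mul_re]
  ring

/-! ### The subspaces `stdSub` -/

theorem mem_stdSub {n q : ℕ} {hq : q ≤ n} {z : Matrix (Fin q) (Fin q) ℂ}
    {v : Fin n ⊕ Fin n → ℂ} :
    v ∈ stdSub hq z ↔ (∀ i : Fin q, v (Sum.inl (Fin.castLE hq i))
      = ∑ j, z i j * v (Sum.inr (Fin.castLE hq j))) ∧
    ∀ i : Fin n, q ≤ (i : ℕ) → v (Sum.inr i) = 0 := Iff.rfl

theorem sum_castLE {M : Type*} [AddCommMonoid M] {n q : ℕ} (hq : q ≤ n) (f : Fin n → M)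
    (hf : ∀ i : Fin n, q ≤ (i : ℕ) → f i = 0) : ∑ i, f i = ∑ j : Fin q, f (Fin.castLE hq j) := by
  symm
  refine (Finset.sum_map Finset.univ (Fin.castLEEmb hq) f).symm.trans ?_
  refine Finset.sum_subset (Finset.subset_univ _) fun i _ hi => hf i ?_
  by_contra h
  exact hi (Finset.mem_map.2 ⟨⟨i, not_le.1 h⟩, Finset.mem_univ _, rfl⟩)

/-- On a boundary Lagrangian `herm` depends only on the coordinates in `ℂ^q`, where it is the
Hermitian form with matrix `Im z`. All positivity comes from here. -/
theorem herm_eq {n q : ℕ} {hq : q ≤ n} {z : Matrix (Fin q) (Fin q) ℂ} (hz : zᵀ = z)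
    {v : Fin n ⊕ Fin n → ℂ} (hv : v ∈ stdSub hq z) :
    herm v = (fun j => (v (Sum.inr (Fin.castLE hq j))).re) ⬝ᵥ
        (z.map Complex.im *ᵥ fun j => (v (Sum.inr (Fin.castLE hq j))).re)
      + (fun j => (v (Sum.inr (Fin.castLE hq j))).im) ⬝ᵥ
        (z.map Complex.im *ᵥ fun j => (v (Sum.inr (Fin.castLE hq j))).im) := by
  obtain ⟨h1, h2⟩ := hv
  have hs : ∀ i j, z i j = z j i := fun i j => by conv_lhs => rw [← hz, transpose_apply]
  rw [herm, om_apply, sum_castLE hq _ (fun i hi => by simp [h2 i hi])]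
  set u : Fin q → ℂ := fun j => v (Sum.inr (Fin.castLE hq j)) with hu
  have e : (∑ j : Fin q, ((star v) (Sum.inr (Fin.castLE hq j)) * v (Sum.inl (Fin.castLE hq j))
      - (star v) (Sum.inl (Fin.castLE hq j)) * v (Sum.inr (Fin.castLE hq j))))
      = ∑ i, ∑ j, (star (u i) * (z i j - star (z i j)) * u j) := by
    have : ∑ j : Fin q, (star v) (Sum.inl (Fin.castLE hq j)) * v (Sum.inr (Fin.castLE hq j))
        = ∑ i, ∑ j, star (u i) * star (z i j) * u j := by
      rw [Finset.sum_comm]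
      refine Finset.sum_congr rfl fun i _ => ?_
      rw [Pi.star_apply, h1 i, star_sum, Finset.sum_mul]
      refine Finset.sum_congr rfl fun j _ => ?_
      rw [star_mul, hs i j]
    rw [Finset.sum_sub_distrib, this, ← Finset.sum_sub_distrib]
    refine Finset.sum_congr rfl fun i _ => ?_
    rw [h1 i, Pi.star_apply, Finset.mul_sum, ← Finset.sum_sub_distrib]
    exact Finset.sum_congr rfl fun j _ => by ring
  have hz' : ∀ i j, z i j - star (z i j) = (2 * (z i j).im : ℝ) * Complex.I := fun i j => by
    apply Complex.ext <;> simp; ring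
  rw [e]
  simp only [hz', dotProduct, mulVec, Matrix.map_apply, Finset.mul_sum, Complex.im_sum]
  rw [Finset.sum_div, ← Finset.sum_add_distrib]
  refine Finset.sum_congr rfl fun i _ => ?_
  rw [Finset.sum_div, ← Finset.sum_add_distrib]
  refine Finset.sum_congr rfl fun j _ => ?_
  simp [Complex.mul_im, Complex.mul_re]
  ring

theorem om_eq_zero {n q : ℕ} {hq : q ≤ n} {z : Matrix (Fin q) (Fin q) ℂ} (hz : zᵀ = z)
    {v w : Fin n ⊕ Fin n → ℂ} (hv : v ∈ stdSub hq z) (hw : w ∈ stdSub hq z) : om n v w = 0 := by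
  obtain ⟨h1, h2⟩ := hv
  obtain ⟨h3, h4⟩ := hw
  have hs : ∀ i j, z i j = z j i := fun i j => by conv_lhs => rw [← hz, transpose_apply]
  rw [om_apply, sum_castLE hq _ (fun i hi => by simp [h2 i hi, h4 i hi]), Finset.sum_sub_distrib]
  simp only [h1, h3, Finset.mul_sum, Finset.sum_mul]
  rw [sub_eq_zero, Finset.sum_comm]
  refine Finset.sum_congr rfl fun i _ => Finset.sum_congr rfl fun j _ => ?_
  rw [hs i j]
  ring

theorem single_inl_mem {n q : ℕ} (hq : q ≤ n) (z : Matrix (Fin q) (Fin q) ℂ) {i : Fin n}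
    (hi : q ≤ (i : ℕ)) : (Pi.single (Sum.inl i) 1 : Fin n ⊕ Fin n → ℂ) ∈ stdSub hq z := by
  refine ⟨fun j => ?_, fun j _ => by simp⟩
  have : Fin.castLE hq j ≠ i := fun h => by
    have := congrArg Fin.val h
    simp at this
    omega
  simp [this]

theorem om_single_inl {n : ℕ} (i : Fin n) (v : Fin n ⊕ Fin n → ℂ) :
    om n (Pi.single (Sum.inl i) 1) v = -v (Sum.inr i) := by
  simp [om_apply, Pi.single_apply]

/-- The element of `stdSub hq z` with coordinates `u` in `ℂ^q`. -/
def lift {n q : ℕ} (_hq : q ≤ n) (z : Matrix (Fin q) (Fin q) ℂ) (u : Fin q → ℂ) :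
    Fin n ⊕ Fin n → ℂ :=
  Sum.elim (fun i => if h : (i : ℕ) < q then ∑ j, z ⟨i, h⟩ j * u j else 0)
    (fun i => if h : (i : ℕ) < q then u ⟨i, h⟩ else 0)

@[simp] theorem lift_inl {n q : ℕ} (hq : q ≤ n) (z : Matrix (Fin q) (Fin q) ℂ) (u : Fin q → ℂ)
    (i : Fin q) : lift hq z u (Sum.inl (Fin.castLE hq i)) = ∑ j, z i j * u j := by
  simp [lift]

@[simp] theorem lift_inr {n q : ℕ} (hq : q ≤ n) (z : Matrix (Fin q) (Fin q) ℂ) (u : Fin q → ℂ)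
    (i : Fin q) : lift hq z u (Sum.inr (Fin.castLE hq i)) = u i := by
  simp [lift]

theorem lift_inl_of_le {n q : ℕ} (hq : q ≤ n) (z : Matrix (Fin q) (Fin q) ℂ) (u : Fin q → ℂ)
    {i : Fin n} (hi : q ≤ (i : ℕ)) : lift hq z u (Sum.inl i) = 0 := by
  simp [lift, not_lt.2 hi]

theorem lift_inr_of_le {n q : ℕ} (hq : q ≤ n) (z : Matrix (Fin q) (Fin q) ℂ) (u : Fin q → ℂ)
    {i : Fin n} (hi : q ≤ (i : ℕ)) : lift hq z u (Sum.inr i) = 0 := by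
  simp [lift, not_lt.2 hi]

theorem lift_mem {n q : ℕ} (hq : q ≤ n) (z : Matrix (Fin q) (Fin q) ℂ) (u : Fin q → ℂ) :
    lift hq z u ∈ stdSub hq z :=
  ⟨fun i => by simp, fun _ hi => lift_inr_of_le hq z u hi⟩

/-- `stdSub hq z` is its own orthogonal complement. -/
theorem mem_stdSub_of_om {n q : ℕ} {hq : q ≤ n} {z : Matrix (Fin q) (Fin q) ℂ} (hz : zᵀ = z)
    {v : Fin n ⊕ Fin n → ℂ} (hv : ∀ w ∈ stdSub hq z, om n w v = 0) : v ∈ stdSub hq z := by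
  have h2 : ∀ i : Fin n, q ≤ (i : ℕ) → v (Sum.inr i) = 0 := fun i hi => by
    have := hv _ (single_inl_mem hq z hi)
    rwa [om_single_inl, neg_eq_zero] at this
  have hs : ∀ i j, z i j = z j i := fun i j => by conv_lhs => rw [← hz, transpose_apply]
  refine ⟨fun i => ?_, h2⟩
  have := hv _ (lift_mem hq z (Pi.single i 1))
  rw [om_apply, sum_castLE hq _ (fun i hi => by simp [h2 i hi, lift_inr_of_le hq z _ hi]),
    Finset.sum_sub_distrib, sub_eq_zero] at this
  simpa [Pi.single_apply, hs i] using this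

/-- `h x = τ x` for `x = φ_q(z)`, expressed by the antilinear map `sig h`. -/
theorem tau_std_iff {n q : ℕ} {hq : q ≤ n} (z : siegel q) (h : SpQ n) :
    tau (std hq z) = h • std hq z ↔ ∀ v ∈ stdSub hq z.1, sig h v ∈ stdSub hq z.1 := by
  have e : tau (std hq z) = h • std hq z ↔ tauSub (stdSub hq z.1) = actSub h (stdSub hq z.1) :=
    Subtype.ext_iff
  rw [e]
  constructor
  · intro H v hv
    have : toC h *ᵥ v ∈ tauSub (stdSub hq z.1) := by
      rw [H]
      exact ⟨v, hv, rfl⟩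
    exact this
  · intro H
    apply le_antisymm
    · intro v hv
      refine ⟨toC h⁻¹ *ᵥ v, ?_, toC_mulVec_inv h v⟩
      -- The reverse inclusion costs nothing: the subspace is maximal isotropic, so orthogonality to
      -- it suffices.
      refine mem_stdSub_of_om z.2.1 fun w hw => ?_
      have h1 := om_eq_zero z.2.1 (H w hw) (show conjVec n v ∈ stdSub hq z.1 from hv)
      rw [sig_apply, om_conjVec, neg_eq_zero, star_eq_zero] at h1
      rw [← om_toC h, toC_mulVec_inv, h1]
    · rintro _ ⟨v, hv, rfl⟩
      exact H v hv

/-! ### Real quadratic forms -/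

theorem sum_extend_castLE {q r : ℕ} (hqr : q ≤ r) {a : Fin r → ℝ}
    (ha : ∀ i : Fin r, q ≤ (i : ℕ) → a i = 0) (Y : Matrix (Fin r) (Fin r) ℝ) :
    a ⬝ᵥ (Y *ᵥ a) = (fun j => a (Fin.castLE hqr j)) ⬝ᵥ
      (Y.submatrix (Fin.castLE hqr) (Fin.castLE hqr) *ᵥ fun j => a (Fin.castLE hqr j)) := by
  simp only [dotProduct, mulVec, submatrix_apply]
  rw [sum_castLE hqr _ fun i hi => by simp [ha i hi]]
  refine Finset.sum_congr rfl fun i _ => ?_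
  rw [sum_castLE hqr _ fun i hi => by simp [ha i hi]]

/-- Cauchy–Schwarz, read off from the discriminant of the nonnegative quadratic polynomial `x ↦ Y(x
p + b)`. -/
theorem dotProduct_mulVec_sq_le {ι : Type*} [Fintype ι] {Y : Matrix ι ι ℝ} (hY : Y.PosSemidef)
    (p b : ι → ℝ) : (p ⬝ᵥ (Y *ᵥ b)) ^ 2 ≤ (p ⬝ᵥ (Y *ᵥ p)) * (b ⬝ᵥ (Y *ᵥ b)) := by
  have hs : b ⬝ᵥ (Y *ᵥ p) = p ⬝ᵥ (Y *ᵥ b) := by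
    have : Yᵀ = Y := hY.1
    rw [dotProduct_mulVec, ← mulVec_transpose, this, dotProduct_comm]
  have h := discrim_le_zero (a := p ⬝ᵥ (Y *ᵥ p)) (b := 2 * (p ⬝ᵥ (Y *ᵥ b)))
    (c := b ⬝ᵥ (Y *ᵥ b)) fun x => by
      have := hY.dotProduct_mulVec_nonneg (x • p + b)
      simp only [star_trivial, mulVec_add, mulVec_smul, dotProduct_add, add_dotProduct,
        smul_dotProduct, dotProduct_smul, smul_eq_mul, hs] at this
      linarith
  rw [discrim] at h
  linarith

theorem exists_lower_bound {q : ℕ} {Y : Matrix (Fin q) (Fin q) ℝ} (hY : Y.PosDef) :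
    ∃ c : ℝ, 0 < c ∧ ∀ p : Fin q → ℝ, c * ‖p‖ ^ 2 ≤ p ⬝ᵥ (Y *ᵥ p) := by
  have hcont : Continuous fun p : Fin q → ℝ => p ⬝ᵥ (Y *ᵥ p) := by
    simp only [dotProduct, mulVec]
    fun_prop
  -- The sphere is empty exactly when `q = 0`; otherwise the bound is the minimum of the form on it.
  rcases (Metric.sphere (0 : Fin q → ℝ) 1).eq_empty_or_nonempty with he | hne
  · refine ⟨1, one_pos, fun p => ?_⟩
    have : p = 0 := by
      by_contra hp
      have : ‖p‖⁻¹ • p ∈ Metric.sphere (0 : Fin q → ℝ) 1 := by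
        simp [norm_smul, norm_ne_zero_iff.2 hp]
      rw [he] at this
      exact this
    simp [this]
  · obtain ⟨p₀, hp₀, hmin⟩ := (isCompact_sphere (0 : Fin q → ℝ) 1).exists_isMinOn hne
      hcont.continuousOn
    have h0 : p₀ ≠ 0 := by
      rintro rfl
      simp at hp₀
    refine ⟨p₀ ⬝ᵥ (Y *ᵥ p₀), by simpa using hY.dotProduct_mulVec_pos h0, fun p => ?_⟩
    by_cases hp : p = 0
    · simp [hp]
    have hn : ‖p‖ ≠ 0 := norm_ne_zero_iff.2 hp
    have h1 : ‖p‖⁻¹ • p ∈ Metric.sphere (0 : Fin q → ℝ) 1 := by simp [norm_smul, hn]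
    have h2 : p₀ ⬝ᵥ (Y *ᵥ p₀) ≤ _ := hmin h1
    simp only [mulVec_smul, smul_dotProduct, dotProduct_smul, smul_eq_mul] at h2
    calc p₀ ⬝ᵥ (Y *ᵥ p₀) * ‖p‖ ^ 2
        ≤ (‖p‖⁻¹ * (‖p‖⁻¹ * (p ⬝ᵥ (Y *ᵥ p)))) * ‖p‖ ^ 2 := by gcongr
      _ = p ⬝ᵥ (Y *ᵥ p) := by field_simp

theorem abs_dotProduct_mulVec_le {q : ℕ} {A : Matrix (Fin q) (Fin q) ℝ} {η : ℝ}
    (hA : ∀ i j, |A i j| ≤ η) (p : Fin q → ℝ) :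
    |p ⬝ᵥ (A *ᵥ p)| ≤ (q : ℝ) ^ 2 * η * ‖p‖ ^ 2 := by
  have h : ∀ i j, |p i * (A i j * p j)| ≤ η * ‖p‖ ^ 2 := fun i j => by
    rw [abs_mul, abs_mul]
    have h1 : |p i| ≤ ‖p‖ := norm_le_pi_norm p i
    have h2 : |p j| ≤ ‖p‖ := norm_le_pi_norm p j
    have hη : 0 ≤ η := (abs_nonneg _).trans (hA i j)
    calc |p i| * (|A i j| * |p j|) ≤ ‖p‖ * (η * ‖p‖) := by
          gcongr
          exact hA i j
      _ = _ := by ring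
  simp only [dotProduct, mulVec, Finset.mul_sum]
  calc |∑ i, ∑ j, p i * (A i j * p j)| ≤ ∑ i : Fin q, ∑ j : Fin q, η * ‖p‖ ^ 2 :=
        (Finset.abs_sum_le_sum_abs _ _).trans (Finset.sum_le_sum fun i _ =>
          (Finset.abs_sum_le_sum_abs _ _).trans (Finset.sum_le_sum fun j _ => h i j))
    _ = _ := by
      simp
      ring

/-- The imaginary parts of the matrices near `z ∈ 𝔥_q` are uniformly equivalent to the identity. -/
theorem exists_nhd_bounds {q : ℕ} (z : siegel q) :
    ∃ V : Set (Matrix (Fin q) (Fin q) ℂ), IsOpen V ∧ z.1 ∈ V ∧ ∃ c C : ℝ, 0 < c ∧ 0 < C ∧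
      ∀ z' ∈ V, (∀ i j, ‖z' i j‖ ≤ C) ∧ ∀ p : Fin q → ℝ, c * ‖p‖ ^ 2 ≤ p ⬝ᵥ (z'.map Complex.im *ᵥ p) ∧
        p ⬝ᵥ (z'.map Complex.im *ᵥ p) ≤ C * ‖p‖ ^ 2 := by
  obtain ⟨c, hc, hcz⟩ := exists_lower_bound z.2.2
  -- Moving every entry by less than `η` changes the form by at most `q² η ‖p‖²`, which costs no
  -- more than half of the lower bound.
  set η : ℝ := c / (2 * ((q : ℝ) ^ 2 + 1)) with hη
  have hη0 : 0 < η := by positivity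
  have hqη : (q : ℝ) ^ 2 * η ≤ c / 2 := by
    rw [hη, mul_div_assoc', div_le_div_iff₀ (by positivity) two_pos]
    nlinarith
  set B : ℝ := ∑ i, ∑ j, ‖z.1 i j‖ with hB
  have hzB : ∀ i j, ‖z.1 i j‖ ≤ B := fun i j =>
    (Finset.single_le_sum (f := fun j => ‖z.1 i j‖) (fun _ _ => norm_nonneg _)
      (Finset.mem_univ j)).trans
    (Finset.single_le_sum (f := fun i => ∑ j, ‖z.1 i j‖)
      (fun _ _ => Finset.sum_nonneg fun _ _ => norm_nonneg _) (Finset.mem_univ i))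
  have hB0 : 0 ≤ B := Finset.sum_nonneg fun _ _ => Finset.sum_nonneg fun _ _ => norm_nonneg _
  refine ⟨{z' | ∀ i j, ‖z' i j - z.1 i j‖ < η}, ?_, fun i j => by simpa using hη0, c / 2,
    ((q : ℝ) ^ 2 + 1) * (B + η), by positivity, by positivity, fun z' hz' => ⟨fun i j => ?_, fun p => ?_⟩⟩
  · simp only [Set.ofPred_forall]
    refine isOpen_iInter_of_finite fun i => isOpen_iInter_of_finite fun j => ?_
    exact isOpen_lt (by fun_prop) continuous_const
  · have h1 := norm_le_norm_add_norm_sub' (z' i j) (z.1 i j)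
    have h2 := hz' i j
    have h3 := hzB i j
    have : ‖z' i j‖ ≤ 1 * (B + η) := by linarith
    refine this.trans ?_
    gcongr
    nlinarith [sq_nonneg (q : ℝ)]
  · have h1 : |p ⬝ᵥ ((z'.map Complex.im - z.1.map Complex.im) *ᵥ p)| ≤ (q : ℝ) ^ 2 * η * ‖p‖ ^ 2 :=
      abs_dotProduct_mulVec_le (fun i j => by
        rw [Matrix.sub_apply, Matrix.map_apply, Matrix.map_apply, ← Complex.sub_im]
        exact (Complex.abs_im_le_norm _).trans (hz' i j).le) p
    have h2 : |p ⬝ᵥ (z.1.map Complex.im *ᵥ p)| ≤ (q : ℝ) ^ 2 * B * ‖p‖ ^ 2 :=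
      abs_dotProduct_mulVec_le (fun i j => (Complex.abs_im_le_norm _).trans (hzB i j)) p
    rw [sub_mulVec, dotProduct_sub] at h1
    have h3 := hcz p
    have h4 : (q : ℝ) ^ 2 * η * ‖p‖ ^ 2 ≤ c / 2 * ‖p‖ ^ 2 := by gcongr
    have h5 : 0 ≤ (B + η) * ‖p‖ ^ 2 := by positivity
    constructor
    · linarith [abs_le.1 h1]
    · have := (abs_le.1 h1).2
      have := (abs_le.1 h2).2
      linarith

/-! ### Denominators -/

/-- `d h` is integral. -/
def HasDenom {n : ℕ} (d : ℕ) (h : SpQ n) : Prop :=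
  ∃ M : Matrix (Fin n ⊕ Fin n) (Fin n ⊕ Fin n) ℤ,
    (d : ℚ) • (h : Matrix (Fin n ⊕ Fin n) (Fin n ⊕ Fin n) ℚ) = M.map (Int.castRingHom ℚ)

theorem hasDenom_one_of_mem {n N : ℕ} {g : SpQ n} (hg : g ∈ congruenceSubgroup n N) :
    HasDenom 1 g := by
  obtain ⟨M, hM⟩ := hg
  refine ⟨Matrix.of fun i j => (1 : Matrix _ _ ℤ) i j + N * M i j, ?_⟩
  rw [hM]
  ext i j
  by_cases h : i = j <;> simp [Matrix.one_apply, h]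

theorem HasDenom.mul {n d e : ℕ} {g h : SpQ n} (hg : HasDenom d g) (hh : HasDenom e h) :
    HasDenom (d * e) (g * h) := by
  obtain ⟨A, hA⟩ := hg
  obtain ⟨B, hB⟩ := hh
  refine ⟨A * B, ?_⟩
  rw [Matrix.map_mul, ← hA, ← hB, Submonoid.coe_mul, Nat.cast_mul, Matrix.smul_mul,
    Matrix.mul_smul, smul_smul]

theorem HasDenom.inv {n d : ℕ} {g : SpQ n} (hg : HasDenom d g) : HasDenom d g⁻¹ := by
  obtain ⟨A, hA⟩ := hg
  refine ⟨(-J (Fin n) ℤ) * Aᵀ * J (Fin n) ℤ, ?_⟩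
  rw [Matrix.map_mul, Matrix.map_mul, Matrix.map_neg _ (by simp), map_J, transpose_map, ← hA,
    SymplecticGroup.coe_inv]
  simp

theorem HasDenom.tauSp {n d : ℕ} {g : SpQ n} (hg : HasDenom d g) :
    HasDenom d (RealSatake.tauSp g) := by
  obtain ⟨A, hA⟩ := hg
  refine ⟨Iminus n ℤ * A * Iminus n ℤ, ?_⟩
  have hI : (Iminus n ℤ).map (Int.castRingHom ℚ) = Iminus n ℚ := by
    simp [Iminus, fromBlocks_map, Matrix.map_neg]
  rw [Matrix.map_mul, Matrix.map_mul, hI, ← hA]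
  simp [RealSatake.tauSp]

theorem exists_hasDenom {n : ℕ} (g : SpQ n) : ∃ d : ℕ, 0 < d ∧ HasDenom d g := by
  refine ⟨∏ i, ∏ j, (g.1 i j).den, ?_, ?_⟩
  · exact Finset.prod_pos fun i _ => Finset.prod_pos fun j _ => (g.1 i j).den_pos
  · have : ∀ i j, ∃ a : ℤ, ((∏ i, ∏ j, (g.1 i j).den : ℕ) : ℚ) * g.1 i j = a := fun i j => by
      have h1 : (g.1 i j).den ∣ ∏ i, ∏ j, (g.1 i j).den :=
        (Finset.dvd_prod_of_mem (fun j => (g.1 i j).den) (Finset.mem_univ j)).trans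
          (Finset.dvd_prod_of_mem (fun i => ∏ j, (g.1 i j).den) (Finset.mem_univ i))
      obtain ⟨e, he⟩ := h1
      refine ⟨e * (g.1 i j).num, ?_⟩
      rw [he]
      push_cast
      nth_rewrite 2 [← Rat.num_div_den (g.1 i j)]
      field_simp
    choose a ha using this
    exact ⟨Matrix.of a, by ext i j; simpa using ha i j⟩

theorem HasDenom.toC {n d : ℕ} {h : SpQ n} (hd : HasDenom d h) (i j : Fin n ⊕ Fin n) :
    ∃ a : ℤ, (d : ℂ) * toC h i j = a := by
  obtain ⟨M, hM⟩ := hd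
  refine ⟨M i j, ?_⟩
  have := congrFun (congrFun hM i) j
  simp only [Matrix.smul_apply, smul_eq_mul, Matrix.map_apply, eq_intCast] at this
  simp only [RealSatake.toC, Matrix.map_apply, eq_ratCast]
  exact_mod_cast this

theorem HasDenom.sig_single {n d : ℕ} {h : SpQ n} (hd : HasDenom d h) (i j : Fin n ⊕ Fin n) :
    ∃ a : ℤ, (d : ℂ) * sig h (Pi.single i 1) j = a := by
  obtain ⟨a, ha⟩ := hd.toC j i
  have ha' := congrArg star ha
  simp only [star_mul'] at ha'
  rcases j with j | j
  · refine ⟨-a, ?_⟩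
    simp only [sig_apply, conjVec, LinearMap.coe_mk, AddHom.coe_mk, mulVec_single_one, Sum.elim_inl,
      col_apply]
    simpa using ha'
  · refine ⟨a, ?_⟩
    simp only [sig_apply, conjVec, LinearMap.coe_mk, AddHom.coe_mk, mulVec_single_one, Sum.elim_inr,
      col_apply]
    simpa using ha'

/-- A complex number in `d⁻¹ ℤ` of real part less than `d⁻¹` is zero. -/
theorem eq_zero_of_denom {d : ℕ} (hd : 0 < d) {x : ℂ} (hx : ∃ a : ℤ, (d : ℂ) * x = a)
    (h : (d : ℝ) ^ 2 * x.re ^ 2 < 1) : x = 0 := by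
  obtain ⟨a, ha⟩ := hx
  have h1 : (d : ℝ) * x.re = a := by simpa using congrArg Complex.re ha
  have h2 : ((a ^ 2 : ℤ) : ℝ) < 1 := by
    push_cast
    rw [← h1]
    linarith [mul_pow (d : ℝ) x.re 2]
  have h3 : a ^ 2 < 1 := by exact_mod_cast h2
  have h4 : a = 0 := by nlinarith [sq_nonneg a, sq_nonneg (a - 1), sq_nonneg (a + 1)]
  rw [h4, Int.cast_zero] at ha
  exact (mul_eq_zero.1 ha).resolve_left (by exact_mod_cast hd.ne')

/-! ### Real vectors as twice the real parts of elements of a subspace `stdSub` -/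

/-- The real parts of the coordinates in `ℂ^r` are forced; their imaginary parts `b` solve a linear
system with matrix `Im Z`, which is invertible. The formula for `Im Z` applied to `b` is what later
controls `herm ℓ`. -/
theorem exists_add_star_eq {n r : ℕ} (hr : r ≤ n) (Z : siegel r) {ρ : Fin n ⊕ Fin n → ℂ}
    (hρ : star ρ = ρ) (hρr : ∀ i : Fin n, r ≤ (i : ℕ) → ρ (Sum.inr i) = 0) :
    ∃ ℓ ∈ stdSub hr Z.1, ∃ b : Fin r → ℝ, ℓ + star ℓ = ρ ∧
      (Z.1.map Complex.im *ᵥ b = fun i => ∑ j, (Z.1 i j).re * ((ρ (Sum.inr (Fin.castLE hr j))).re / 2)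
        - (ρ (Sum.inl (Fin.castLE hr i))).re / 2) ∧
      ∀ j, ℓ (Sum.inr (Fin.castLE hr j)) = ⟨(ρ (Sum.inr (Fin.castLE hr j))).re / 2, b j⟩ := by
  have hre : ∀ i, ρ i = (ρ i).re := fun i => by
    have := congrFun hρ i
    exact (Complex.conj_eq_iff_re.1 this).symm
  set w : Fin r → ℝ := fun i => ∑ j, (Z.1 i j).re * ((ρ (Sum.inr (Fin.castLE hr j))).re / 2)
        - (ρ (Sum.inl (Fin.castLE hr i))).re / 2 with hw
  have hu : IsUnit (Z.1.map Complex.im).det := (Matrix.isUnit_iff_isUnit_det _).1 Z.2.2.isUnit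
  set b : Fin r → ℝ := (Z.1.map Complex.im)⁻¹ *ᵥ w with hb
  have hYb : Z.1.map Complex.im *ᵥ b = w := by
    rw [hb, mulVec_mulVec, Matrix.mul_nonsing_inv _ hu, one_mulVec]
  set u : Fin r → ℂ := fun j => ⟨(ρ (Sum.inr (Fin.castLE hr j))).re / 2, b j⟩ with hudef
  -- The upper coordinates of index at least `r` are unconstrained in the subspace and are added
  -- separately.
  set ω : Fin n ⊕ Fin n → ℂ := Sum.elim (fun i => if (i : ℕ) < r then 0 else ρ (Sum.inl i) / 2) 0
    with hω
  have hωmem : ω ∈ stdSub hr Z.1 := ⟨fun i => by simp [hω], fun i _ => by simp [hω]⟩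
  refine ⟨lift hr Z.1 u + ω, add_mem (lift_mem hr Z.1 u) hωmem, b, ?_, hYb, fun j => by simp [hω, hudef]⟩
  ext i
  rcases i with i | i
  · by_cases hi : (i : ℕ) < r
    · obtain ⟨j, rfl⟩ : ∃ j : Fin r, i = Fin.castLE hr j := ⟨⟨i, hi⟩, rfl⟩
      have := congrFun hYb j
      simp only [mulVec, dotProduct, hw, Matrix.map_apply] at this
      have e : (∑ l, Z.1 j l * u l).re = (ρ (Sum.inl (Fin.castLE hr j))).re / 2 := by
        rw [Complex.re_sum]
        simp only [Complex.mul_re, hudef, Finset.sum_sub_distrib]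
        linarith
      rw [hre (Sum.inl (Fin.castLE hr j))]
      simp only [Pi.add_apply, Pi.star_apply, lift_inl, hω, Sum.elim_inl, if_pos hi, add_zero]
      apply Complex.ext
      · rw [Complex.add_re, Complex.star_def, Complex.conj_re, e, Complex.ofReal_re]
        ring
      · rw [Complex.add_im, Complex.star_def, Complex.conj_im, Complex.ofReal_im]
        ring
    · have h1 := lift_inl_of_le hr Z.1 u (not_lt.1 hi)
      simp only [Pi.add_apply, Pi.star_apply, h1, zero_add, hω, Sum.elim_inl, if_neg hi]
      rw [hre (Sum.inl i)]
      apply Complex.ext <;> simp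
  · by_cases hi : (i : ℕ) < r
    · obtain ⟨j, rfl⟩ : ∃ j : Fin r, i = Fin.castLE hr j := ⟨⟨i, hi⟩, rfl⟩
      rw [hre (Sum.inr (Fin.castLE hr j))]
      apply Complex.ext <;> simp [hω, hudef]
    · have h1 := lift_inr_of_le hr Z.1 u (not_lt.1 hi)
      simp [h1, hω, hρr i (not_lt.1 hi)]

theorem star_single {n : ℕ} (i : Fin n ⊕ Fin n) :
    star (Pi.single i 1 : Fin n ⊕ Fin n → ℂ) = Pi.single i 1 := by
  ext j
  by_cases h : j = i <;> simp [h]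

/-- Short rational vectors: if `sig h` stabilizes the subspace of a point `Z` that is close to the
standard boundary component `F_q`, and `h` has bounded denominators, then `sig h` maps the vectors
`e_i`, `q ≤ i`, to combinations of such vectors. -/
theorem sig_single_of_close {n q r d : ℕ} (hr : r ≤ n) (hqr : q ≤ r) (Z : siegel r)
    (hd : 0 < d) {c C k : ℝ} (hc : 0 < c) (hk : 0 < k)
    (hZc : ∀ p : Fin q → ℝ, c * ‖p‖ ^ 2 ≤ p ⬝ᵥ ((Z.1.submatrix (Fin.castLE hqr)
      (Fin.castLE hqr)).map Complex.im *ᵥ p) ∧ p ⬝ᵥ ((Z.1.submatrix (Fin.castLE hqr)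
      (Fin.castLE hqr)).map Complex.im *ᵥ p) ≤ C * ‖p‖ ^ 2)
    (hZk : ∀ p : Fin r → ℝ, ∀ j : Fin r, q ≤ (j : ℕ) →
      k * p j ^ 2 ≤ p ⬝ᵥ (Z.1.map Complex.im *ᵥ p))
    (hk1 : (d : ℝ) ^ 2 < k ^ 2) (hk2 : (d : ℝ) ^ 2 < k * c) (hk3 : (d : ℝ) ^ 2 * C < k)
    {h : SpQ n} (hh : HasDenom d h) (hs : ∀ v ∈ stdSub hr Z.1, sig h v ∈ stdSub hr Z.1)
    {i : Fin n} (hi : q ≤ (i : ℕ)) :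
    (∀ j, sig h (Pi.single (Sum.inl i) 1) (Sum.inr j) = 0) ∧
      ∀ j : Fin n, (j : ℕ) < q → sig h (Pi.single (Sum.inl i) 1) (Sum.inl j) = 0 := by
  set Y := Z.1.map Complex.im with hY
  have hYps : Y.PosSemidef := Z.2.2.posSemidef
  obtain ⟨ℓ, hℓ, b, hℓs, hb, hℓb⟩ := exists_add_star_eq hr Z (star_single (Sum.inl i))
    (fun j _ => by simp)
  -- If `i < r`, then `Y b = -e_i / 2`, so `herm ℓ = -b_i / 2`, while closeness to the boundary
  -- gives `k b_i² ≤ herm ℓ`; together `herm ℓ ≤ 1 / (4k)`. If `i ≥ r`, then `b = 0`.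
  have hherm : herm ℓ * (4 * k) ≤ 1 := by
    rw [herm_eq Z.2.1 hℓ]
    simp only [hℓb, hb]
    by_cases hir : (i : ℕ) < r
    · have h1 := hZk b ⟨i, hir⟩ hi
      have h2 : b ⬝ᵥ (Y *ᵥ b) = -b ⟨i, hir⟩ / 2 := by
        rw [hb, dotProduct, Finset.sum_eq_single ⟨i, hir⟩]
        · simp
          ring
        · intro j _ hj
          have : Fin.castLE hr j ≠ i := fun e => hj (Fin.ext (by simpa using congrArg Fin.val e))
          simp [this]
        · simp
      rw [← hb, h2]
      rw [h2] at h1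
      simp only [Pi.single_apply, reduceCtorEq, if_false, Complex.zero_re, zero_div]
      have e : (fun _ : Fin r => (0 : ℝ)) = 0 := rfl
      rw [e, zero_dotProduct, zero_add]
      nlinarith [sq_nonneg (b ⟨i, hir⟩ * k * 2 + 1)]
    · have hb0 : b = 0 := by
        have : Y *ᵥ b = 0 := by
          rw [hb]
          ext j
          have : Fin.castLE hr j ≠ i := fun e => hir (by simp [← e])
          simp [this]
        have hu : IsUnit Y.det := (Matrix.isUnit_iff_isUnit_det _).1 Z.2.2.isUnit
        rw [← one_mulVec b, ← Matrix.nonsing_inv_mul _ hu, ← mulVec_mulVec, this, mulVec_zero]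
      simp only [Pi.single_apply, reduceCtorEq, if_false, Complex.zero_re, zero_div, hb0]
      have e : (fun _ : Fin r => (0 : ℝ)) = 0 := rfl
      simp only [Pi.zero_apply]
      rw [e]
      simp
  set m := sig h ℓ with hm
  have hmL : m ∈ stdSub hr Z.1 := hs ℓ hℓ
  have hms : m + star m = sig h (Pi.single (Sum.inl i) 1) := by
    rw [hm, ← sig_star, ← map_add, hℓs]
  have hmh : herm m * (4 * k) ≤ 1 := by rwa [hm, herm_sig]
  rw [herm_eq Z.2.1 hmL, ← hY] at hmh
  set a : Fin r → ℝ := fun j => (m (Sum.inr (Fin.castLE hr j))).re with ha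
  set b' : Fin r → ℝ := fun j => (m (Sum.inr (Fin.castLE hr j))).im with hb'
  have ha0 : 0 ≤ a ⬝ᵥ (Y *ᵥ a) := by simpa using hYps.dotProduct_mulVec_nonneg a
  have hb0 : 0 ≤ b' ⬝ᵥ (Y *ᵥ b') := by simpa using hYps.dotProduct_mulVec_nonneg b'
  have hak : a ⬝ᵥ (Y *ᵥ a) * (4 * k) ≤ 1 := by nlinarith
  have hbk : b' ⬝ᵥ (Y *ᵥ b') * (4 * k) ≤ 1 := by nlinarith
  have hden : ∀ j, ∃ z : ℤ, (d : ℂ) * (m + star m) j = z := fun j => by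
    rw [hms]
    exact hh.sig_single _ _
  have hre : ∀ j, (m + star m) j = ((2 * (m j).re : ℝ) : ℂ) := fun j => by
    apply Complex.ext <;> simp
    ring
  have hd1 : (1 : ℝ) ≤ d := by exact_mod_cast hd
  have hzero : ∀ j, (d : ℝ) ^ 2 * (2 * (m j).re) ^ 2 < 1 → (m j).re = 0 := fun j hj => by
    have := eq_zero_of_denom hd (hden j) (by rw [hre, Complex.ofReal_re]; exact hj)
    rw [hre] at this
    have h2 : 2 * (m j).re = 0 := by exact_mod_cast this
    linarith
  -- Directions of index at least `q` have height `k`, so `k² (2 a_j)² ≤ 1`, and `d² < k²` forces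
  -- zero. The other directions only have the lower bound `c`, which is why `d² < k c` is needed
  -- next.
  have haz1 : ∀ j : Fin r, q ≤ (j : ℕ) → a j = 0 := fun j hj => by
    apply hzero
    have h1 := hZk a j hj
    have h2 : k ^ 2 * (2 * a j) ^ 2 ≤ 1 := by nlinarith
    rcases eq_or_ne (a j) 0 with h0 | h0
    · change (d : ℝ) ^ 2 * (2 * a j) ^ 2 < 1
      simp [h0]
    · have : 0 < (2 * a j) ^ 2 := by positivity
      change (d : ℝ) ^ 2 * (2 * a j) ^ 2 < 1
      nlinarith
  have haz : a = 0 := by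
    ext j
    by_cases hj : q ≤ (j : ℕ)
    · exact haz1 j hj
    · apply hzero
      obtain ⟨l, rfl⟩ : ∃ l : Fin q, j = Fin.castLE hqr l := ⟨⟨j, not_le.1 hj⟩, rfl⟩
      change (d : ℝ) ^ 2 * (2 * a (Fin.castLE hqr l)) ^ 2 < 1
      have h1 := (hZc fun l => a (Fin.castLE hqr l)).1
      have h2 := sum_extend_castLE hqr haz1 Y
      have h3 : |a (Fin.castLE hqr l)| ≤ ‖fun l => a (Fin.castLE hqr l)‖ :=
        norm_le_pi_norm (fun l => a (Fin.castLE hqr l)) l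
      have h4 : a (Fin.castLE hqr l) ^ 2 ≤ ‖fun l => a (Fin.castLE hqr l)‖ ^ 2 := by
        rw [← sq_abs]
        gcongr
      have h5 : c * a (Fin.castLE hqr l) ^ 2 ≤ a ⬝ᵥ (Y *ᵥ a) := by
        rw [h2]
        refine le_trans ?_ h1
        gcongr
      have h6 : (k * c) * (2 * a (Fin.castLE hqr l)) ^ 2 ≤ 1 := by nlinarith
      rcases eq_or_ne (a (Fin.castLE hqr l)) 0 with h0 | h0
      · simp [h0]
      · have : 0 < (2 * a (Fin.castLE hqr l)) ^ 2 := by positivity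
        nlinarith
  rw [← hms]
  refine ⟨fun j => ?_, fun j hj => ?_⟩
  · rw [hre]
    by_cases hj : (j : ℕ) < r
    · have : a ⟨j, hj⟩ = 0 := by rw [haz]; rfl
      change (m (Sum.inr j)).re = 0 at this
      simp [this]
    · simp [hmL.2 j (not_lt.1 hj)]
  · obtain ⟨l, rfl⟩ : ∃ l : Fin q, j = Fin.castLE (hqr.trans hr) l := ⟨⟨j, hj⟩, rfl⟩
    set l' : Fin r := Fin.castLE hqr l with hl'
    have hll : Fin.castLE (hqr.trans hr) l = Fin.castLE hr l' := rfl
    have e1 : (m (Sum.inl (Fin.castLE hr l'))).re = -(Y *ᵥ b') l' := by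
      rw [hmL.1 l', Complex.re_sum, mulVec, dotProduct, ← Finset.sum_neg_distrib]
      refine Finset.sum_congr rfl fun j _ => ?_
      have : (m (Sum.inr (Fin.castLE hr j))).re = 0 := congrFun haz j
      rw [Complex.mul_re, this, hY, Matrix.map_apply]
      ring
    rw [hre, hll, hzero, mul_zero, Complex.ofReal_zero]
    rw [e1]
    -- With `a = 0` these coordinates are entries of `-Y b'`. Cauchy–Schwarz bounds them by the
    -- diagonal entry of `Y`, at most `C`, times `herm m`; the last condition on `k` makes this too
    -- small for a nonzero element of `d⁻¹ℤ`.
    have h1 := dotProduct_mulVec_sq_le hYps (Pi.single l' 1) b'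
    rw [single_one_dotProduct, single_one_dotProduct] at h1
    have h2 := (hZc (Pi.single l 1)).2
    rw [single_one_dotProduct, mulVec_single_one, Pi.norm_single] at h2
    have h3 : (Y *ᵥ Pi.single l' 1) l' ≤ C := by
      rw [mulVec_single_one]
      simpa [hY, hl'] using h2
    have h4 : ((Y *ᵥ b') l') ^ 2 ≤ C * (b' ⬝ᵥ (Y *ᵥ b')) := h1.trans (by gcongr)
    have h5 : ((Y *ᵥ b') l') ^ 2 * (4 * k) ≤ C := by
      have h0 := hZc (Pi.single l 1)
      rw [Pi.norm_single, norm_one, one_pow, mul_one, mul_one] at h0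
      have hC : 0 ≤ C := hc.le.trans (h0.1.trans h0.2)
      nlinarith
    have h6 : (2 * -(Y *ᵥ b') l') ^ 2 * k ≤ C := by linarith
    by_contra hcon
    have hd0 : (0 : ℝ) < (d : ℝ) ^ 2 := by positivity
    nlinarith

/-! ### From `F_r` to the smaller component `F_q` -/

theorem tau_tau {n : ℕ} (x : Satake n) : tau (tau x) = x := Subtype.ext (tauSub_tauSub x.1)

theorem sig_sig_tauSp_inv {n : ℕ} (h : SpQ n) (v : Fin n ⊕ Fin n → ℂ) :
    sig h (sig (tauSp h⁻¹) v) = v := by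
  rw [sig_apply, sig_apply, conjVec_mulVec, conjVec_conjVec, ← toC_mul_mulVec, ← tauSp_mul,
    mul_inv_cancel, tauSp_one, toC_one, one_mulVec]

theorem sig_eq_sum {n : ℕ} (h : SpQ n) (v : Fin n ⊕ Fin n → ℂ) :
    sig h v = ∑ i, star (v i) • sig h (Pi.single i 1) := by
  conv_lhs => rw [pi_eq_sum_univ' v, map_sum]
  refine Finset.sum_congr rfl fun i _ => ?_
  rw [LinearMap.map_smulₛₗ]
  rfl

/-- `sig (tauSp h⁻¹)` is a right inverse of `sig h` (`sig_sig_tauSp_inv`); stability is transferred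
by applying `tau` to the reality equation. -/
theorem stable_tauSp_inv {n r : ℕ} {hr : r ≤ n} (Z : siegel r) {h : SpQ n}
    (hs : ∀ v ∈ stdSub hr Z.1, sig h v ∈ stdSub hr Z.1) :
    ∀ v ∈ stdSub hr Z.1, sig (tauSp h⁻¹) v ∈ stdSub hr Z.1 := by
  rw [← tau_std_iff] at hs ⊢
  have := congrArg tau hs
  rw [tau_tau, tau_smul] at this
  rw [tauSp_inv, eq_inv_smul_iff, ← this]

theorem submatrix_mem_siegel {q r : ℕ} (hqr : q ≤ r) (Z : siegel r) :
    Z.1.submatrix (Fin.castLE hqr) (Fin.castLE hqr) ∈ siegel q :=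
  ⟨by rw [transpose_submatrix, Z.2.1], Z.2.2.submatrix (Fin.castLE_injective hqr)⟩

/-- If `h` is `Z`-real with bounded denominators, and `Z` is close to `F_q`, then `h` is real at
the projection of `Z` to `F_q`. -/
theorem stable_of_close {n q r d : ℕ} (hr : r ≤ n) (hqr : q ≤ r) (Z : siegel r)
    (hd : 0 < d) {c C k : ℝ} (hc : 0 < c) (hk : 0 < k)
    (hZc : ∀ p : Fin q → ℝ, c * ‖p‖ ^ 2 ≤ p ⬝ᵥ ((Z.1.submatrix (Fin.castLE hqr)
      (Fin.castLE hqr)).map Complex.im *ᵥ p) ∧ p ⬝ᵥ ((Z.1.submatrix (Fin.castLE hqr)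
      (Fin.castLE hqr)).map Complex.im *ᵥ p) ≤ C * ‖p‖ ^ 2)
    (hZk : ∀ p : Fin r → ℝ, ∀ j : Fin r, q ≤ (j : ℕ) →
      k * p j ^ 2 ≤ p ⬝ᵥ (Z.1.map Complex.im *ᵥ p))
    (hk1 : (d : ℝ) ^ 2 < k ^ 2) (hk2 : (d : ℝ) ^ 2 < k * c) (hk3 : (d : ℝ) ^ 2 * C < k)
    {h : SpQ n} (hh : HasDenom d h) (hs : ∀ v ∈ stdSub hr Z.1, sig h v ∈ stdSub hr Z.1) :
    ∀ v ∈ stdSub (hqr.trans hr) (Z.1.submatrix (Fin.castLE hqr) (Fin.castLE hqr)),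
      sig h v ∈ stdSub (hqr.trans hr) (Z.1.submatrix (Fin.castLE hqr) (Fin.castLE hqr)) := by
  have H1 := fun i (hi : q ≤ ((i : Fin n) : ℕ)) =>
    sig_single_of_close hr hqr Z hd hc hk hZc hZk hk1 hk2 hk3 hh hs hi
  -- The same bound on denominators holds for the inverse map, so both maps preserve the isotropic
  -- space spanned by the `e_i` with `q ≤ i`.
  have H2 := fun i (hi : q ≤ ((i : Fin n) : ℕ)) =>
    sig_single_of_close hr hqr Z hd hc hk hZc hZk hk1 hk2 hk3 hh.inv.tauSp
      (stable_tauSp_inv Z hs) hi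
  rintro v ⟨hv1, hv2⟩
  set u : Fin r → ℂ := fun j => v (Sum.inr (Fin.castLE hr j)) with hu
  -- `v'` lies in the Lagrangian of `Z` and differs from `v` only by a combination of the `e_i` with
  -- `q ≤ i`.
  set v' := lift hr Z.1 u with hv'
  have hv'r : ∀ i, v' (Sum.inr i) = v (Sum.inr i) := fun i => by
    by_cases hi : (i : ℕ) < r
    · obtain ⟨j, rfl⟩ : ∃ j : Fin r, i = Fin.castLE hr j := ⟨⟨i, hi⟩, rfl⟩
      rw [hv', lift_inr]
    · rw [hv', lift_inr_of_le hr Z.1 u (not_lt.1 hi), hv2 i (hqr.trans (not_lt.1 hi))]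
  have hv'l : ∀ i : Fin n, (i : ℕ) < q → v' (Sum.inl i) = v (Sum.inl i) := fun i hi => by
    obtain ⟨l, rfl⟩ : ∃ l : Fin q, i = Fin.castLE (hqr.trans hr) l := ⟨⟨i, hi⟩, rfl⟩
    rw [hv1 l]
    change lift hr Z.1 u (Sum.inl (Fin.castLE hr (Fin.castLE hqr l))) = _
    rw [lift_inl, sum_castLE hqr _ fun j hj => by simp [hu, hv2 (Fin.castLE hr j) hj]]
    rfl
  have hm := hs v' (lift_mem hr Z.1 u)
  have hw : ∀ a : Fin n ⊕ Fin n, (∀ i, q ≤ ((i : Fin n) : ℕ) → sig h (Pi.single (Sum.inl i) 1) a = 0) →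
      sig h v a = sig h v' a := fun a ha => by
    rw [← sub_eq_zero, ← Pi.sub_apply, ← map_sub, sig_eq_sum, Finset.sum_apply]
    refine Finset.sum_eq_zero fun x _ => ?_
    rcases x with i | i
    · by_cases hi : (i : ℕ) < q
      · simp [hv'l i hi]
      · simp [ha i (not_lt.1 hi)]
    · simp [hv'r i]
  -- The coordinate is a pairing with `e_i`. Writing `e_i` as the image of its preimage under `sig
  -- h` turns it into a pairing of `v'` with a vector of the isotropic space, and this is zero.
  have hmr : ∀ i : Fin n, q ≤ (i : ℕ) → sig h v' (Sum.inr i) = 0 := fun i hi => by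
    have h1 := om_single_inl i (sig h v')
    rw [← sig_sig_tauSp_inv h (Pi.single (Sum.inl i) 1), om_sig, om_apply,
      Finset.sum_eq_zero, star_zero, neg_zero, eq_comm, neg_eq_zero] at h1
    · exact h1
    · intro j _
      rw [(H2 i hi).1 j]
      by_cases hj : (j : ℕ) < q
      · rw [(H2 i hi).2 j hj]
        simp
      · rw [hv'r, hv2 j (not_lt.1 hj)]
        simp
  refine ⟨fun i => ?_, fun i hi => ?_⟩
  · rw [hw _ fun j hj => (H1 j hj).2 _ i.2]
    simp only [fun j => hw (Sum.inr j) fun i hi => (H1 i hi).1 j]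
    have := hm.1 (Fin.castLE hqr i)
    rw [sum_castLE hqr _ fun j hj => by simp [hmr (Fin.castLE hr j) hj]] at this
    exact this
  · rw [hw _ fun j hj => (H1 j hj).1 _]
    exact hmr i hi

/-! ### Local constancy of reality on a component -/

/-- The image of `e_i` is a real vector of the Lagrangian. Reality gives `Im z` times its lower
coordinates equal to zero, and `Im z` is invertible. -/
theorem stable_single_inl {n q : ℕ} {hq : q ≤ n} (z : siegel q) {h : SpQ n}
    (hs : ∀ v ∈ stdSub hq z.1, sig h v ∈ stdSub hq z.1) {i : Fin n} (hi : q ≤ (i : ℕ)) :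
    (∀ j, sig h (Pi.single (Sum.inl i) 1) (Sum.inr j) = 0) ∧
      ∀ j : Fin n, (j : ℕ) < q → sig h (Pi.single (Sum.inl i) 1) (Sum.inl j) = 0 := by
  set m := sig h (Pi.single (Sum.inl i) 1) with hm
  have hmL : m ∈ stdSub hq z.1 := hs _ (single_inl_mem hq z.1 hi)
  have hms : star m = m := by rw [hm, ← sig_star, star_single]
  have hre : ∀ j, (m j).im = 0 := fun j => Complex.conj_eq_iff_im.1 (congrFun hms j)
  set a : Fin q → ℝ := fun j => (m (Sum.inr (Fin.castLE hq j))).re with ha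
  have hYa : z.1.map Complex.im *ᵥ a = 0 := by
    ext j
    have := hre (Sum.inl (Fin.castLE hq j))
    rw [hmL.1 j, Complex.im_sum] at this
    rw [Pi.zero_apply, ← this]
    change ∑ l, (z.1 j l).im * a l = _
    refine Finset.sum_congr rfl fun l _ => ?_
    rw [Complex.mul_im, hre]
    simp [ha]
  have ha0 : a = 0 := by
    have hu : IsUnit (z.1.map Complex.im).det := (Matrix.isUnit_iff_isUnit_det _).1 z.2.2.isUnit
    rw [← one_mulVec a, ← Matrix.nonsing_inv_mul _ hu, ← mulVec_mulVec, hYa, mulVec_zero]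
  have hr : ∀ j, m (Sum.inr j) = 0 := fun j => by
    by_cases hj : (j : ℕ) < q
    · exact Complex.ext (congrFun ha0 ⟨j, hj⟩) (hre _)
    · exact hmL.2 j (not_lt.1 hj)
  refine ⟨hr, fun j hj => ?_⟩
  have := hmL.1 ⟨j, hj⟩
  simpa [hr] using this

/-- The inclusion of index sets corresponding to `ℂ^(2q) ⊆ ℂ^(2n)`. -/
def emb {n q : ℕ} (hq : q ≤ n) : Fin q ⊕ Fin q → Fin n ⊕ Fin n :=
  Sum.map (Fin.castLE hq) (Fin.castLE hq)

/-- The basis vector is twice the real part of an element of the Lagrangian, whose image stays in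
the Lagrangian. -/
theorem stable_single_emb {n q : ℕ} {hq : q ≤ n} (z : siegel q) {h : SpQ n}
    (hs : ∀ v ∈ stdSub hq z.1, sig h v ∈ stdSub hq z.1) (x : Fin q ⊕ Fin q) {i : Fin n}
    (hi : q ≤ (i : ℕ)) : sig h (Pi.single (emb hq x) 1) (Sum.inr i) = 0 := by
  obtain ⟨ℓ, hℓ, b, hℓs, -, -⟩ := exists_add_star_eq hq z (star_single (emb hq x)) (fun j hj => by
    rcases x with x | x
    · simp [emb]
    · have : j ≠ Fin.castLE hq x := fun e => by
        rw [e] at hj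
        exact absurd x.2 (not_lt.2 hj)
      simp [emb, this])
  have := (hs ℓ hℓ).2 i hi
  rw [← hℓs, map_add, sig_star, Pi.add_apply, Pi.star_apply, this]
  simp

/-- The matrix of `sig h` on `ℂ^(2q)`. -/
def sigBlock {n q : ℕ} (hq : q ≤ n) (h : SpQ n) : Matrix (Fin q ⊕ Fin q) (Fin q ⊕ Fin q) ℂ :=
  Matrix.of fun a b => sig h (Pi.single (emb hq b) 1) (emb hq a)

/-- The antilinear map with matrix `P` preserves the graph of `z`. -/
def PreservesGraph {q : ℕ} (P : Matrix (Fin q ⊕ Fin q) (Fin q ⊕ Fin q) ℂ)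
    (z : Matrix (Fin q) (Fin q) ℂ) : Prop :=
  ∀ (u : Fin q → ℂ) (i : Fin q),
    (P *ᵥ star (Sum.elim (z *ᵥ u) u)) (Sum.inl i)
      = ∑ j, z i j * (P *ᵥ star (Sum.elim (z *ᵥ u) u)) (Sum.inr j)

theorem isClosed_preservesGraph {q : ℕ} (P : Matrix (Fin q ⊕ Fin q) (Fin q ⊕ Fin q) ℂ) :
    IsClosed {z | PreservesGraph P z} := by
  simp only [PreservesGraph, Set.ofPred_forall]
  refine isClosed_iInter fun u => isClosed_iInter fun i => ?_
  have hc : Continuous fun z : Matrix (Fin q) (Fin q) ℂ => P *ᵥ star (Sum.elim (z *ᵥ u) u) := by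
    refine Continuous.matrix_mulVec continuous_const (Continuous.star ?_)
    refine continuous_pi fun x => ?_
    rcases x with x | x
    · exact (continuous_apply x).comp (continuous_id.matrix_mulVec continuous_const)
    · exact continuous_const
  refine isClosed_eq ((continuous_apply _).comp hc) (continuous_finsetSum _ fun j _ => ?_)
  exact Continuous.mul (by fun_prop) ((continuous_apply _).comp hc)

/-- Reality at the single point `z` already makes `sig h` respect the flag of the component. Reality
at any other `z'` is then a condition on the induced antilinear map of `ℂ^(2q)` alone, which turns
local constancy into a finiteness question about matrices. -/
theorem stable_iff_preservesGraph {n q : ℕ} {hq : q ≤ n} (z : siegel q) {h : SpQ n}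
    (hs : ∀ v ∈ stdSub hq z.1, sig h v ∈ stdSub hq z.1) (z' : Matrix (Fin q) (Fin q) ℂ) :
    (∀ v ∈ stdSub hq z', sig h v ∈ stdSub hq z') ↔ PreservesGraph (sigBlock hq h) z' := by
  have key : ∀ v ∈ stdSub hq z', ∀ a : Fin n ⊕ Fin n,
      (∀ i, q ≤ ((i : Fin n) : ℕ) → sig h (Pi.single (Sum.inl i) 1) a = 0) →
      sig h v a = ∑ b, star (v (emb hq b)) * sig h (Pi.single (emb hq b) 1) a := by
    intro v hv a ha
    rw [sig_eq_sum, Finset.sum_apply, Fintype.sum_sum_type, Fintype.sum_sum_type,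
      sum_castLE hq _ fun i hi => by simp [ha i hi],
      sum_castLE hq _ fun i hi => by simp [hv.2 i hi]]
    rfl
  have key2 : ∀ v ∈ stdSub hq z', ∀ a : Fin q ⊕ Fin q, sig h v (emb hq a) =
      (sigBlock hq h *ᵥ star (Sum.elim (z' *ᵥ fun j => v (Sum.inr (Fin.castLE hq j)))
        fun j => v (Sum.inr (Fin.castLE hq j)))) a := by
    intro v hv a
    rw [key v hv _ fun i hi => ?_]
    · refine Finset.sum_congr rfl fun b _ => ?_
      rw [mul_comm]
      congr 2
      rcases b with b | b
      · exact hv.1 b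
      · rfl
    · rcases a with a | a
      · exact (stable_single_inl z hs hi).2 _ a.2
      · exact (stable_single_inl z hs hi).1 _
  constructor
  · intro H u i
    have hl := lift_mem hq z' u
    have h1 := (H _ hl).1 i
    have e : (fun j => lift hq z' u (Sum.inr (Fin.castLE hq j))) = u := by
      ext j
      simp
    have h2 := key2 _ hl
    rw [e] at h2
    rw [← h2]
    simp only [← h2]
    exact h1
  · intro H v hv
    refine ⟨fun i => ?_, fun i hi => ?_⟩
    · have h1 := H (fun j => v (Sum.inr (Fin.castLE hq j))) i
      simp only [← key2 v hv] at h1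
      exact h1
    · rw [key v hv _ fun j hj => (stable_single_inl z hs hj).1 i]
      exact Finset.sum_eq_zero fun b _ => by rw [stable_single_emb z hs b hi, mul_zero]

theorem finite_bounded_denom {ι : Type*} [Finite ι] {d : ℕ} (hd : 0 < d) (K : ℝ) :
    {P : Matrix ι ι ℂ | ∀ a b, (∃ x : ℤ, (d : ℂ) * P a b = x) ∧ ‖P a b‖ ≤ K}.Finite := by
  classical
  have := Fintype.ofFinite ι
  have hf : (Set.Icc (fun _ _ => -⌈d * K⌉) (fun _ _ => ⌈d * K⌉) : Set (ι → ι → ℤ)).Finite :=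
    Set.finite_Icc _ _
  refine (hf.image fun f => Matrix.of fun a b => (f a b : ℂ) / d).subset fun P hP => ?_
  choose x hx using fun a b => (hP a b).1
  have hd0 : (d : ℂ) ≠ 0 := by exact_mod_cast hd.ne'
  have hb : ∀ a b, |x a b| ≤ ⌈d * K⌉ := fun a b => by
    have h1 := congrArg norm (hx a b)
    rw [norm_mul, Complex.norm_natCast, Complex.norm_intCast] at h1
    have h2 : ((|x a b| : ℤ) : ℝ) ≤ ⌈d * K⌉ := by
      rw [Int.cast_abs, ← h1]
      refine le_trans ?_ (Int.le_ceil _)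
      gcongr
      exact (hP a b).2
    exact_mod_cast h2
  refine ⟨x, ⟨fun a b => (abs_le.1 (hb a b)).1, fun a b => (abs_le.1 (hb a b)).2⟩, ?_⟩
  ext a b
  change (x a b : ℂ) / d = _
  rw [← hx, mul_div_cancel_left₀ _ hd0]

/-- A basis vector is `2 Re ℓ` with `herm ℓ` bounded in terms of `c` and `C`, where `D` bounds the
entries of `Im z` applied to the imaginary part of `ℓ`. Since `herm` is preserved, the lower
coordinates of the image of `ℓ` are at most `2 (S + 1)`; the factor `1 + q C` accounts for the upper
coordinates and a last factor `2` for adding the conjugate. -/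
theorem norm_sigBlock_le {n q : ℕ} {hq : q ≤ n} (z : siegel q) {c C : ℝ} (hc : 0 < c) (hC : 0 < C)
    (hzC : ∀ i j, ‖z.1 i j‖ ≤ C) (hz : ∀ p : Fin q → ℝ, c * ‖p‖ ^ 2 ≤ p ⬝ᵥ (z.1.map Complex.im *ᵥ p) ∧
        p ⬝ᵥ (z.1.map Complex.im *ᵥ p) ≤ C * ‖p‖ ^ 2) {h : SpQ n}
    (hs : ∀ v ∈ stdSub hq z.1, sig h v ∈ stdSub hq z.1) (a b : Fin q ⊕ Fin q) :
    ‖sigBlock hq h a b‖ ≤ 4 * ((C / 4 + (q * (q * C / 2 + 1 / 2)) ^ 2 / c) / c + 1) * (1 + q * C) := by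
  set D : ℝ := q * C / 2 + 1 / 2 with hD
  have hD0 : 0 < D := by positivity
  set Y := z.1.map Complex.im with hY
  have hYps : Y.PosSemidef := z.2.2.posSemidef
  obtain ⟨ℓ, hℓ, b', hℓs, hb', hℓb⟩ := exists_add_star_eq hq z (star_single (emb hq b)) (fun j hj => by
    rcases b with x | x
    · simp [emb]
    · have : j ≠ Fin.castLE hq x := fun e => by
        rw [e] at hj
        exact absurd x.2 (not_lt.2 hj)
      simp [emb, this])
  set ρ : Fin n ⊕ Fin n → ℂ := Pi.single (emb hq b) 1 with hρ
  have hρ1 : ∀ x, |(ρ x).re / 2| ≤ 1 / 2 := fun x => by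
    by_cases hx : x = emb hq b <;> simp [hρ, hx]
  have hherm : herm ℓ ≤ C / 4 + (q * D) ^ 2 / c := by
    rw [herm_eq z.2.1 hℓ]
    simp only [hℓb]
    apply add_le_add
    · refine (hz _).2.trans ?_
      have : ‖fun j => (ρ (Sum.inr (Fin.castLE hq j))).re / 2‖ ≤ 1 / 2 :=
        (pi_norm_le_iff_of_nonneg (by norm_num)).2 fun j => hρ1 _
      calc C * ‖fun j => (ρ (Sum.inr (Fin.castLE hq j))).re / 2‖ ^ 2 ≤ C * (1 / 2) ^ 2 := by gcongr
        _ = C / 4 := by ring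
    · have h1 := (hz b').1
      have h2 : b' ⬝ᵥ (Y *ᵥ b') ≤ ‖b'‖ * (q * D) := by
        rw [dotProduct]
        calc ∑ i, b' i * (Y *ᵥ b') i ≤ ∑ _i : Fin q, ‖b'‖ * D := by
              refine Finset.sum_le_sum fun i _ => (le_abs_self _).trans ?_
              rw [abs_mul]
              gcongr
              · exact norm_le_pi_norm b' i
              · rw [hY, hb']
                refine (abs_sub _ _).trans ?_
                refine add_le_add ?_ (hρ1 _)
                refine (Finset.abs_sum_le_sum_abs _ _).trans ?_
                calc ∑ j, |(z.1 i j).re * ((ρ (Sum.inr (Fin.castLE hq j))).re / 2)|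
                    ≤ ∑ _j : Fin q, C * (1 / 2) := by
                      refine Finset.sum_le_sum fun j _ => ?_
                      rw [abs_mul]
                      gcongr
                      · exact (Complex.abs_re_le_norm _).trans (hzC i j)
                      · exact hρ1 _
                  _ = q * C / 2 := by
                      simp
                      ring
          _ = _ := by
              simp
              ring
      have h3 : ‖b'‖ * c ≤ q * D := by
        rcases (norm_nonneg b').eq_or_lt with h0 | h0
        · rw [← h0]
          simp only [zero_mul]
          positivity
        · nlinarith
      change b' ⬝ᵥ (Y *ᵥ b') ≤ _
      rw [le_div_iff₀ hc]
      have : 0 ≤ (q : ℝ) * D := by positivity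
      nlinarith
  set S : ℝ := (C / 4 + (q * D) ^ 2 / c) / c with hS
  set m := sig h ℓ with hm
  have hmL : m ∈ stdSub hq z.1 := hs ℓ hℓ
  have hms : m + star m = sig h ρ := by rw [hm, ← sig_star, ← map_add, hℓs]
  have hmh : herm m ≤ S * c := by
    rw [hm, herm_sig, hS, div_mul_cancel₀ _ hc.ne']
    exact hherm
  rw [herm_eq z.2.1 hmL] at hmh
  have ha0 := hYps.dotProduct_mulVec_nonneg fun j => (m (Sum.inr (Fin.castLE hq j))).re
  have hb0 := hYps.dotProduct_mulVec_nonneg fun j => (m (Sum.inr (Fin.castLE hq j))).im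
  rw [star_trivial] at ha0 hb0
  have hbd : ∀ (p : Fin q → ℝ), p ⬝ᵥ (Y *ᵥ p) ≤ S * c → ∀ j, |p j| ≤ S + 1 := fun p hp j => by
    have h1 := (hz p).1.trans hp
    have h2 : |p j| ≤ ‖p‖ := norm_le_pi_norm p j
    have h3 : ‖p‖ ^ 2 ≤ S := by nlinarith
    nlinarith [sq_nonneg (‖p‖ - 1), norm_nonneg p]
  have hure := hbd _ (by linarith : (fun j => (m (Sum.inr (Fin.castLE hq j))).re) ⬝ᵥ
    (Y *ᵥ fun j => (m (Sum.inr (Fin.castLE hq j))).re) ≤ S * c)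
  have huim := hbd _ (by linarith : (fun j => (m (Sum.inr (Fin.castLE hq j))).im) ⬝ᵥ
    (Y *ᵥ fun j => (m (Sum.inr (Fin.castLE hq j))).im) ≤ S * c)
  have hu : ∀ j : Fin q, ‖m (Sum.inr (Fin.castLE hq j))‖ ≤ 2 * (S + 1) := fun j => by
    have := Complex.norm_le_abs_re_add_abs_im (m (Sum.inr (Fin.castLE hq j)))
    linarith [hure j, huim j]
  have hS0 : 0 ≤ S := by positivity
  have hm2 : ‖m (emb hq a)‖ ≤ 2 * (S + 1) * (1 + q * C) := by
    rcases a with a | a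
    · change ‖m (Sum.inl (Fin.castLE hq a))‖ ≤ _
      rw [hmL.1 a]
      calc _ ≤ ∑ _j : Fin q, C * (2 * (S + 1)) := by
            refine (norm_sum_le _ _).trans (Finset.sum_le_sum fun j _ => ?_)
            rw [norm_mul]
            gcongr
            · exact hzC a j
            · exact hu j
        _ = 2 * (S + 1) * (q * C) := by
            simp
            ring
        _ ≤ _ := by
            gcongr
            linarith
    · refine (hu a).trans ?_
      have : 0 ≤ (q : ℝ) * C := by positivity
      nlinarith
  change ‖sig h ρ (emb hq a)‖ ≤ _
  rw [← hms, Pi.add_apply, Pi.star_apply]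
  refine (norm_add_le _ _).trans ?_
  rw [norm_star]
  linarith

/-- Reality at points near `z` for elements with bounded denominators implies reality at `z`. -/
theorem exists_nhd_stable {n q d : ℕ} (hq : q ≤ n) (hd : 0 < d) (z : siegel q) :
    ∃ V : Set (Matrix (Fin q) (Fin q) ℂ), IsOpen V ∧ z.1 ∈ V ∧
      ∀ h : SpQ n, HasDenom d h → ∀ z' : siegel q, z'.1 ∈ V →
        (∀ v ∈ stdSub hq z'.1, sig h v ∈ stdSub hq z'.1) →
        ∀ v ∈ stdSub hq z.1, sig h v ∈ stdSub hq z.1 := by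
  obtain ⟨V₀, hV₀, hzV₀, c, C, hc, hC, hb⟩ := exists_nhd_bounds z
  set K : ℝ := 4 * ((C / 4 + (q * (q * C / 2 + 1 / 2)) ^ 2 / c) / c + 1) * (1 + q * C)
  set SP := {P : Matrix (Fin q ⊕ Fin q) (Fin q ⊕ Fin q) ℂ |
    ∀ a b, (∃ x : ℤ, (d : ℂ) * P a b = x) ∧ ‖P a b‖ ≤ K} with hSP
  have hfin : SP.Finite := finite_bounded_denom hd K
  -- Each of these finitely many matrices preserves the graph only on a closed set missing `z`;
  -- removing those closed sets leaves a neighbourhood of `z`.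
  set SQ := {P ∈ SP | ¬PreservesGraph P z.1} with hSQ
  have hfin' : SQ.Finite := hfin.subset fun P hP => hP.1
  refine ⟨V₀ ∩ ⋂ P ∈ SQ, {z' | PreservesGraph P z'}ᶜ, hV₀.inter (hfin'.isOpen_biInter fun P _ =>
    (isClosed_preservesGraph P).isOpen_compl), ⟨hzV₀, ?_⟩, ?_⟩
  · simp only [Set.mem_iInter]
    exact fun P hP => hP.2
  · rintro h hh z' ⟨hz'0, hz'⟩ hs
    rw [stable_iff_preservesGraph z' hs]
    by_contra hcon
    simp only [Set.mem_iInter] at hz'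
    refine hz' (sigBlock hq h) ⟨fun a b => ⟨hh.sig_single _ _, ?_⟩, hcon⟩
      ((stable_iff_preservesGraph z' hs z'.1).1 hs)
    exact norm_sigBlock_le z' hc hC (hb _ hz'0).1 (hb _ hz'0).2 hs a b

/-! ### `V_ℝ` is closed -/

theorem proj_mem_VReal_iff {n N : ℕ} (x : Satake n) :
    proj n N x ∈ VReal n N ↔ ∃ γ ∈ congruenceSubgroup n N, tau x = γ • x := by
  have h : proj n N x ∈ VReal n N ↔ proj n N (tau x) = proj n N x := Iff.rfl
  rw [h, proj, proj, Quotient.eq, MulAction.orbitRel_apply, MulAction.mem_orbit_iff]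
  constructor
  · rintro ⟨⟨γ, hγ⟩, e⟩
    exact ⟨γ, hγ, e.symm⟩
  · rintro ⟨γ, hγ, e⟩
    exact ⟨⟨γ, hγ⟩, e.symm⟩

theorem tau_smul_eq_iff {n : ℕ} (g γ : SpQ n) (x : Satake n) :
    tau (g • x) = γ • g • x ↔ tau x = ((tauSp g)⁻¹ * γ * g) • x := by
  rw [tau_smul, mul_smul, mul_smul, eq_inv_smul_iff]

theorem sub_diagonal_le {q r : ℕ} {Y : Matrix (Fin r) (Fin r) ℝ} {k : ℝ} (hk : 0 < k)
    (h : (Y - k • Matrix.diagonal (fun i : Fin r => if q ≤ (i : ℕ) then (1 : ℝ) else 0)).PosDef)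
    (p : Fin r → ℝ) (j : Fin r) (hj : q ≤ (j : ℕ)) : k * p j ^ 2 ≤ p ⬝ᵥ (Y *ᵥ p) := by
  have h1 := h.posSemidef.dotProduct_mulVec_nonneg p
  rw [star_trivial, sub_mulVec, dotProduct_sub, sub_nonneg, smul_mulVec, dotProduct_smul,
    smul_eq_mul] at h1
  refine le_trans ?_ h1
  gcongr
  rw [dotProduct]
  have h2 : ∀ i ∈ Finset.univ, 0 ≤ p i * ((Matrix.diagonal fun i : Fin r =>
      if q ≤ (i : ℕ) then (1 : ℝ) else 0) *ᵥ p) i := fun i _ => by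
    rw [mulVec_diagonal]
    split_ifs
    · nlinarith [sq_nonneg (p i)]
    · simp
  refine le_trans (le_of_eq ?_) (Finset.single_le_sum h2 (Finset.mem_univ j))
  rw [mulVec_diagonal, if_pos hj]
  ring

/-- A non-real point has a non-real basic neighbourhood: reality descends from a nearby point to its
projection on the component, and from there to the centre `z`. -/
theorem isClosed_VReal (n N : ℕ) : IsClosed (VReal n N) := by
  rw [← isOpen_compl_iff]
  change ∀ (q : ℕ) (hq : q ≤ n) (g : SpQ n) (z : siegel q),
    proj n N (g • std hq z) ∉ VReal n N →
    ∃ V : Set (Matrix (Fin q) (Fin q) ℂ), IsOpen V ∧ z.1 ∈ V ∧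
      ∃ k : ℝ, 0 < k ∧ ∀ y ∈ basicNhd hq V k, proj n N (g • y) ∉ VReal n N
  intro q hq g z hgz
  simp only [proj_mem_VReal_iff] at hgz ⊢
  obtain ⟨e, he, hge⟩ := exists_hasDenom g
  -- This is a common denominator of `(tauSp g)⁻¹ * γ * g` for all integral `γ`; conjugating by the
  -- integral `δ` of the basic neighbourhood does not change it.
  set d : ℕ := e * 1 * e with hd
  have hd0 : 0 < d := by positivity
  obtain ⟨V₁, hV₁, hzV₁, c, C, hc, hC, hb⟩ := exists_nhd_bounds z
  obtain ⟨V₂, hV₂, hzV₂, hst⟩ := exists_nhd_stable hq hd0 z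
  -- The three summands serve the three inequalities on `k` required by `stable_of_close`.
  set k : ℝ := (d : ℝ) ^ 2 * (1 + 1 / c + C) + 1 with hk
  have hk0 : 0 < k := by positivity
  have hd2 : (0 : ℝ) < (d : ℝ) ^ 2 := by positivity
  have hkd : (d : ℝ) ^ 2 < k := by
    have : 0 ≤ (d : ℝ) ^ 2 * (1 / c + C) := by positivity
    linarith
  have hk1 : 1 ≤ k := by
    have : 0 ≤ (d : ℝ) ^ 2 * (1 + 1 / c + C) := by positivity
    linarith
  refine ⟨V₁ ∩ V₂, hV₁.inter hV₂, ⟨hzV₁, hzV₂⟩, k, hk0, ?_⟩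
  rintro y ⟨r, hr, hqr, Z, ⟨hZ1, hZ2⟩, hZk, δ, ⟨hδ, hδz⟩, rfl⟩ ⟨γ, hγ, hy⟩
  rw [tau_smul_eq_iff, tau_smul_eq_iff, tau_std_iff] at hy
  set h : SpQ n := (tauSp g)⁻¹ * γ * g with hh
  have hhd : HasDenom d h := (hge.tauSp.inv.mul (hasDenom_one_of_mem hγ)).mul hge
  have hδ1 := hasDenom_one_of_mem hδ
  have hhd' : HasDenom d ((tauSp δ)⁻¹ * h * δ) := by
    have := (hδ1.tauSp.inv.mul hhd).mul hδ1
    rwa [one_mul, mul_one] at this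
  set Z₁ : siegel q := ⟨_, submatrix_mem_siegel hqr Z⟩ with hZ₁
  have h1 := stable_of_close hr hqr Z hd0 hc hk0 (fun p => (hb _ hZ1).2 p)
    (fun p j hj => sub_diagonal_le hk0 hZk p j hj) (by nlinarith)
    (by
      have : (d : ℝ) ^ 2 * (1 + 1 / c + C) * c = (d : ℝ) ^ 2 + (d : ℝ) ^ 2 * (1 + C) * c := by
        field_simp
        ring
      have : 0 ≤ (d : ℝ) ^ 2 * (1 + C) * c := by positivity
      nlinarith)
    (by
      have : 0 ≤ (d : ℝ) ^ 2 * (1 + 1 / c) := by positivity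
      linarith) hhd' hy
  have h2 := (tau_std_iff (hq := hq) Z₁ _).2 h1
  -- Since `δ` fixes the component pointwise, it can be dropped as soon as reality is known on the
  -- component.
  rw [← tau_smul_eq_iff, hδz Z₁, tau_std_iff] at h2
  have h3 := hst h hhd Z₁ hZ2 h2
  rw [← tau_std_iff, ← tau_smul_eq_iff] at h3
  exact hgz ⟨γ, hγ, h3⟩

/-! ### The action on `𝔥_n` -/

theorem herm_nonneg {n q : ℕ} {hq : q ≤ n} (z : siegel q) {v : Fin n ⊕ Fin n → ℂ}
    (hv : v ∈ stdSub hq z.1) : 0 ≤ herm v := by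
  rw [herm_eq z.2.1 hv]
  have h1 := z.2.2.posSemidef.dotProduct_mulVec_nonneg
    fun j => (v (Sum.inr (Fin.castLE hq j))).re
  have h2 := z.2.2.posSemidef.dotProduct_mulVec_nonneg
    fun j => (v (Sum.inr (Fin.castLE hq j))).im
  rw [star_trivial] at h1 h2
  exact add_nonneg h1 h2

theorem inr_eq_zero_of_herm {n q : ℕ} {hq : q ≤ n} (z : siegel q) {v : Fin n ⊕ Fin n → ℂ}
    (hv : v ∈ stdSub hq z.1) (h : herm v = 0) (i : Fin n) : v (Sum.inr i) = 0 := by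
  by_cases hi : (i : ℕ) < q
  · rw [herm_eq z.2.1 hv] at h
    have h1 := z.2.2.posSemidef.dotProduct_mulVec_nonneg
      fun j => (v (Sum.inr (Fin.castLE hq j))).re
    have h2 := z.2.2.posSemidef.dotProduct_mulVec_nonneg
      fun j => (v (Sum.inr (Fin.castLE hq j))).im
    rw [star_trivial] at h1 h2
    have h3 : (fun j => (v (Sum.inr (Fin.castLE hq j))).re) = 0 := by
      by_contra hne
      have := z.2.2.dotProduct_mulVec_pos hne
      rw [star_trivial] at this
      linarith
    have h4 : (fun j => (v (Sum.inr (Fin.castLE hq j))).im) = 0 := by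
      by_contra hne
      have := z.2.2.dotProduct_mulVec_pos hne
      rw [star_trivial] at this
      linarith
    exact Complex.ext (congrFun h3 ⟨i, hi⟩) (congrFun h4 ⟨i, hi⟩)
  · exact hv.2 i (not_lt.1 hi)

theorem mem_stdSub_self {n : ℕ} {Z : Matrix (Fin n) (Fin n) ℂ} {v : Fin n ⊕ Fin n → ℂ} :
    v ∈ stdSub le_rfl Z ↔ v ∘ Sum.inl = Z *ᵥ (v ∘ Sum.inr) := by
  rw [mem_stdSub, funext_iff]
  constructor
  · exact fun h i => h.1 i
  · exact fun h => ⟨fun i => h i, fun i hi => absurd i.2 (not_lt.2 hi)⟩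

theorem toC_mulVec_of_mem {n : ℕ} (g : SpQ n) {Z : Matrix (Fin n) (Fin n) ℂ}
    {v : Fin n ⊕ Fin n → ℂ} (hv : v ∈ stdSub le_rfl Z) :
    toC g *ᵥ v = Sum.elim (((toC g).toBlocks₁₁ * Z + (toC g).toBlocks₁₂) *ᵥ (v ∘ Sum.inr))
      (((toC g).toBlocks₂₁ * Z + (toC g).toBlocks₂₂) *ᵥ (v ∘ Sum.inr)) := by
  rw [mem_stdSub_self] at hv
  conv_lhs => rw [← fromBlocks_toBlocks (toC g)]
  rw [fromBlocks_mulVec, hv]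
  simp only [mulVec_mulVec, add_mulVec]

/-- A kernel vector would give an element of the Lagrangian whose image has zero lower half, hence
zero `herm`, contradicting definiteness at an interior point. -/
theorem isUnit_det_denom {n : ℕ} (g : SpQ n) (Z : siegel n) :
    IsUnit ((toC g).toBlocks₂₁ * Z.1 + (toC g).toBlocks₂₂).det := by
  by_contra hcon
  rw [isUnit_iff_ne_zero, not_not] at hcon
  obtain ⟨u, hu, hu0⟩ := Matrix.exists_mulVec_eq_zero_iff.2 hcon
  have hv : (Sum.elim (Z.1 *ᵥ u) u : Fin n ⊕ Fin n → ℂ) ∈ stdSub le_rfl Z.1 := by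
    rw [mem_stdSub_self, Sum.elim_comp_inl, Sum.elim_comp_inr]
  have h1 := toC_mulVec_of_mem g hv
  rw [Sum.elim_comp_inr, hu0] at h1
  have h2 : herm (toC g *ᵥ Sum.elim (Z.1 *ᵥ u) u) = 0 := by
    rw [h1, herm, om_apply]
    simp
  rw [herm_toC] at h2
  exact hu (funext fun i => inr_eq_zero_of_herm Z hv h2 i)

theorem actSub_stdSub_self {n : ℕ} (g : SpQ n) (Z : siegel n) :
    actSub g (stdSub le_rfl Z.1) = stdSub le_rfl (moebius g Z.1) := by
  have hM := isUnit_det_denom g Z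
  set M := (toC g).toBlocks₂₁ * Z.1 + (toC g).toBlocks₂₂ with hMdef
  have hmob : moebius g Z.1 = ((toC g).toBlocks₁₁ * Z.1 + (toC g).toBlocks₁₂) * M⁻¹ := rfl
  ext w
  constructor
  · rintro ⟨v, hv, rfl⟩
    rw [mulVecLin_apply, toC_mulVec_of_mem g hv, mem_stdSub_self, Sum.elim_comp_inl,
      Sum.elim_comp_inr, hmob, mulVec_mulVec, Matrix.mul_assoc, ← hMdef,
      Matrix.nonsing_inv_mul _ hM, Matrix.mul_one]
  · intro hw
    rw [mem_stdSub_self] at hw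
    set u := M⁻¹ *ᵥ (w ∘ Sum.inr) with hu
    have hv : (Sum.elim (Z.1 *ᵥ u) u : Fin n ⊕ Fin n → ℂ) ∈ stdSub le_rfl Z.1 := by
      rw [mem_stdSub_self, Sum.elim_comp_inl, Sum.elim_comp_inr]
    refine ⟨_, hv, ?_⟩
    rw [mulVecLin_apply, toC_mulVec_of_mem g hv, Sum.elim_comp_inr, ← hMdef, hu, mulVec_mulVec,
      mulVec_mulVec, Matrix.mul_nonsing_inv _ hM, one_mulVec, ← hmob, ← hw, Sum.elim_comp_inl_inr]

/-- Symmetry is the isotropy of the image Lagrangian, and positivity is the invariance of `herm`. -/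
theorem moebius_mem_siegel {n : ℕ} (g : SpQ n) (Z : siegel n) : moebius g Z.1 ∈ siegel n := by
  have hact := actSub_stdSub_self g Z
  have hpre : ∀ u : Fin n → ℂ, ∃ v ∈ stdSub le_rfl Z.1,
      toC g *ᵥ v = lift le_rfl (moebius g Z.1) u := fun u => by
    have := lift_mem le_rfl (moebius g Z.1) u
    rw [← hact] at this
    exact this
  have hsymm : (moebius g Z.1)ᵀ = moebius g Z.1 := by
    ext i j
    obtain ⟨v, hv, hve⟩ := hpre (Pi.single i 1)
    obtain ⟨w, hw, hwe⟩ := hpre (Pi.single j 1)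
    have h := om_eq_zero Z.2.1 hv hw
    rw [← om_toC g, hve, hwe, om_apply] at h
    have e1 : ∀ (u : Fin n → ℂ) (i : Fin n), lift le_rfl (moebius g Z.1) u (Sum.inl i)
      = ∑ j, moebius g Z.1 i j * u j := fun u i => lift_inl le_rfl _ u i
    have e2 : ∀ (u : Fin n → ℂ) (i : Fin n), lift le_rfl (moebius g Z.1) u (Sum.inr i) = u i :=
      fun u i => lift_inr le_rfl _ u i
    simp only [e1, e2, Finset.sum_sub_distrib] at h
    simp [Pi.single_apply] at h
    rw [transpose_apply, sub_eq_zero.1 h]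
  refine ⟨hsymm, ?_⟩
  refine PosDef.of_dotProduct_mulVec_pos ?_ fun p hp => ?_
  · ext i j
    change ((moebius g Z.1)ᵀ i j).im = _
    rw [hsymm]
    rfl
  · rw [star_trivial]
    obtain ⟨v, hv, hve⟩ := hpre fun j => (p j : ℂ)
    have h1 := herm_eq hsymm (lift_mem le_rfl (moebius g Z.1) fun j => (p j : ℂ))
    simp only [lift_inr, Complex.ofReal_re, Complex.ofReal_im] at h1
    have e : (fun _ : Fin n => (0 : ℝ)) = 0 := rfl
    rw [e, zero_dotProduct, add_zero, ← hve, herm_toC] at h1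
    rw [← h1]
    refine (herm_nonneg Z hv).lt_of_ne' fun h0 => hp ?_
    have hv0 := inr_eq_zero_of_herm Z hv h0
    have hvz : v = 0 := by
      ext i
      rcases i with i | i
      · have := congrFun (mem_stdSub_self.1 hv) i
        simpa [hv0, mulVec, dotProduct] using this
      · exact hv0 i
    rw [hvz, mulVec_zero] at hve
    ext j
    have := congrFun hve (Sum.inr (Fin.castLE le_rfl j))
    rw [lift_inr] at this
    exact Complex.ofReal_eq_zero.1 this.symm

theorem smul_incl {n : ℕ} (g : SpQ n) (Z : siegel n) :
    g • incl n Z = incl n ⟨moebius g Z.1, moebius_mem_siegel g Z⟩ :=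
  Subtype.ext (actSub_stdSub_self g Z)

theorem stdSub_self_injective {n : ℕ} {Z Z' : Matrix (Fin n) (Fin n) ℂ}
    (h : stdSub le_rfl Z = stdSub le_rfl Z') : Z = Z' := by
  ext i j
  have h1 := lift_mem le_rfl Z (Pi.single j 1)
  rw [h] at h1
  have h2 := h1.1 i
  rw [lift_inl] at h2
  simpa [Pi.single_apply, lift] using h2

theorem mem_realLocus_iff {n : ℕ} (γ : SpQ n) (Z : siegel n) :
    Z ∈ realLocus γ ↔ tau (incl n Z) = γ • incl n Z := by
  have e : tau (incl n Z) = incl n ⟨_, neg_conj_mem_siegel Z.2⟩ :=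
    Subtype.ext (tauSub_stdSub le_rfl Z.1)
  rw [smul_incl, e]
  constructor
  · intro h
    exact Subtype.ext (congrArg (stdSub le_rfl) (show moebius γ Z.1 = _ from h).symm)
  · intro h
    exact (stdSub_self_injective (congrArg Subtype.val h)).symm

/-! ### The strata of rank `n` and `n - 1` -/

theorem continuous_proj (n N : ℕ) : Continuous (proj n N) := continuous_quotient_mk'

theorem stratumReal_zero_subset (n N : ℕ) : stratumReal n N 0 ⊆ XReal n N := by
  rintro v ⟨⟨q, F, hq, ⟨hqn, g, rfl⟩, x, ⟨Z, rfl⟩, rfl⟩, hv⟩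
  obtain rfl : q = n := hq
  exact ⟨⟨⟨_, moebius_mem_siegel g Z⟩, congrArg (proj q N) (smul_incl g Z).symm⟩, hv⟩

/-- A `τ`-fixed point of `V` lifts to a `γ`-real point for some `γ` in the group, and the continuous
projection carries closures into closures. -/
theorem stratumReal_one_subset {n N : ℕ}
    (H : ∀ (q : ℕ) (F : Set (Satake n)), q + 1 = n → IsRationalBoundaryComponent q F →
      ∀ γ ∈ congruenceSubgroup n N, componentReal F γ ⊆
        closure (incl n '' groupRealLocus (congruenceSubgroup n N))) :
    stratumReal n N 1 ⊆ closure (XReal n N) := by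
  rintro v ⟨⟨q, F, hq, hF, x, hx, rfl⟩, hv⟩
  obtain ⟨γ, hγ, hxγ⟩ := (proj_mem_VReal_iff x).1 hv
  have h1 := H q F hq hF γ hγ ⟨hx, hxγ⟩
  refine closure_mono ?_ (image_closure_subset_closure_image (continuous_proj n N) ⟨x, h1, rfl⟩)
  rintro _ ⟨_, ⟨Z, hZ, rfl⟩, rfl⟩
  simp only [groupRealLocus, Set.mem_iUnion] at hZ
  obtain ⟨δ, hδ, hZ⟩ := hZ
  exact ⟨⟨Z, rfl⟩, (proj_mem_VReal_iff _).2 ⟨δ, hδ, (mem_realLocus_iff δ Z).1 hZ⟩⟩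

/-! ### Real points over a component of corank one -/

/-- The matrix `(z w; wᵀ t)`. -/
def border {R : Type*} {q : ℕ} (z : Matrix (Fin q) (Fin q) R) (w : Fin q → R) (t : R) :
    Matrix (Fin (q + 1)) (Fin (q + 1)) R :=
  Matrix.of fun i => Fin.lastCases (motive := fun _ => Fin (q + 1) → R)
    (fun j => Fin.lastCases (motive := fun _ => R) t w j)
    (fun i' j => Fin.lastCases (motive := fun _ => R) (w i') (z i') j) i

section border

variable {R : Type*} {q : ℕ} (z : Matrix (Fin q) (Fin q) R) (w : Fin q → R) (t : R)

@[simp] theorem border_castSucc_castSucc (i j : Fin q) :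
    border z w t i.castSucc j.castSucc = z i j := by simp [border]

@[simp] theorem border_castSucc_last (i : Fin q) :
    border z w t i.castSucc (Fin.last q) = w i := by simp [border]

@[simp] theorem border_last_castSucc (j : Fin q) :
    border z w t (Fin.last q) j.castSucc = w j := by simp [border]

@[simp] theorem border_last_last : border z w t (Fin.last q) (Fin.last q) = t := by simp [border]

end border

theorem border_ext {R : Type*} {q : ℕ} {M M' : Matrix (Fin (q + 1)) (Fin (q + 1)) R}
    (h1 : ∀ i j : Fin q, M i.castSucc j.castSucc = M' i.castSucc j.castSucc)
    (h2 : ∀ i : Fin q, M i.castSucc (Fin.last q) = M' i.castSucc (Fin.last q))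
    (h3 : ∀ j : Fin q, M (Fin.last q) j.castSucc = M' (Fin.last q) j.castSucc)
    (h4 : M (Fin.last q) (Fin.last q) = M' (Fin.last q) (Fin.last q)) : M = M' := by
  ext i j
  refine Fin.lastCases ?_ (fun i => ?_) i <;> refine Fin.lastCases ?_ (fun j => ?_) j
  · exact h4
  · exact h3 j
  · exact h2 i
  · exact h1 i j

/-- Complete the square: the hypothesis says that the Schur complement of `y` is positive. -/
theorem border_posDef {q : ℕ} {y : Matrix (Fin q) (Fin q) ℝ} (hy : y.PosDef) (b : Fin q → ℝ) {T : ℝ}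
    (hT : (y⁻¹ *ᵥ b) ⬝ᵥ b < T) : (border y b T).PosDef := by
  have hys : ∀ i j, y i j = y j i := fun i j => by
    have := congrFun (congrFun hy.1 j) i
    simpa using this
  refine PosDef.of_dotProduct_mulVec_pos ?_ fun p hp => ?_
  · refine border_ext ?_ ?_ ?_ ?_ <;> simp [hys]
  · rw [star_trivial]
    set p₁ : Fin q → ℝ := fun i => p i.castSucc with hp₁
    set s := p (Fin.last q) with hs
    set x := y⁻¹ *ᵥ b with hx
    have hyx : y *ᵥ x = b := by
      rw [hx, mulVec_mulVec, Matrix.mul_nonsing_inv _ ((Matrix.isUnit_iff_isUnit_det _).1 hy.isUnit),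
        one_mulVec]
    have e1 : p ⬝ᵥ (border y b T *ᵥ p) = p₁ ⬝ᵥ (y *ᵥ p₁) + 2 * s * (b ⬝ᵥ p₁) + T * s ^ 2 := by
      simp only [dotProduct, mulVec, Fin.sum_univ_castSucc, border_castSucc_castSucc,
        border_castSucc_last, border_last_castSucc, border_last_last, mul_add,
        Finset.sum_add_distrib, ← hs]
      have : ∑ i, p i.castSucc * (b i * s) = s * ∑ i, b i * p₁ i := by
        rw [Finset.mul_sum]
        exact Finset.sum_congr rfl fun i _ => by simp only [hp₁]; ring
      rw [this]
      simp only [hp₁]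
      ring
    have hxs : x ⬝ᵥ (y *ᵥ p₁) = b ⬝ᵥ p₁ := by
      have : yᵀ = y := by ext i j; exact hys j i
      rw [dotProduct_mulVec, ← mulVec_transpose, this, hyx]
    have e2 : (p₁ + s • x) ⬝ᵥ (y *ᵥ (p₁ + s • x))
        = p₁ ⬝ᵥ (y *ᵥ p₁) + 2 * s * (b ⬝ᵥ p₁) + s ^ 2 * (x ⬝ᵥ b) := by
      simp only [mulVec_add, mulVec_smul, dotProduct_add, add_dotProduct, smul_dotProduct,
        dotProduct_smul, smul_eq_mul, hyx, hxs, dotProduct_comm p₁ b]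
      ring
    have h0 := hy.posSemidef.dotProduct_mulVec_nonneg (p₁ + s • x)
    rw [star_trivial, e2] at h0
    rw [e1]
    by_cases hs0 : s = 0
    · have hp0 : p₁ ≠ 0 := fun h => hp (by
        ext i
        refine Fin.lastCases hs0 (fun i => congrFun h i) i)
      have := hy.dotProduct_mulVec_pos hp0
      rw [star_trivial] at this
      simpa [hs0] using this
    · have : 0 < s ^ 2 := by positivity
      nlinarith

theorem mem_stdSub_succ {q : ℕ} {hq : q ≤ q + 1} {z : Matrix (Fin q) (Fin q) ℂ}
    {v : Fin (q + 1) ⊕ Fin (q + 1) → ℂ} :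
    v ∈ stdSub hq z ↔ (∀ i : Fin q, v (Sum.inl i.castSucc)
      = ∑ j, z i j * v (Sum.inr j.castSucc)) ∧ v (Sum.inr (Fin.last q)) = 0 := by
  rw [mem_stdSub]
  refine and_congr Iff.rfl ⟨fun h => h _ le_rfl, fun h i hi => ?_⟩
  have : i = Fin.last q := Fin.ext (le_antisymm (Nat.lt_succ_iff.1 i.2) hi)
  rw [this, h]

theorem mem_stdSub_border {q : ℕ} {z : Matrix (Fin q) (Fin q) ℂ} {w : Fin q → ℂ} {t : ℂ}
    {v : Fin (q + 1) ⊕ Fin (q + 1) → ℂ} :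
    v ∈ stdSub le_rfl (border z w t) ↔ (∀ i : Fin q, v (Sum.inl i.castSucc)
      = ∑ j, z i j * v (Sum.inr j.castSucc) + w i * v (Sum.inr (Fin.last q))) ∧
      v (Sum.inl (Fin.last q)) = ∑ j, w j * v (Sum.inr j.castSucc) + t * v (Sum.inr (Fin.last q)) := by
  rw [mem_stdSub]
  have : ∀ i : Fin (q + 1), (∑ j, border z w t i j * v (Sum.inr (Fin.castLE le_rfl j)))
      = ∑ j : Fin q, border z w t i j.castSucc * v (Sum.inr j.castSucc)
        + border z w t i (Fin.last q) * v (Sum.inr (Fin.last q)) := fun i => by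
    rw [Fin.sum_univ_castSucc]
    rfl
  simp only [this]
  constructor
  · rintro ⟨h, -⟩
    refine ⟨fun i => ?_, ?_⟩
    · simpa using h i.castSucc
    · simpa using h (Fin.last q)
  · rintro ⟨h1, h2⟩
    refine ⟨fun i => ?_, fun i hi => absurd i.2 (not_lt.2 hi)⟩
    refine Fin.lastCases ?_ (fun i => ?_) i
    · simpa using h2
    · simpa using h1 i

/-- An antiholomorphic involution of the fibre over `z ∈ 𝔥_q` has fixed points close to `F_q`. -/
theorem exists_real_point {q : ℕ} (hq : q ≤ q + 1) (z : siegel q) (h : SpQ (q + 1)) {ε : ℝ}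
    (hε : ε * ε = 1) (hs : ∀ v ∈ stdSub hq z.1, sig h v ∈ stdSub hq z.1)
    (he : sig h (Pi.single (Sum.inl (Fin.last q)) 1)
      = (ε : ℂ) • (Pi.single (Sum.inl (Fin.last q)) 1 : Fin (q + 1) ⊕ Fin (q + 1) → ℂ))
    (hinv : ∀ v : Fin (q + 1) ⊕ Fin (q + 1) → ℂ, v (Sum.inr (Fin.last q)) = 0 →
      sig h (sig h v) = v) (k : ℝ) :
    ∃ Z : siegel (q + 1), Z.1.submatrix (Fin.castLE hq) (Fin.castLE hq) = z.1 ∧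
      (Z.1.map Complex.im - k • Matrix.diagonal
        (fun i : Fin (q + 1) => if q ≤ (i : ℕ) then (1 : ℝ) else 0)).PosDef ∧
      ∀ v ∈ stdSub le_rfl Z.1, sig h v ∈ stdSub le_rfl Z.1 := by
  set e : Fin (q + 1) ⊕ Fin (q + 1) → ℂ := Pi.single (Sum.inl (Fin.last q)) 1 with hedef
  have hεC : (ε : ℂ) * ε = 1 := by exact_mod_cast hε
  have heL : e ∈ stdSub hq z.1 := single_inl_mem hq z.1 (by simp)
  have hom_e : ∀ v, om (q + 1) e v = -v (Sum.inr (Fin.last q)) := fun v => om_single_inl _ v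
  have hzs : ∀ i j, z.1 i j = z.1 j i := fun i j => by conv_lhs => rw [← z.2.1, transpose_apply]
  -- the coordinate along `e`, made equivariant
  obtain ⟨κ, hκe, hκs⟩ : ∃ κ : (Fin (q + 1) ⊕ Fin (q + 1) → ℂ) →ₗ[ℂ] ℂ, κ e = 1 ∧
      ∀ p : Fin (q + 1) ⊕ Fin (q + 1) → ℂ, p (Sum.inr (Fin.last q)) = 0 →
        κ (sig h p) = ε * star (κ p) := by
    -- The last upper coordinate is averaged with its transform under `sig h`; this is equivariant
    -- where `sig h` is an involution, that is, on `e^⊥`. Its kernel in the Lagrangian is a stable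
    -- complement of `e`.
    refine ⟨{ toFun := fun p => (p (Sum.inl (Fin.last q))
                + ε * star (sig h p (Sum.inl (Fin.last q)))) / 2
              map_add' := fun p p' => ?_
              map_smul' := fun c p => ?_ }, ?_, fun p hp => ?_⟩
    · simp only [map_add, Pi.add_apply, star_add]
      ring
    · rw [LinearMap.map_smulₛₗ]
      simp only [Pi.smul_apply, smul_eq_mul, star_mul', RingHom.id_apply]
      rw [Complex.star_def, Complex.conj_conj]
      ring
    · simp only [LinearMap.coe_mk, AddHom.coe_mk, he]
      simp [hedef, hεC]
    · simp only [LinearMap.coe_mk, AddHom.coe_mk, hinv p hp]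
      simp only [star_div₀, star_add, star_mul', star_star, star_ofNat]
      rw [Complex.star_def, Complex.conj_ofReal]
      linear_combination (-(sig h p (Sum.inl (Fin.last q))) / 2) * hεC
  -- The off-diagonal column is chosen so that the Lagrangian of `border z w t` contains the kernel
  -- of `κ`, whatever `t` is.
  set w : Fin q → ℂ := fun j => -κ (lift hq z.1 (Pi.single j 1)) with hw
  have hκL : ∀ p ∈ stdSub hq z.1, κ p = p (Sum.inl (Fin.last q)) - ∑ j, w j * p (Sum.inr j.castSucc) := by
    intro p hp
    have hp' := mem_stdSub_succ.1 hp
    have hsum : p = ∑ j : Fin q, p (Sum.inr j.castSucc) • lift hq z.1 (Pi.single j 1)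
        + p (Sum.inl (Fin.last q)) • e := by
      ext x
      simp only [Pi.add_apply, Finset.sum_apply, Pi.smul_apply, smul_eq_mul]
      rcases x with x | x
      · refine Fin.lastCases ?_ (fun i => ?_) x
        · rw [Finset.sum_eq_zero fun j _ => by rw [lift_inl_of_le hq z.1 _ (by simp), mul_zero]]
          simp [hedef]
        · have : ∀ j : Fin q, lift hq z.1 (Pi.single j 1) (Sum.inl i.castSucc) = z.1 i j := fun j => by
            refine (lift_inl hq z.1 _ i).trans ?_
            simp [Pi.single_apply]
          simp only [this]
          rw [hp'.1 i]
          simp [hedef, (Fin.castSucc_lt_last i).ne, mul_comm]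
      · refine Fin.lastCases ?_ (fun i => ?_) x
        · rw [Finset.sum_eq_zero fun j _ => by rw [lift_inr_of_le hq z.1 _ (by simp), mul_zero]]
          simp [hedef, hp'.2]
        · have : ∀ j : Fin q, lift hq z.1 (Pi.single j 1) (Sum.inr i.castSucc)
              = (Pi.single j 1 : Fin q → ℂ) i := fun j => lift_inr hq z.1 _ i
          simp [this, hedef, Pi.single_apply]
    conv_lhs => rw [hsum]
    rw [map_add, map_sum, map_smul, hκe, smul_eq_mul, mul_one, sub_eq_add_neg,
      ← Finset.sum_neg_distrib, add_comm]
    congr 1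
    refine Finset.sum_congr rfl fun j _ => ?_
    rw [map_smul, smul_eq_mul, hw]
    ring
  have hL's : ∀ p ∈ stdSub hq z.1, κ p = 0 → sig h p ∈ stdSub hq z.1 ∧ κ (sig h p) = 0 :=
    fun p hp hp0 => ⟨hs p hp, by rw [hκs p (mem_stdSub_succ.1 hp).2, hp0, star_zero, mul_zero]⟩
  have hL'Z : ∀ t, ∀ p ∈ stdSub hq z.1, κ p = 0 → p ∈ stdSub le_rfl (border z.1 w t) := by
    intro t p hp hp0
    have hp' := mem_stdSub_succ.1 hp
    rw [hκL p hp, sub_eq_zero] at hp0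
    exact mem_stdSub_border.2 ⟨fun i => by rw [hp'.1 i, hp'.2, mul_zero, add_zero],
      by rw [hp0, hp'.2, mul_zero, add_zero]⟩
  set ℓ : Fin (q + 1) ⊕ Fin (q + 1) → ℂ :=
    Sum.elim (fun i => Fin.lastCases (motive := fun _ => ℂ) 0 w i) (Pi.single (Fin.last q) 1) with hℓ
  have hℓ1 : ∀ i : Fin q, ℓ (Sum.inl i.castSucc) = w i := fun i => by simp [hℓ]
  have hℓ2 : ℓ (Sum.inl (Fin.last q)) = 0 := by simp [hℓ]
  have hℓ3 : ∀ i : Fin q, ℓ (Sum.inr i.castSucc) = 0 := fun i => by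
    simp [hℓ, (Fin.castSucc_lt_last i).ne]
  have hℓ4 : ℓ (Sum.inr (Fin.last q)) = 1 := by simp [hℓ]
  have homℓ : ∀ p ∈ stdSub hq z.1, κ p = 0 → om (q + 1) ℓ p = 0 := by
    intro p hp hp0
    rw [hκL p hp, sub_eq_zero] at hp0
    rw [om_apply, Fin.sum_univ_castSucc]
    simp only [hℓ1, hℓ2, hℓ3, hℓ4, hp0, (mem_stdSub_succ.1 hp).2]
    simp
  have hσℓ : sig h ℓ (Sum.inr (Fin.last q)) = -ε := by
    have h1 := om_sig h e ℓ
    rw [he, map_smul, LinearMap.smul_apply, hom_e, hom_e, hℓ4, smul_eq_mul] at h1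
    simp only [star_neg, star_one, neg_neg] at h1
    linear_combination (-(ε : ℂ)) * h1 - (sig h ℓ (Sum.inr (Fin.last q))) * hεC
  -- `sig h ℓ` pairs with `e` as `-ε ℓ` does, so `m` is orthogonal to `e`. It is also orthogonal to
  -- the kernel of `κ`, hence lies in the Lagrangian of `z`.
  set m := sig h ℓ + (ε : ℂ) • ℓ with hm
  have hm1 : m (Sum.inr (Fin.last q)) = 0 := by simp [hm, hσℓ, hℓ4]
  have homm : ∀ p ∈ stdSub hq z.1, κ p = 0 → om (q + 1) m p = 0 := by
    intro p hp hp0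
    have h1 := om_sig h ℓ (sig h p)
    obtain ⟨h2, h3⟩ := hL's p hp hp0
    rw [hinv p (mem_stdSub_succ.1 hp).2, homℓ _ h2 h3] at h1
    rw [hm, map_add, map_smul, LinearMap.add_apply, LinearMap.smul_apply, homℓ p hp hp0, h1]
    simp
  have hmL : m ∈ stdSub hq z.1 := by
    refine mem_stdSub_of_om z.2.1 fun p hp => ?_
    have h1 := homm (p - κ p • e) (sub_mem hp (Submodule.smul_mem _ _ heL)) (by simp [hκe])
    rw [map_sub, map_smul, om_swap m e, hom_e, hm1] at h1
    rw [om_swap]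
    simpa using h1
  set a := κ m with ha
  -- the coefficient `a` is real
  have hareal : star a = a := by
    set f : Fin (q + 1) ⊕ Fin (q + 1) → ℂ := Pi.single (Sum.inr (Fin.last q)) 1 with hf
    -- The square of `sig h` preserves `ω` and is the identity on `e^⊥`, so `δ` is orthogonal to
    -- `e^⊥`, thus a multiple of `e`, and a real one because `f` is real. Applying `κ` to `sig h m =
    -- ε m + δ` makes `ε (a - ā)` real as well as imaginary.
    set δ := sig h (sig h f) - f with hδ
    have hδf : sig h (sig h ℓ) - ℓ = δ := by
      have := hinv (ℓ - f) (by simp [hℓ4, hf])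
      rw [map_sub, map_sub] at this
      rw [hδ, sub_eq_sub_iff_sub_eq_sub, this]
    have hδom : ∀ v : Fin (q + 1) ⊕ Fin (q + 1) → ℂ, v (Sum.inr (Fin.last q)) = 0 →
        om (q + 1) v δ = 0 := by
      intro v hv
      rw [hδ, map_sub]
      nth_rewrite 1 [← hinv v hv]
      rw [om_sig, om_sig]
      simp
    have hδL : δ ∈ stdSub hq z.1 :=
      mem_stdSub_of_om z.2.1 fun p hp => hδom p (mem_stdSub_succ.1 hp).2
    have hδr : ∀ i : Fin q, δ (Sum.inr i.castSucc) = 0 := fun i => by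
      have := hδom (Pi.single (Sum.inl i.castSucc) 1) (by simp)
      rwa [om_single_inl, neg_eq_zero] at this
    have hδstar : star δ = δ := by
      rw [hδ, star_sub, ← sig_star, ← sig_star, hf, star_single]
    have hκδ : star (κ δ) = κ δ := by
      rw [hκL δ hδL]
      simp only [hδr, mul_zero, Finset.sum_const_zero, sub_zero]
      exact congrFun hδstar _
    have h1 : sig h m = (ε : ℂ) • m + δ := by
      rw [← hδf, hm, map_add, LinearMap.map_smulₛₗ, Complex.conj_ofReal, smul_add, smul_smul, hεC]
      module
    have h2 := hκs m hm1
    rw [h1, map_add, map_smul, smul_eq_mul] at h2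
    have h3 := congrArg star h2
    simp only [star_add, star_mul', star_star, hκδ] at h3
    rw [show star (ε : ℂ) = ε from Complex.conj_ofReal ε] at h3
    have h4 : (ε : ℂ) * (κ m - star (κ m)) = 0 := by linear_combination (h2 - h3) / 2
    rcases mul_eq_zero.1 h4 with h5 | h5
    · rw [h5] at hεC
      simp at hεC
    · exact (sub_eq_zero.1 h5).symm
  set y := z.1.map Complex.im with hy
  -- The first term is the Schur bound for positivity; `|k| + 1` keeps positivity both for `T` and
  -- for `T - k`.
  set T : ℝ := (y⁻¹ *ᵥ fun j => (w j).im) ⬝ᵥ (fun j => (w j).im) + |k| + 1 with hT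
  -- Stability of the line of `ℓ + t e` modulo the kernel of `κ` is the equation `ε t + a + ε t̄ =
  -- 0`. It fixes only the real part of `t`, and is solvable because `a` is real.
  set t : ℂ := ⟨-ε * a.re / 2, T⟩ with ht
  have hat : (ε : ℂ) * t + a + star t * ε = 0 := by
    have ha' : ((a.re : ℝ) : ℂ) = a := Complex.conj_eq_iff_re.1 hareal
    have htt : t + star t = -ε * a := by
      rw [← ha']
      apply Complex.ext
      · simp [ht]
      · simp [ht]
    linear_combination ε * htt - a * hεC
  have hmap : (border z.1 w t).map Complex.im = border y (fun j => (w j).im) T := by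
    refine border_ext ?_ ?_ ?_ ?_ <;> simp [hy, ht]
  have hpos : (border z.1 w t).map Complex.im ∈ {M | M.PosDef} := by
    rw [hmap]
    exact border_posDef z.2.2 _ (by rw [hT]; linarith [abs_nonneg k])
  refine ⟨⟨border z.1 w t, ?_, hpos⟩, ?_, ?_, ?_⟩
  · refine border_ext (fun i j => ?_) (fun i => ?_) (fun i => ?_) ?_ <;> simp [hzs]
  · ext i j
    exact border_castSucc_castSucc _ _ _ i j
  · have : (border z.1 w t).map Complex.im - k • Matrix.diagonal
        (fun i : Fin (q + 1) => if q ≤ (i : ℕ) then (1 : ℝ) else 0)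
        = border y (fun j => (w j).im) (T - k) := by
      rw [hmap]
      refine border_ext (fun i j => ?_) (fun i => ?_) (fun i => ?_) ?_
      · by_cases hij : i = j
        · subst hij
          simp [not_le.2 i.2]
        · simp [Matrix.diagonal_apply_ne, hij]
      · simp [Matrix.diagonal_apply_ne, (Fin.castSucc_lt_last i).ne]
      · simp [Matrix.diagonal_apply_ne, (Fin.castSucc_lt_last i).ne']
      · simp
    rw [this]
    exact border_posDef z.2.2 _ (by rw [hT]; linarith [le_abs_self k])
  · intro v hv
    have hv' := mem_stdSub_border.1 hv
    set ℓt := ℓ + t • e with hℓt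
    have hℓtZ : ℓt ∈ stdSub le_rfl (border z.1 w t) := by
      refine mem_stdSub_border.2 ⟨fun i => ?_, ?_⟩
      · simp [hℓt, hℓ1, hℓ3, hℓ4, hedef, (Fin.castSucc_lt_last i).ne]
      · simp [hℓt, hℓ2, hℓ3, hℓ4, hedef]
    set p := v - v (Sum.inr (Fin.last q)) • ℓt with hp
    have hpr : ∀ i : Fin q, p (Sum.inr i.castSucc) = v (Sum.inr i.castSucc) := fun i => by
      simp [hp, hℓt, hℓ3, hedef]
    have hpL : p ∈ stdSub hq z.1 := by
      refine mem_stdSub_succ.2 ⟨fun i => ?_, ?_⟩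
      · simp only [hpr]
        simp [hp, hℓt, hℓ1, hedef, (Fin.castSucc_lt_last i).ne, hv'.1 i]
        ring
      · simp [hp, hℓt, hℓ4, hedef]
    have hp0 : κ p = 0 := by
      rw [hκL p hpL]
      simp only [hpr]
      simp [hp, hℓt, hℓ2, hedef, hv'.2]
      ring
    have hvp : v = p + v (Sum.inr (Fin.last q)) • ℓt := by rw [hp]; abel
    have hσℓt : sig h ℓt = -(ε : ℂ) • ℓt + (m - a • e) := by
      rw [hℓt, map_add, LinearMap.map_smulₛₗ, he, hm]
      have : star t * ε = -(ε * t + a) := by linear_combination hat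
      rw [smul_smul, ← Complex.star_def, this]
      module
    have hma := hL'Z t (m - a • e) (sub_mem hmL (Submodule.smul_mem _ _ heL)) (by simp [hκe, ha])
    obtain ⟨h1, h2⟩ := hL's p hpL hp0
    change sig h v ∈ stdSub le_rfl (border z.1 w t)
    rw [hvp, map_add, LinearMap.map_smulₛₗ, hσℓt]
    exact add_mem (hL'Z t _ h1 h2)
      (Submodule.smul_mem _ _ (add_mem (Submodule.smul_mem _ _ hℓtZ) hma))

/-! ### Integral isometries congruent to the identity -/

theorem herm_add_of_inr {n q : ℕ} {hq : q ≤ n} (z : siegel q) {v w : Fin n ⊕ Fin n → ℂ}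
    (hv : v ∈ stdSub hq z.1) (hw : w ∈ stdSub hq z.1) (hw0 : ∀ i, w (Sum.inr i) = 0) :
    herm (v + w) = herm v := by
  rw [herm_eq z.2.1 hv, herm_eq z.2.1 (add_mem hv hw)]
  simp [hw0]

section

variable {n q : ℕ} {hq : q ≤ n} (z : siegel q) {h : SpQ n}
  {T : Matrix (Fin n ⊕ Fin n) (Fin n ⊕ Fin n) ℂ} {N : ℕ}

theorem sig_sig_of_eq (hT : toC (tauSp h * h) = 1 + (N : ℂ) • T) (v : Fin n ⊕ Fin n → ℂ) :
    sig h (sig h v) = v + (N : ℂ) • (T *ᵥ v) := by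
  rw [sig_sig, hT, add_mulVec, one_mulVec, smul_mulVec]

theorem mulVec_mem_stdSub (hs : ∀ v ∈ stdSub hq z.1, sig h v ∈ stdSub hq z.1) (hN : 4 ≤ N)
    (hT : toC (tauSp h * h) = 1 + (N : ℂ) • T) {v : Fin n ⊕ Fin n → ℂ}
    (hv : v ∈ stdSub hq z.1) : T *ᵥ v ∈ stdSub hq z.1 := by
  have hN0 : (N : ℂ) ≠ 0 := by
    have : N ≠ 0 := by omega
    exact_mod_cast this
  have h1 : (N : ℂ) • (T *ᵥ v) ∈ stdSub hq z.1 := by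
    rw [← add_sub_cancel_left v ((N : ℂ) • (T *ᵥ v)), ← sig_sig_of_eq hT]
    exact sub_mem (hs _ (hs _ hv)) hv
  have := Submodule.smul_mem _ (N : ℂ)⁻¹ h1
  rwa [smul_smul, inv_mul_cancel₀ hN0, one_smul] at this

theorem mulVec_star_of_eq (hN : 4 ≤ N)
    (hT : toC (tauSp h * h) = 1 + (N : ℂ) • T) (v : Fin n ⊕ Fin n → ℂ) :
    T *ᵥ star v = star (T *ᵥ v) := by
  have hN0 : (N : ℂ) ≠ 0 := by
    have : N ≠ 0 := by omega
    exact_mod_cast this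
  have h1 := toC_mulVec_star (tauSp h * h) v
  rw [hT, add_mulVec, add_mulVec, one_mulVec, one_mulVec, smul_mulVec, smul_mulVec, star_add,
    star_smul, add_right_inj] at h1
  have h2 : star (N : ℂ) = N := by simp
  rw [h2] at h1
  exact smul_right_injective _ hN0 h1

theorem herm_natCast_smul (N : ℕ) (v : Fin n ⊕ Fin n → ℂ) :
    herm ((N : ℂ) • v) = (N : ℝ) ^ 2 * herm v := by
  rw [← herm_real_smul, Complex.ofReal_natCast]

/-- The parallelogram law for the isometry `σ²` gives `N² herm (T v) ≤ 4 herm v`; the bound `N ≥ 4`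
makes this a contraction by `1/4`. -/
theorem herm_mulVec_le (hs : ∀ v ∈ stdSub hq z.1, sig h v ∈ stdSub hq z.1) (hN : 4 ≤ N)
    (hT : toC (tauSp h * h) = 1 + (N : ℂ) • T) {v : Fin n ⊕ Fin n → ℂ}
    (hv : v ∈ stdSub hq z.1) : herm (T *ᵥ v) ≤ herm v / 4 := by
  have hTv := mulVec_mem_stdSub z hs hN hT hv
  have h1 := herm_add_add_herm_sub (sig h (sig h v)) v
  rw [herm_sig, herm_sig] at h1
  have h2 : sig h (sig h v) - v = (N : ℂ) • (T *ᵥ v) := by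
    rw [sig_sig_of_eq hT, add_sub_cancel_left]
  rw [h2, herm_natCast_smul] at h1
  have h3 := herm_nonneg z (add_mem (hs _ (hs _ hv)) hv)
  have h4 : (4 : ℝ) ≤ N := by exact_mod_cast hN
  have h5 : (16 : ℝ) ≤ (N : ℝ) ^ 2 := by nlinarith
  nlinarith [herm_nonneg z hTv]

/-- With `x = N T v`, the vectors `v`, `v + x` and, modulo the kernel of `herm`, `v + 2x` all have
the same `herm`. A semidefinite form constant at three points of an arithmetic progression vanishes
on the step. -/
theorem herm_mulVec_eq_zero (hs : ∀ v ∈ stdSub hq z.1, sig h v ∈ stdSub hq z.1) (hN : 4 ≤ N)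
    (hT : toC (tauSp h * h) = 1 + (N : ℂ) • T) {v : Fin n ⊕ Fin n → ℂ}
    (hv : v ∈ stdSub hq z.1) (h0 : herm (T *ᵥ (T *ᵥ v)) = 0) : herm (T *ᵥ v) = 0 := by
  have hTv := mulVec_mem_stdSub z hs hN hT hv
  have hTTv := mulVec_mem_stdSub z hs hN hT hTv
  set x := (N : ℂ) • (T *ᵥ v) with hx
  have hxL : x ∈ stdSub hq z.1 := Submodule.smul_mem _ _ hTv
  have h1 : sig h (sig h v) = v + x := sig_sig_of_eq hT v
  have h2 : sig h (sig h (v + x)) = v + x + x + (N : ℂ) • (T *ᵥ x) := by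
    rw [map_add, map_add, h1, sig_sig_of_eq hT x, add_assoc (v + x)]
  have h3 : ∀ i, ((N : ℂ) • (T *ᵥ x)) (Sum.inr i) = 0 := fun i => by
    rw [hx, mulVec_smul, Pi.smul_apply, Pi.smul_apply, inr_eq_zero_of_herm z hTTv h0 i,
      smul_zero, smul_zero]
  have h4 : herm (v + x) = herm v := by rw [← h1, herm_sig, herm_sig]
  have h5 : herm (v + x + x) = herm v := by
    rw [← h4, ← herm_sig h (v + x), ← herm_sig h (sig h (v + x)), h2]
    exact (herm_add_of_inr z (add_mem (add_mem hv hxL) hxL)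
      (Submodule.smul_mem _ _ (mulVec_mem_stdSub z hs hN hT hxL)) h3).symm
  have h6 := herm_add_add_herm_sub (v + x) x
  rw [add_sub_cancel_right, h5, h4, hx, herm_natCast_smul] at h6
  have hN0 : (N : ℝ) ^ 2 ≠ 0 := by
    have : N ≠ 0 := by omega
    positivity
  have h7 : (N : ℝ) ^ 2 * herm (T *ᵥ v) = 0 := by linarith
  exact (mul_eq_zero.1 h7).resolve_left hN0

/-- Smallness kills the real parts of the lower coordinates by `hs1`, then those of the first `q`
upper ones by `hs2` and Cauchy–Schwarz. The latter are the entries of `-Y b`, so `Y b = 0` as well.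
-/
theorem herm_eq_zero_of_small {ℓ : Fin n ⊕ Fin n → ℂ} (hℓ : ℓ ∈ stdSub hq z.1) {d : ℕ} (hd : 0 < d)
    (hden : ∀ j, ∃ a : ℤ, (d : ℂ) * (ℓ + star ℓ) j = a) {c : ℝ} (hc : 0 < c)
    (hz : ∀ p : Fin q → ℝ, c * ‖p‖ ^ 2 ≤ p ⬝ᵥ (z.1.map Complex.im *ᵥ p))
    (hs1 : 4 * (d : ℝ) ^ 2 * herm ℓ < c)
    (hs2 : ∀ j, 4 * (d : ℝ) ^ 2 * ((z.1 j j).im * herm ℓ) < 1) : herm ℓ = 0 := by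
  set Y := z.1.map Complex.im with hY
  have hYps : Y.PosSemidef := z.2.2.posSemidef
  have hherm := herm_eq z.2.1 hℓ
  set a : Fin q → ℝ := fun j => (ℓ (Sum.inr (Fin.castLE hq j))).re with ha
  set b : Fin q → ℝ := fun j => (ℓ (Sum.inr (Fin.castLE hq j))).im with hb
  rw [← hY] at hherm
  have ha0 : 0 ≤ a ⬝ᵥ (Y *ᵥ a) := by simpa using hYps.dotProduct_mulVec_nonneg a
  have hb0 : 0 ≤ b ⬝ᵥ (Y *ᵥ b) := by simpa using hYps.dotProduct_mulVec_nonneg b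
  have hre : ∀ j, (ℓ + star ℓ) j = ((2 * (ℓ j).re : ℝ) : ℂ) := fun j => by
    apply Complex.ext <;> simp
    ring
  have hzero : ∀ j, (d : ℝ) ^ 2 * (2 * (ℓ j).re) ^ 2 < 1 → (ℓ j).re = 0 := fun j hj => by
    have := eq_zero_of_denom hd (hden j) (by rw [hre, Complex.ofReal_re]; exact hj)
    rw [hre] at this
    have h2 : 2 * (ℓ j).re = 0 := by exact_mod_cast this
    linarith
  have haz : a = 0 := by
    ext j
    apply hzero
    change (d : ℝ) ^ 2 * (2 * a j) ^ 2 < 1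
    have h1 := hz a
    have h2 : |a j| ≤ ‖a‖ := norm_le_pi_norm a j
    have h3 : a j ^ 2 ≤ ‖a‖ ^ 2 := by
      rw [← sq_abs]
      gcongr
    have h4 : c * a j ^ 2 ≤ herm ℓ := by nlinarith
    have h5 : c * ((d : ℝ) ^ 2 * (2 * a j) ^ 2) < c * 1 := by
      calc c * ((d : ℝ) ^ 2 * (2 * a j) ^ 2) = 4 * (d : ℝ) ^ 2 * (c * a j ^ 2) := by ring
        _ ≤ 4 * (d : ℝ) ^ 2 * herm ℓ := by gcongr
        _ < c * 1 := by linarith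
    exact lt_of_mul_lt_mul_left h5 hc.le
  have hYb : Y *ᵥ b = 0 := by
    ext j
    have e1 : (ℓ (Sum.inl (Fin.castLE hq j))).re = -(Y *ᵥ b) j := by
      rw [hℓ.1 j, Complex.re_sum, mulVec, dotProduct, ← Finset.sum_neg_distrib]
      refine Finset.sum_congr rfl fun l _ => ?_
      have : (ℓ (Sum.inr (Fin.castLE hq l))).re = 0 := congrFun haz l
      rw [Complex.mul_re, this, hY, Matrix.map_apply]
      ring
    have h1 := dotProduct_mulVec_sq_le hYps (Pi.single j 1) b
    rw [single_one_dotProduct, single_one_dotProduct, mulVec_single_one] at h1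
    have h2 : (Y.col j) j = (z.1 j j).im := rfl
    have h3 : 0 ≤ (z.1 j j).im := hYps.diag_nonneg
    have h4 : ((Y *ᵥ b) j) ^ 2 ≤ (z.1 j j).im * herm ℓ := by
      rw [h2] at h1
      refine h1.trans ?_
      gcongr
      linarith
    have h5 := hzero (Sum.inl (Fin.castLE hq j)) (by
      rw [e1]
      refine lt_of_le_of_lt ?_ (hs2 j)
      calc (d : ℝ) ^ 2 * (2 * -(Y *ᵥ b) j) ^ 2 = 4 * (d : ℝ) ^ 2 * ((Y *ᵥ b) j) ^ 2 := by ring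
        _ ≤ _ := by gcongr)
    rw [e1, neg_eq_zero] at h5
    exact h5
  rw [hherm, haz, hYb]
  simp

/-- If the square of `sig h` is `1 + N T` with `N ≥ 4` and the powers of `T` have bounded
denominators, then `T` vanishes on the symplectic space belonging to the boundary component. -/
theorem mulVec_eq_zero (hs : ∀ v ∈ stdSub hq z.1, sig h v ∈ stdSub hq z.1) (hN : 4 ≤ N)
    (hT : toC (tauSp h * h) = 1 + (N : ℂ) • T) {d : ℕ} (hd : 0 < d)
    (hTd : ∀ k i j, ∃ a : ℤ, (d : ℂ) * (T ^ k) i j = a) {v : Fin n ⊕ Fin n → ℂ}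
    (hv : ∀ i : Fin n, q ≤ (i : ℕ) → v (Sum.inr i) = 0) :
    (∀ j, (T *ᵥ v) (Sum.inr j) = 0) ∧ ∀ j : Fin n, (j : ℕ) < q → (T *ᵥ v) (Sum.inl j) = 0 := by
  have main : ∀ x : Fin n ⊕ Fin n,
      (∀ i : Fin n, q ≤ (i : ℕ) → (Pi.single x 1 : Fin n ⊕ Fin n → ℂ) (Sum.inr i) = 0) →
      (∀ j, (T *ᵥ Pi.single x 1) (Sum.inr j) = 0) ∧
        ∀ j : Fin n, (j : ℕ) < q → (T *ᵥ Pi.single x 1) (Sum.inl j) = 0 := by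
    intro x hx
    obtain ⟨ℓ, hℓ, -, hℓs, -, -⟩ := exists_add_star_eq hq z (star_single x) hx
    have hpow : ∀ k, (T ^ k) *ᵥ ℓ ∈ stdSub hq z.1 ∧ herm ((T ^ k) *ᵥ ℓ) ≤ (1 / 4) ^ k * herm ℓ ∧
        (T ^ k) *ᵥ ℓ + star ((T ^ k) *ᵥ ℓ) = (T ^ k) *ᵥ Pi.single x 1 := by
      intro k
      induction k with
      | zero =>
        simp only [pow_zero, one_mulVec, one_mul]
        exact ⟨hℓ, le_rfl, hℓs⟩
      | succ k ih =>
        obtain ⟨h1, h2, h3⟩ := ih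
        rw [pow_succ', ← mulVec_mulVec, ← mulVec_mulVec]
        refine ⟨mulVec_mem_stdSub z hs hN hT h1, ?_, ?_⟩
        · refine (herm_mulVec_le z hs hN hT h1).trans ?_
          rw [pow_succ]
          linarith
        · rw [← mulVec_star_of_eq hN hT, ← mulVec_add, h3]
    obtain ⟨c, hc, hcz⟩ := exists_lower_bound z.2.2
    set B : ℝ := ∑ j, |(z.1 j j).im| with hB
    have hlim : Filter.Tendsto (fun k : ℕ => (1 / 4 : ℝ) ^ k * herm ℓ * (4 * (d : ℝ) ^ 2 * (1 + B)))
        Filter.atTop (nhds 0) := by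
      have := (tendsto_pow_atTop_nhds_zero_of_lt_one (r := (1 / 4 : ℝ)) (by norm_num)
        (by norm_num)).mul_const (herm ℓ * (4 * (d : ℝ) ^ 2 * (1 + B)))
      simpa [mul_assoc] using this
    -- The contraction factor `1/4` beats the fixed denominator `d` of all powers of `T`; the factor
    -- `1 + B` covers both smallness conditions at once.
    obtain ⟨k, hk⟩ := (hlim.eventually (gt_mem_nhds (lt_min hc one_pos))).exists
    have hB0 : 0 ≤ B := Finset.sum_nonneg fun _ _ => abs_nonneg _
    obtain ⟨h1, h2, h3⟩ := hpow k
    have h0 := herm_nonneg z h1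
    have hkey : 4 * (d : ℝ) ^ 2 * herm ((T ^ k) *ᵥ ℓ) * (1 + B) < min c 1 := by
      refine lt_of_le_of_lt ?_ hk
      calc 4 * (d : ℝ) ^ 2 * herm ((T ^ k) *ᵥ ℓ) * (1 + B)
          = herm ((T ^ k) *ᵥ ℓ) * (4 * (d : ℝ) ^ 2 * (1 + B)) := by ring
        _ ≤ _ := by gcongr
    have hD0 : 0 ≤ 4 * (d : ℝ) ^ 2 * herm ((T ^ k) *ᵥ ℓ) := by positivity
    have hzero : herm ((T ^ k) *ᵥ ℓ) = 0 := by
      refine herm_eq_zero_of_small z h1 hd (fun j => ?_) hc hcz ?_ fun j => ?_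
      · rw [h3, mulVec_single_one]
        exact hTd k j x
      · have := min_le_left c 1
        nlinarith
      · have h4 : (z.1 j j).im ≤ B := (le_abs_self _).trans
          (Finset.single_le_sum (f := fun j => |(z.1 j j).im|) (fun _ _ => abs_nonneg _)
            (Finset.mem_univ j))
        have := min_le_right c 1
        nlinarith
    -- Vanishing at a high power descends one power at a time, by the three-term progression.
    have hdesc : ∀ k, herm ((T ^ (k + 1)) *ᵥ ℓ) = 0 → herm (T *ᵥ ℓ) = 0 := by
      intro k
      induction k with
      | zero => simp
      | succ k ih =>
        intro hk
        rw [pow_succ', pow_succ', ← mulVec_mulVec, ← mulVec_mulVec] at hk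
        apply ih
        rw [pow_succ', ← mulVec_mulVec]
        exact herm_mulVec_eq_zero z hs hN hT (hpow k).1 hk
    have hT0 : herm (T *ᵥ ℓ) = 0 := by
      refine hdesc k ?_
      refine le_antisymm ?_ (herm_nonneg z (hpow (k + 1)).1)
      rw [pow_succ', ← mulVec_mulVec]
      refine (herm_mulVec_le z hs hN hT h1).trans ?_
      rw [hzero, zero_div]
    have hTL := mulVec_mem_stdSub z hs hN hT hℓ
    have hr := inr_eq_zero_of_herm z hTL hT0
    have hx1 := (hpow 1).2.2
    rw [pow_one] at hx1
    rw [← hx1]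
    refine ⟨fun j => by simp [hr j], fun j hj => ?_⟩
    have := hTL.1 ⟨j, hj⟩
    simp only [hr, mul_zero, Finset.sum_const_zero] at this
    have this' : (T *ᵥ ℓ) (Sum.inl j) = 0 := this
    simp [this']
  have hsum : T *ᵥ v = ∑ x, v x • (T *ᵥ Pi.single x 1) := by
    conv_lhs => rw [pi_eq_sum_univ' v, mulVec_sum]
    refine Finset.sum_congr rfl fun x _ => ?_
    rw [mulVec_smul]
  have hterm : ∀ a : Fin n ⊕ Fin n, (∀ x : Fin n ⊕ Fin n,
      (∀ i : Fin n, q ≤ (i : ℕ) → (Pi.single x 1 : Fin n ⊕ Fin n → ℂ) (Sum.inr i) = 0) →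
      (T *ᵥ Pi.single x 1) a = 0) → (T *ᵥ v) a = 0 := by
    intro a ha
    rw [hsum, Finset.sum_apply]
    refine Finset.sum_eq_zero fun x _ => ?_
    rw [Pi.smul_apply, smul_eq_mul]
    by_cases hx : v x = 0
    · rw [hx, zero_mul]
    · rw [ha x fun i hi => ?_, mul_zero]
      refine Pi.single_eq_of_ne (fun e => hx ?_) _
      rw [← e, hv i hi]
  exact ⟨fun j => hterm _ fun x hx => (main x hx).1 j,
    fun j hj => hterm _ fun x hx => (main x hx).2 j hj⟩

end

/-! ### Integral vectors and symplectic transvections -/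

/-- The complex vector with the given integral coordinates. -/
def castV {n : ℕ} (a : Fin n ⊕ Fin n → ℤ) : Fin n ⊕ Fin n → ℂ := fun i => (a i : ℂ)

theorem exists_int_om {n : ℕ} (a b : Fin n ⊕ Fin n → ℤ) :
    ∃ x : ℤ, om n (castV a) (castV b) = x := by
  refine ⟨∑ i, (a (Sum.inr i) * b (Sum.inl i) - a (Sum.inl i) * b (Sum.inr i)), ?_⟩
  rw [om_apply]
  simp [castV]

theorem exists_int_mulVec {n : ℕ} (M : Matrix (Fin n ⊕ Fin n) (Fin n ⊕ Fin n) ℤ)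
    (a : Fin n ⊕ Fin n → ℤ) : M.map (Int.castRingHom ℂ) *ᵥ castV a = castV (M *ᵥ a) := by
  ext i
  simp [mulVec, dotProduct, castV]

/-- Divide by a generator of the ideal of the coordinates; membership of that generator in the ideal
provides the Bézout coefficients `f`. -/
theorem exists_primitive {ι : Type*} [Fintype ι] {a : ι → ℤ} (ha : a ≠ 0) :
    ∃ t : ℤ, t ≠ 0 ∧ ∃ b f : ι → ℤ, a = t • b ∧ ∑ i, b i * f i = 1 := by
  set I : Ideal ℤ := Ideal.span (Set.range a) with hI
  obtain ⟨t, ht⟩ := IsPrincipalIdealRing.principal I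
  have hmem : ∀ i, a i ∈ I := fun i => Ideal.subset_span ⟨i, rfl⟩
  have hdvd : ∀ i, ∃ b, a i = t * b := fun i => by
    have := hmem i
    rw [ht] at this
    obtain ⟨b, hb⟩ := Submodule.mem_span_singleton.1 this
    exact ⟨b, by rw [← hb, smul_eq_mul, mul_comm]⟩
  choose b hb using hdvd
  have ht0 : t ≠ 0 := by
    rintro rfl
    exact ha (funext fun i => by simp [hb i])
  have htI : t ∈ I := by
    rw [ht]
    exact Submodule.mem_span_singleton_self t
  obtain ⟨f, hf⟩ := (Submodule.mem_span_range_iff_exists_fun ℤ).1 htI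
  refine ⟨t, ht0, b, f, funext fun i => by simp [hb i], ?_⟩
  have : t * ∑ i, b i * f i = t * 1 := by
    rw [mul_one, Finset.mul_sum]
    nth_rewrite 2 [← hf]
    refine Finset.sum_congr rfl fun i _ => ?_
    rw [smul_eq_mul, hb i]
    ring
  exact mul_left_cancel₀ ht0 this

/-- Every rational line in `ℂ²ⁿ` is spanned by a primitive integral vector. -/
theorem exists_primitive_smul {n : ℕ} (g : SpQ n) (x : Fin n ⊕ Fin n) :
    ∃ t : ℝ, t ≠ 0 ∧ ∃ b f : Fin n ⊕ Fin n → ℤ,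
      castV b = (t : ℂ) • (toC g *ᵥ Pi.single x 1) ∧ om n (castV b) (castV f) = 1 := by
  obtain ⟨d, hd, hg⟩ := exists_hasDenom g
  choose a ha using fun i => hg.toC i x
  have hd0 : (d : ℝ) ≠ 0 := by exact_mod_cast hd.ne'
  have hae : castV a = (d : ℂ) • (toC g *ᵥ Pi.single x 1) := by
    ext i
    rw [Pi.smul_apply, mulVec_single_one, smul_eq_mul]
    exact (ha i).symm
  have ha0 : a ≠ 0 := by
    rintro rfl
    have h1 : toC g⁻¹ *ᵥ castV (0 : Fin n ⊕ Fin n → ℤ) = 0 := by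
      have : castV (0 : Fin n ⊕ Fin n → ℤ) = 0 := by
        ext
        simp [castV]
      rw [this, mulVec_zero]
    rw [hae, mulVec_smul, toC_inv_mulVec] at h1
    have := congrFun h1 x
    simp [hd.ne'] at this
  obtain ⟨s, hs, b, f, hab, hbf⟩ := exists_primitive ha0
  have hsR : (s : ℝ) ≠ 0 := by exact_mod_cast hs
  refine ⟨d / s, div_ne_zero hd0 hsR, b, Sum.elim (fun i => f (Sum.inr i)) (fun i => -f (Sum.inl i)),
    ?_, ?_⟩
  · have : castV a = (s : ℂ) • castV b := by
      ext i
      simp [hab, castV]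
    have hsC : (s : ℂ) ≠ 0 := by exact_mod_cast hs
    push_cast
    rw [div_eq_inv_mul, ← smul_smul, ← hae, this, smul_smul, inv_mul_cancel₀ hsC, one_smul]
  · rw [om_apply]
    rw [Fintype.sum_sum_type, add_comm, ← Finset.sum_add_distrib] at hbf
    have := congrArg (Int.cast : ℤ → ℂ) hbf
    push_cast at this
    rw [← this]
    refine Finset.sum_congr rfl fun i _ => ?_
    simp [castV]

theorem dotProduct_J_self {n : ℕ} {R : Type*} [CommRing R] (b : Fin n ⊕ Fin n → R) :
    (b ᵥ* J (Fin n) R) ⬝ᵥ b = 0 := by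
  rw [← dotProduct_mulVec]
  simp [J, dotProduct, fromBlocks_mulVec, neg_mulVec]
  rw [neg_add_eq_zero]
  exact Finset.sum_congr rfl fun i _ => mul_comm _ _

/-- The symplectic map `v ↦ v + ω(c, v) b + ω(b, v) c`, for `ω(b, c) = 0`. -/
def transvection {n : ℕ} (b c : Fin n ⊕ Fin n → ℚ) (hbc : (b ᵥ* J (Fin n) ℚ) ⬝ᵥ c = 0) : SpQ n :=
  ⟨1 + (vecMulVec b (c ᵥ* J (Fin n) ℚ) + vecMulVec c (b ᵥ* J (Fin n) ℚ)), by
    have hcb : (c ᵥ* J (Fin n) ℚ) ⬝ᵥ b = 0 := by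
      rw [← dotProduct_mulVec, dotProduct_comm, ← vecMul_transpose, J_transpose, vecMul_neg,
        neg_dotProduct, hbc, neg_zero]
    have hJ : ∀ x : Fin n ⊕ Fin n → ℚ, x ᵥ* J (Fin n) ℚ ᵥ* J (Fin n) ℚ = -x := fun x => by
      rw [vecMul_vecMul, J_squared, vecMul_neg, vecMul_one]
    have hJ' : ∀ x : Fin n ⊕ Fin n → ℚ, J (Fin n) ℚ *ᵥ (x ᵥ* J (Fin n) ℚ) = x := fun x => by
      rw [← vecMul_transpose, J_transpose, vecMul_neg, hJ, neg_neg]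
    rw [SymplecticGroup.mem_iff]
    have h1 : c ⬝ᵥ (b ᵥ* J (Fin n) ℚ) = 0 := by rw [dotProduct_comm, hbc]
    have h2 : b ⬝ᵥ (c ᵥ* J (Fin n) ℚ) = 0 := by rw [dotProduct_comm, hcb]
    have h3 : b ⬝ᵥ (b ᵥ* J (Fin n) ℚ) = 0 := by rw [dotProduct_comm, dotProduct_J_self]
    have h4 : c ⬝ᵥ (c ᵥ* J (Fin n) ℚ) = 0 := by rw [dotProduct_comm, dotProduct_J_self]
    simp only [transpose_add, transpose_one, transpose_vecMulVec, Matrix.add_mul, Matrix.mul_add,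
      Matrix.one_mul, Matrix.mul_one, vecMulVec_mul, mul_vecMulVec, hJ, vecMulVec_neg, add_mulVec,
      neg_mulVec, vecMulVec_mulVec, hJ', h1, h2, h3, h4]
    simp only [zero_smul, neg_zero, add_zero, MulOpposite.op_zero]
    abel⟩

theorem toC_transvection_mulVec {n : ℕ} (b c : Fin n ⊕ Fin n → ℤ)
    (hbc : ((fun i => (b i : ℚ)) ᵥ* J (Fin n) ℚ) ⬝ᵥ (fun i => (c i : ℚ)) = 0)
    (v : Fin n ⊕ Fin n → ℂ) :
    toC (transvection _ _ hbc) *ᵥ v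
      = v + om n (castV c) v • castV b + om n (castV b) v • castV c := by
  have hJ : ∀ i j, ((J (Fin n) ℚ i j : ℚ) : ℂ) = J (Fin n) ℂ i j := fun i j =>
    congrFun (congrFun (map_J (Fin n) (algebraMap ℚ ℂ)) i) j
  have e : toC (transvection _ _ hbc) = 1 + (vecMulVec (castV b) (castV c ᵥ* J (Fin n) ℂ)
      + vecMulVec (castV c) (castV b ᵥ* J (Fin n) ℂ)) := by
    ext i j
    simp only [toC, transvection, Matrix.map_apply, Matrix.add_apply, vecMulVec_apply, vecMul,
      dotProduct, map_add, map_mul, map_sum, eq_ratCast, hJ, castV, Rat.cast_intCast]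
    congr 1
    rcases eq_or_ne i j with rfl | h
    · rw [Matrix.one_apply_eq, Matrix.one_apply_eq, Rat.cast_one]
    · rw [Matrix.one_apply_ne h, Matrix.one_apply_ne h, Rat.cast_zero]
  rw [e, add_mulVec, add_mulVec, one_mulVec, vecMulVec_mulVec, vecMulVec_mulVec,
    ← dotProduct_mulVec, ← dotProduct_mulVec, ← om_eq, ← om_eq, add_assoc]
  simp only [op_smul_eq_smul]

theorem transvection_mem {n N : ℕ} (b c : Fin n ⊕ Fin n → ℤ)
    (hbc : ((fun i => (b i : ℚ)) ᵥ* J (Fin n) ℚ) ⬝ᵥ (fun i => (((N : ℤ) * c i : ℤ) : ℚ)) = 0) :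
    transvection _ _ hbc ∈ congruenceSubgroup n N := by
  refine ⟨vecMulVec b (c ᵥ* J (Fin n) ℤ) + vecMulVec c (b ᵥ* J (Fin n) ℤ), ?_⟩
  have hJ : ∀ i j, ((J (Fin n) ℤ i j : ℤ) : ℚ) = J (Fin n) ℚ i j := fun i j =>
    congrFun (congrFun (map_J (Fin n) (Int.castRingHom ℚ)) i) j
  simp only [transvection]
  congr 1
  ext i j
  simp only [Matrix.add_apply, vecMulVec_apply, vecMul, dotProduct, Matrix.smul_apply,
    Matrix.map_apply, map_add, map_mul, map_sum, eq_intCast, hJ, smul_eq_mul, Int.cast_mul,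
    Int.cast_natCast, mul_add, Finset.mul_sum]
  congr 1 <;> exact Finset.sum_congr rfl fun _ _ => by ring

/-! ### The norm of an element of `Γ(4m)` -/

/-- Writing `γ = 1 + 4m M`, the linear term is `4m (I₋ M I₋ + M)`. The off-diagonal blocks cancel
and the diagonal ones double, so the level gains a factor `2`, used later to halve the defect of
`σ²` inside `Γ(4m)`. -/
theorem tauSp_mul_self {n m : ℕ} {γ : SpQ n} (hγ : γ ∈ congruenceSubgroup n (4 * m)) :
    ∃ S : Matrix (Fin n ⊕ Fin n) (Fin n ⊕ Fin n) ℤ,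
      toC (tauSp γ * γ) = 1 + ((8 * m : ℕ) : ℂ) • S.map (Int.castRingHom ℂ) := by
  obtain ⟨M, hM⟩ := hγ
  set a := M.toBlocks₁₁ with ha
  set b := M.toBlocks₁₂ with hb
  set c := M.toBlocks₂₁ with hc
  set e := M.toBlocks₂₂ with he
  have hMb : M = fromBlocks a b c e := (fromBlocks_toBlocks M).symm
  set I := Iminus n ℤ with hI
  have hsum : I * M * I + M = (2 : ℤ) • fromBlocks a 0 0 e := by
    rw [hMb, hI, Iminus, fromBlocks_multiply, fromBlocks_multiply, fromBlocks_add,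
      fromBlocks_smul]
    simp [two_mul]
  refine ⟨fromBlocks a 0 0 e + (2 * m : ℤ) • (I * M * I * M), ?_⟩
  have h1 : I * (1 + (4 * m : ℤ) • M) * I * (1 + (4 * m : ℤ) • M)
      = 1 + (8 * m : ℤ) • (fromBlocks a 0 0 e + (2 * m : ℤ) • (I * M * I * M)) := by
    have h2 : I * (1 + (4 * m : ℤ) • M) * I * (1 + (4 * m : ℤ) • M)
        = I * I + (4 * m : ℤ) • (I * M * I + (I * I) * M)
          + ((4 * m : ℤ) * (4 * m : ℤ)) • (I * M * I * M) := by
      simp only [Matrix.mul_add, Matrix.add_mul, Matrix.mul_one, Matrix.mul_smul,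
        Matrix.smul_mul, smul_add, smul_smul]
      abel
    rw [h2, hI, Iminus_sq, ← hI, Matrix.one_mul, hsum, smul_add, smul_smul, smul_smul, add_assoc]
    congr 3 <;> ring
  have hIC : (Iminus n ℤ).map (Int.castRingHom ℂ) = Iminus n ℂ := by
    simp [Iminus, fromBlocks_map, Matrix.map_neg]
  have h3 : toC γ = (1 + (4 * m : ℤ) • M).map (Int.castRingHom ℂ) := by
    ext i j
    rw [toC, hM]
    by_cases h : i = j <;> simp [-zsmul_eq_mul, h]
  have h4 : toC (tauSp γ) = Iminus n ℂ * toC γ * Iminus n ℂ := by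
    simp [toC, tauSp, Matrix.map_mul, Iminus, fromBlocks_map, Matrix.map_neg]
  rw [toC_mul, h4, h3, ← hIC, ← Matrix.map_mul, ← Matrix.map_mul, ← Matrix.map_mul, ← hI, h1]
  generalize fromBlocks a 0 0 e + (2 * m : ℤ) • (I * M * I * M) = X
  ext i j
  by_cases h : i = j <;> simp [-zsmul_eq_mul, h]

/-! ### Components of corank one -/

theorem toC_mulVec_sig {n : ℕ} (g γ : SpQ n) (v : Fin n ⊕ Fin n → ℂ) :
    toC g *ᵥ sig ((tauSp g)⁻¹ * γ * g) v = sig γ (toC g *ᵥ v) := by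
  have h1 : g * tauSp ((tauSp g)⁻¹ * γ * g) = tauSp (γ * g) := by
    rw [tauSp_mul, tauSp_mul, tauSp_inv, tauSp_tauSp, tauSp_mul]
    group
  rw [sig_apply, conjVec_mulVec, ← toC_mul_mulVec, h1, ← conjVec_mulVec, toC_mul_mulVec,
    sig_apply]

theorem ratCast_dotProduct_J {n : ℕ} (b c : Fin n ⊕ Fin n → ℤ) :
    ((((fun i => (b i : ℚ)) ᵥ* J (Fin n) ℚ) ⬝ᵥ (fun i => (c i : ℚ)) : ℚ) : ℂ)
      = om n (castV b) (castV c) := by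
  have hJ : ∀ i j, ((J (Fin n) ℚ i j : ℚ) : ℂ) = J (Fin n) ℂ i j := fun i j =>
    congrFun (congrFun (map_J (Fin n) (algebraMap ℚ ℂ)) i) j
  rw [om_eq, dotProduct_mulVec]
  simp only [dotProduct, vecMul, Rat.cast_sum, Rat.cast_mul, Rat.cast_intCast, hJ, castV]

/-- If `γ ∈ Γ(4m)` acts on `b^⊥ / b` by an antiholomorphic involution, then it can be changed by an
element of the unipotent radical of level `4m` so that it acts by an involution on `b^⊥`. -/
theorem exists_involutive {n m : ℕ} {γ : SpQ n} (hγ : γ ∈ congruenceSubgroup n (4 * m))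
    {b f : Fin n ⊕ Fin n → ℤ} (hbf : om n (castV b) (castV f) = 1) {ε : ℝ} (hε : ε * ε = 1)
    (hb : sig γ (castV b) = (ε : ℂ) • castV b)
    (H : ∀ x, om n (castV b) x = 0 → ∃ α : ℂ, sig γ (sig γ x) = x + α • castV b) :
    ∃ γ' ∈ congruenceSubgroup n (4 * m), sig γ' (castV b) = (ε : ℂ) • castV b ∧
      (∀ x, om n (castV b) x = 0 → sig γ' (sig γ' x) = x) ∧
      ∀ x, om n (castV b) x = 0 → ∃ α : ℂ, sig γ' x = sig γ x + α • castV b := by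
  have hεC : (ε : ℂ) * ε = 1 := by exact_mod_cast hε
  have hb0 : castV b ≠ 0 := fun h => by simp [h] at hbf
  obtain ⟨S, hS⟩ := tauSp_mul_self hγ
  have hs : ∀ x, sig γ (sig γ x) = x + ((8 * m : ℕ) : ℂ) • (S.map (Int.castRingHom ℂ) *ᵥ x) :=
    fun x => sig_sig_of_eq hS x
  -- `c = 4m c'` is half of `f - σ² f`, and is still divisible by `4m`, so the transvection along
  -- `b` and `c` has level `4m`.
  set c' : Fin n ⊕ Fin n → ℤ := -(S *ᵥ f) with hc'
  set c : Fin n ⊕ Fin n → ℤ := fun i => ((4 * m : ℕ) : ℤ) * c' i with hc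
  have hsf : sig γ (sig γ (castV f)) = castV f - (2 : ℂ) • castV c := by
    rw [hs, exists_int_mulVec]
    ext i
    simp [castV, hc, hc']
    ring
  have homs : ∀ x y, om n (sig γ (sig γ x)) (sig γ (sig γ y)) = om n x y := fun x y => by
    rw [om_sig, om_sig]
    simp
  have hsb : sig γ (sig γ (castV b)) = castV b := by
    rw [hb, LinearMap.map_smulₛₗ, hb, Complex.conj_ofReal, smul_smul, hεC, one_smul]
  have hbc : om n (castV b) (castV c) = 0 := by
    have := homs (castV b) (castV f)
    rw [hsb, hsf, map_sub, map_smul, smul_eq_mul] at this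
    linear_combination (-1 / 2) * this
  have hcb : om n (castV c) (castV b) = 0 := by rw [om_swap, hbc, neg_zero]
  have hs' : ∀ x, om n (castV b) x = 0 →
      sig γ (sig γ x) = x + (-2 * om n (castV c) x) • castV b := fun x hx => by
    obtain ⟨α, hα⟩ := H x hx
    -- Invariance of `ω` under `σ²` determines the defect `α` from the displacement of the dual
    -- vector `f`.
    have h1 := homs x (castV f)
    rw [hα, hsf] at h1
    simp only [map_add, map_sub, map_smul, LinearMap.add_apply, LinearMap.smul_apply, smul_eq_mul,
      hbf, hbc] at h1
    rw [hα, om_swap (castV c) x]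
    congr 2
    linear_combination h1
  have hbσ : ∀ x, om n (castV b) x = 0 → om n (castV b) (sig γ x) = 0 := fun x hx => by
    have h1 := om_sig γ (castV b) x
    rw [hb, hx, map_smul, LinearMap.smul_apply, smul_eq_mul, star_zero, neg_zero] at h1
    exact (mul_eq_zero.1 h1).resolve_left fun h0 => by simp [h0] at hεC
  have hcσ : ∀ x, om n (castV b) x = 0 →
      om n (castV c) (sig γ x) = ε * star (om n (castV c) x) := fun x hx => by
    -- Comparing the two ways of computing `σ³ x` shows that pairing with `c` is equivariant, so the
    -- two correction terms in the new square add up instead of cancelling.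
    have h1 := hs' (sig γ x) (hbσ x hx)
    rw [hs' x hx, map_add, LinearMap.map_smulₛₗ, hb, add_right_inj, smul_smul] at h1
    have h2 := smul_left_injective ℂ hb0 h1
    simp only [map_mul, map_neg, map_ofNat] at h2
    rw [Complex.star_def]
    linear_combination h2 / 2
  have hbcQ : ((fun i => (b i : ℚ)) ᵥ* J (Fin n) ℚ) ⬝ᵥ (fun i => (c i : ℚ)) = 0 := by
    have := ratCast_dotProduct_J b c
    rw [hbc] at this
    exact_mod_cast this
  set ν := transvection _ _ hbcQ with hν
  have hνx : ∀ x, om n (castV b) x = 0 → toC ν *ᵥ x = x + om n (castV c) x • castV b := fun x hx => by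
    rw [hν, toC_transvection_mulVec, hx, zero_smul, add_zero]
  have hνmem : ν ∈ congruenceSubgroup n (4 * m) := transvection_mem b c' hbcQ
  have hσν : ∀ x, sig (γ * ν) x = sig γ (toC ν *ᵥ x) := fun x => by
    rw [sig_apply, toC_mul_mulVec, sig_apply]
  have hσνx : ∀ x, om n (castV b) x = 0 →
      sig (γ * ν) x = sig γ x + (star (om n (castV c) x) * ε) • castV b := fun x hx => by
    rw [hσν, hνx x hx, map_add, LinearMap.map_smulₛₗ, hb, smul_smul]
    rfl
  refine ⟨γ * ν, Subgroup.mul_mem _ hγ hνmem, ?_, fun x hx => ?_, fun x hx => ⟨_, hσνx x hx⟩⟩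
  · rw [hσνx _ (om_self _), hcb, star_zero, zero_mul, zero_smul, add_zero, hb]
  · have h1 : om n (castV b) (sig (γ * ν) x) = 0 := by
      rw [hσνx x hx, map_add, map_smul, om_self, hbσ x hx, smul_zero, add_zero]
    have h2 : om n (castV c) (sig (γ * ν) x) = ε * star (om n (castV c) x) := by
      rw [hσνx x hx, map_add, map_smul, hcb, smul_zero, add_zero, hcσ x hx]
    have h3 : sig γ (sig (γ * ν) x)
        = sig γ (sig γ x) + (om n (castV c) x * ε * ε) • castV b := by
      rw [hσνx x hx, map_add, LinearMap.map_smulₛₗ, hb, smul_smul, ← Complex.star_def]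
      simp only [star_mul', star_star]
      rw [show star (ε : ℂ) = ε from Complex.conj_ofReal ε]
    rw [hσνx _ h1, h2, h3, hs' x hx]
    simp only [star_mul', star_star]
    rw [show star (ε : ℂ) = ε from Complex.conj_ofReal ε, add_assoc, add_assoc, ← add_smul,
      ← add_smul]
    convert add_zero x
    rw [smul_eq_zero]
    left
    linear_combination 2 * om n (castV c) x * hεC

/-- Given a `γ`-real point over a component of corank one, there are nearby `Γ(4m)`-real points of
`𝔥_n`. -/
theorem exists_near_real_point {q m : ℕ} (hm : 1 ≤ m) (hq : q ≤ q + 1) (g : SpQ (q + 1))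
    (z : siegel q) {γ : SpQ (q + 1)} (hγ : γ ∈ congruenceSubgroup (q + 1) (4 * m))
    (hz : tau (g • std hq z) = γ • g • std hq z) (k : ℝ) :
    ∃ Z : siegel (q + 1), Z.1.submatrix (Fin.castLE hq) (Fin.castLE hq) = z.1 ∧
      (Z.1.map Complex.im - k • Matrix.diagonal
        (fun i : Fin (q + 1) => if q ≤ (i : ℕ) then (1 : ℝ) else 0)).PosDef ∧
      ∃ γ' ∈ congruenceSubgroup (q + 1) (4 * m),
        tau (g • incl (q + 1) Z) = γ' • g • incl (q + 1) Z := by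
  rw [tau_smul_eq_iff] at hz
  set h := (tauSp g)⁻¹ * γ * g with hh
  have hs := (tau_std_iff z h).1 hz
  set e : Fin (q + 1) ⊕ Fin (q + 1) → ℂ := Pi.single (Sum.inl (Fin.last q)) 1 with he
  have heL : e ∈ stdSub hq z.1 := single_inl_mem hq z.1 (by simp)
  -- vectors in the line spanned by `e`
  have hline : ∀ v : Fin (q + 1) ⊕ Fin (q + 1) → ℂ, (∀ j, v (Sum.inr j) = 0) →
      (∀ j : Fin (q + 1), (j : ℕ) < q → v (Sum.inl j) = 0) → v = v (Sum.inl (Fin.last q)) • e := by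
    intro v h1 h2
    ext x
    rcases x with x | x
    · refine Fin.lastCases ?_ (fun i => ?_) x
      · simp [he]
      · simp [he, (Fin.castSucc_lt_last i).ne, h2 i.castSucc i.2]
    · simp [he, h1 x]
  have hge : ∀ v, toC g *ᵥ sig h v = sig γ (toC g *ᵥ v) := toC_mulVec_sig g γ
  obtain ⟨t, ht, b, f, hb, hbf⟩ := exists_primitive_smul g (Sum.inl (Fin.last q))
  rw [← he] at hb
  have htC : (t : ℂ) ≠ 0 := by exact_mod_cast ht
  have hb0 : castV b ≠ 0 := fun h => by simp [h] at hbf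
  have hperp : ∀ v : Fin (q + 1) ⊕ Fin (q + 1) → ℂ, v (Sum.inr (Fin.last q)) = 0 →
      om (q + 1) (castV b) (toC g *ᵥ v) = 0 := fun v hv => by
    rw [hb, map_smul, LinearMap.smul_apply, om_toC, he, om_single_inl, hv, neg_zero, smul_zero]
  have hperp' : ∀ x, om (q + 1) (castV b) x = 0 → (toC g⁻¹ *ᵥ x) (Sum.inr (Fin.last q)) = 0 := by
    intro x hx
    rw [hb, map_smul, LinearMap.smul_apply, ← toC_mulVec_inv g x, om_toC, he, om_single_inl,
      smul_neg, neg_eq_zero] at hx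
    exact (smul_eq_zero.1 hx).resolve_left htC
  -- the sign `ε`
  obtain ⟨hr, hl⟩ := stable_single_inl z hs (i := Fin.last q) (by simp)
  rw [← he] at hr hl
  set ε' := sig h e (Sum.inl (Fin.last q)) with hε'
  have hσe : sig h e = ε' • e := hline _ hr hl
  have hσb : sig γ (castV b) = ε' • castV b := by
    rw [hb, LinearMap.map_smulₛₗ, ← hge, hσe, mulVec_smul, Complex.conj_ofReal, smul_comm]
  have hint : ∀ a : Fin (q + 1) ⊕ Fin (q + 1) → ℤ, ∃ a', sig γ (castV a) = castV a' := by
    intro a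
    have : ∀ i, ∃ x : ℤ, sig γ (castV a) i = x := fun i => by
      choose s hs using fun j => (hasDenom_one_of_mem hγ).sig_single j i
      refine ⟨∑ j, a j * s j, ?_⟩
      rw [sig_eq_sum, Finset.sum_apply]
      push_cast
      refine Finset.sum_congr rfl fun j _ => ?_
      rw [← hs j]
      simp [castV]
    choose a' ha' using this
    exact ⟨a', funext ha'⟩
  obtain ⟨ε, hεε, hε⟩ : ∃ ε : ℝ, ε' = (ε : ℂ) ∧ ε * ε = 1 := by
    obtain ⟨b', hb'⟩ := hint b
    obtain ⟨f', hf'⟩ := hint f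
    obtain ⟨x, hx⟩ := exists_int_om b' f
    -- The scalar is an integer `x`, its pairing with `f`, and `ω(σ b, σ f) = -1` reads `x y = -1`;
    -- so it is a unit of `ℤ`.
    obtain ⟨y, hy⟩ := exists_int_om b f'
    rw [← hb', hσb, map_smul, LinearMap.smul_apply, hbf, smul_eq_mul, mul_one] at hx
    have h1 := om_sig γ (castV b) (castV f)
    rw [hσb, hf', map_smul, LinearMap.smul_apply, hy, hbf, hx, smul_eq_mul, star_one] at h1
    have h2 : x * y = -1 := by exact_mod_cast h1
    have h3 : IsUnit x := IsUnit.of_mul_eq_one (-y) (by linarith)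
    refine ⟨x, by rw [hx]; simp, ?_⟩
    have := Int.isUnit_mul_self h3
    exact_mod_cast this
  -- the square of `sig γ` on `b^⊥`
  have H : ∀ x, om (q + 1) (castV b) x = 0 → ∃ α : ℂ, sig γ (sig γ x) = x + α • castV b := by
    intro x hx
    obtain ⟨S, hS⟩ := tauSp_mul_self hγ
    set T := toC g⁻¹ * S.map (Int.castRingHom ℂ) * toC g with hT
    have hgg : toC g⁻¹ * toC g = 1 := by rw [← toC_mul, inv_mul_cancel, toC_one]
    have hgg' : toC g * toC g⁻¹ = 1 := by rw [← toC_mul, mul_inv_cancel, toC_one]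
    have hTeq : toC (tauSp h * h) = 1 + ((8 * m : ℕ) : ℂ) • T := by
      have h1 : tauSp h * h = g⁻¹ * (tauSp γ * γ) * g := by
        rw [hh, tauSp_mul, tauSp_mul, tauSp_inv, tauSp_tauSp]
        group
      rw [h1, toC_mul, toC_mul, hS, Matrix.mul_add, Matrix.add_mul, Matrix.mul_one, hgg,
        Matrix.mul_smul, Matrix.smul_mul]
    obtain ⟨d, hd, hgd⟩ := exists_hasDenom g
    -- Conjugation telescopes, so all powers of `T` share the denominator `d * d`.
    have hTpow : ∀ k, T ^ k = toC g⁻¹ * (S ^ k).map (Int.castRingHom ℂ) * toC g := by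
      intro k
      induction k with
      | zero =>
        rw [pow_zero, pow_zero, Matrix.map_one _ (map_zero _) (map_one _), Matrix.mul_one, hgg]
      | succ k ih =>
        rw [pow_succ, ih, hT, pow_succ, Matrix.map_mul]
        calc toC g⁻¹ * (S ^ k).map (Int.castRingHom ℂ) * toC g
              * (toC g⁻¹ * S.map (Int.castRingHom ℂ) * toC g)
            = toC g⁻¹ * (S ^ k).map (Int.castRingHom ℂ) * (toC g * toC g⁻¹)
              * S.map (Int.castRingHom ℂ) * toC g := by simp only [Matrix.mul_assoc]
          _ = _ := by
            rw [hgg', Matrix.mul_one]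
            simp only [Matrix.mul_assoc]
    have hTd : ∀ k i j, ∃ a : ℤ, ((d * d : ℕ) : ℂ) * (T ^ k) i j = a := by
      intro k i j
      choose A hA using hgd.inv.toC
      choose B hB using hgd.toC
      refine ⟨∑ l, (∑ r, A i r * (S ^ k) r l) * B l j, ?_⟩
      rw [hTpow]
      push_cast
      simp only [Matrix.mul_apply, Matrix.map_apply, eq_intCast, Finset.mul_sum, Finset.sum_mul,
        ← hA, ← hB]
      refine Finset.sum_congr rfl fun l _ => Finset.sum_congr rfl fun r _ => ?_
      ring
    have hv := hperp' x hx
    set v := toC g⁻¹ *ᵥ x with hvdef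
    obtain ⟨h1, h2⟩ := mulVec_eq_zero z hs (by omega : 4 ≤ 8 * m) hTeq (Nat.mul_pos hd hd) hTd
      (v := v) (fun i hi => by
        have : i = Fin.last q := Fin.ext (le_antisymm (Nat.lt_succ_iff.1 i.2) hi)
        rw [this, hv])
    have h3 := hline _ h1 h2
    set α := (T *ᵥ v) (Sum.inl (Fin.last q)) with hα
    refine ⟨((8 * m : ℕ) : ℂ) * α * (t : ℂ)⁻¹, ?_⟩
    have hxv : x = toC g *ᵥ v := by rw [hvdef, toC_mulVec_inv]
    rw [hxv, ← hge, ← hge, sig_sig_of_eq hTeq, h3, hb, mulVec_add, mulVec_smul, mulVec_smul,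
      smul_smul, smul_smul, mul_assoc, inv_mul_cancel₀ htC, mul_one]
  rw [hεε] at hσb
  obtain ⟨γ', hγ', h1, h2, h3⟩ := exists_involutive hγ hbf hε hσb H
  set h' := (tauSp g)⁻¹ * γ' * g with hh'
  have hge' : ∀ v, toC g *ᵥ sig h' v = sig γ' (toC g *ᵥ v) := toC_mulVec_sig g γ'
  have hinj : ∀ v w, toC g *ᵥ v = toC g *ᵥ w → v = w := fun v w hvw => by
    rw [← toC_inv_mulVec g v, hvw, toC_inv_mulVec]
  obtain ⟨Z, hZ1, hZ2, hZ3⟩ := exists_real_point hq z h' hε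
    -- On `b^⊥` the correction changes the map only by multiples of `b`; since `e` lies in the
    -- Lagrangian of `z`, reality at `z` survives.
    (fun v hv => by
      obtain ⟨α, hα⟩ := h3 _ (hperp v (mem_stdSub_succ.1 hv).2)
      have : sig h' v = sig h v + (α * t) • e := by
        apply hinj
        rw [hge', hα, mulVec_add, hge, mulVec_smul, hb, smul_smul]
      rw [this]
      exact add_mem (hs v hv) (Submodule.smul_mem _ _ heL))
    (by
      apply hinj
      apply smul_right_injective _ htC
      have : (t : ℂ) • (toC g *ᵥ sig h' e) = sig γ' (castV b) := by
        rw [hb, LinearMap.map_smulₛₗ, hge', Complex.conj_ofReal]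
      change (t : ℂ) • (toC g *ᵥ sig h' e) = (t : ℂ) • (toC g *ᵥ ((ε : ℂ) • e))
      rw [this, h1, hb, mulVec_smul, smul_comm])
    (fun v hv => by
      apply hinj
      rw [hge', hge', h2 _ (hperp v hv)]) k
  refine ⟨Z, hZ1, hZ2, γ', hγ', ?_⟩
  rw [tau_smul_eq_iff]
  exact (tau_std_iff Z h').2 hZ3

theorem componentReal_subset_closure {n m q : ℕ} (hm : 1 ≤ m) (hqn : q + 1 = n)
    {F : Set (Satake n)} (hF : IsRationalBoundaryComponent q F) {γ : SpQ n}
    (hγ : γ ∈ congruenceSubgroup n (4 * m)) :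
    componentReal F γ ⊆ closure (incl n '' groupRealLocus (congruenceSubgroup n (4 * m))) := by
  subst hqn
  obtain ⟨hq, g, rfl⟩ := hF
  rintro _ ⟨⟨z, rfl⟩, hx⟩
  rw [mem_closure_iff]
  intro U hU hxU
  obtain ⟨V, -, hzV, k, -, hk⟩ := hU q hq g z hxU
  obtain ⟨Z, hZ1, hZ2, γ', hγ', hZ3⟩ := exists_near_real_point hm hq g z hγ hx k
  -- The real point lies exactly over `z`, so the open set `V` imposes nothing beyond `z ∈ V`, and
  -- no saturation is needed: `δ = 1`.
  refine ⟨g • incl (q + 1) Z, hk _ ⟨q + 1, le_rfl, hq, Z, by rwa [hZ1], hZ2, 1,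
    ⟨Subgroup.one_mem _, fun w => one_smul _ _⟩, (one_smul _ _).symm⟩, ?_⟩
  rw [smul_incl] at hZ3 ⊢
  refine ⟨_, ?_, rfl⟩
  simp only [groupRealLocus, Set.mem_iUnion]
  exact ⟨γ', hγ', (mem_realLocus_iff γ' _).2 hZ3⟩

end RealSatake

end

theorem mainTheorem3 (n m : ℕ) (hm : 1 ≤ m) :
    (∀ (q : ℕ) (F : Set (RealSatake.Satake n)), q + 1 = n →
      RealSatake.IsRationalBoundaryComponent q F →
      ∀ γ ∈ RealSatake.congruenceSubgroup n (4 * m),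
        (RealSatake.componentReal F γ).Nonempty →
        RealSatake.componentReal F γ ⊆
          closure (RealSatake.incl n ''
            RealSatake.groupRealLocus (RealSatake.congruenceSubgroup n (4 * m)))) ∧
    RealSatake.stratumReal n (4 * m) 0 ∪ RealSatake.stratumReal n (4 * m) 1 ⊆
      closure (RealSatake.XReal n (4 * m)) ∧
    closure (RealSatake.XReal n (4 * m)) ⊆ RealSatake.VReal n (4 * m) := by
  refine ⟨fun q F hq hF γ hγ _ => RealSatake.componentReal_subset_closure hm hq hF hγ, ?_, ?_⟩
  · refine Set.union_subset ((RealSatake.stratumReal_zero_subset n (4 * m)).trans subset_closure)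
      (RealSatake.stratumReal_one_subset fun q F hq hF γ hγ =>
        RealSatake.componentReal_subset_closure hm hq hF hγ)
  · exact closure_minimal (fun v hv => hv.2) (RealSatake.isClosed_VReal n (4 * m))
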